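/- **Setting.** Let $d\in\mathbb N$, $T>0$, $\sigma\in(1,2)$, and let $\mu$ be a nonnegative Borel measure on $\mathbb R^d$ (a mass at the origin plays no role). Define $$\mathcal L u(x)=\int_{\mathbb R^d}\big(u(x+z)-u(x)-Du(x)\cdot z\,1_{|z|<1}\big)\,d\mu(z),$$ and let $\mathcal L^*$ be its adjoint, i.e. the operator of the same form with $\mu$ replaced by $\mu^*(B)=\mu(-B)$. The heat kernels are $K(t,\cdot)=\mathcal F^{-1}(e^{t\hat{\mathcal L}})$ and $K^*(t,\cdot)=\mathcal F^{-1}(e^{t\hat{\mathcal L}^*})$, where $\hat{\mathcal L}(\xi)=\int (e^{iz\cdot\xi}-1-i\xi\cdot z1_{|z|<1})\,d\mu(z)$ and $\hat{\mathcal L}^*$ is the same expression with $\mu^*$. Assume, with constants $\Lambda,c_0$ and $\mathcal K=(\mathcal K_{n,p})_{n\in\mathbb N_0,\,p\in[1,\infty)}$: * (L1) $\int 1\wedge|z|^2\,d\mu(z)\le\Lambda<\infty$; * (L2)(i) $r^\sigma\int_{|z|<1}\big(\tfrac{|z|^2}{r^2}\wedge1\big)\,d\mu(z)\le c_0$ for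 $r\in(0,1)$; * (L2)(ii) for $k=K$ and $k=K^*$ and all $t\in(0,T)$: $k(t,\cdot)\in C^\infty$, $k(t,\cdot)\ge0$, $\|k(t,\cdot)\|_{L^1}=1$, and $\|D^n k(t,\cdot)\|_{L^p}\le\mathcal K_{n,p}\,t^{-\frac1\sigma(n+(1-\frac1p)d)}$ for all $n\in\mathbb N_0$, $p\in[1,\infty)$. Let $b:[0,T]\times\mathbb R^d\to\mathbb R^d$ with $b,Db,D^2b\in C_b((0,T)\times\mathbb R^d)$ ($D$ is the derivative in $x$), and let $0\le m_0\in C_b^2(\mathbb R^d)$ with $\int m_0\,dx=1$. Consider $$\partial_t m-\mathcal L^*m+\operatorname{div}(bm)=0\ \text{ in }(0,T)\times\mathbb R^d,\qquad m(0,\cdot)=m_0.\tag{FP}$$ A *classical solution* of (FP) is an $m\in C([0,T]\times\mathbb R^d)$ such that $Dm,D^2m,\mathcal L^*m,\partial_tm$ exist and are continuous on $(0,T)\times\mathbb R^d$ (the integral $\mathcal L^*m$ being absolutely convergent) and (FP) holds at every point. A *modulus* is a nondecreasing $\omega:[0,\infty)\to[0,\infty)$ with $\lim_{r\to0}\omega(r)=0=\omega(0)$.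 **Proposition.** (a) There is a classical solution $m$ of (FP) with $m\ge0$ on $[0,T]\times\mathbb R^d$, $\int_{\mathbb R^d}m(t,x)\,dx=1$ for $t\in[0,T]$, $t\mapsto m(t,x)\,dx$ weakly continuous on $[0,T]$ as a map into the probability measures, and $m,Dm,D^2m,\partial_tm$ bounded on $(0,T)\times\mathbb R^d$ by a constant $c$ that depends only on $d$, $T$, $\sigma$, the constants $\Lambda,c_0,\mathcal K$, an upper bound for $\|D^kb\|_\infty$ and an upper bound for $\|D^km_0\|_\infty$ ($k=0,1,2$). It is unique among all bounded classical solutions of (FP). (b) For each $t\in[0,T]$, $m(t,\cdot)$ is differentiable, and there is a modulus $\tilde\omega$, depending only on $d$, $\Lambda$ and upper bounds for $\|D^km\|_\infty$ and $\|D^kb\|_\infty$ ($k=0,1,2$), such that for all $s,t\in[0,T]$, $x,y\in\mathbb R^d$, $$|m(t,x)-m(s,y)|+|Dm(t,x)-Dm(s,y)|\le\tilde\omega(|t-s|+|x-y|).$$ (c) Suppose in addition that $b$ and $Db$ are uniformly continuous on $(0,T)\times\mathbb R^d$ with moduli $\omega_b$ and $\omega_{Db}$ (with respect to $|t-s|+|x-y|$).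 Then $\mathcal L^*m$ and $\partial_tm$ (one-sided at $t=0,T$) exist on all of $[0,T]\times\mathbb R^d$, and there is a modulus $\omega$, depending only on $d$, $T$, $\sigma$, $\Lambda$, $c_0$, $\omega_b$, $\omega_{Db}$ and upper bounds for $\|D^kb\|_\infty$ and $\|D^km\|_\infty$ ($k=0,1,2$), such that for all $s,t\in[0,T]$, $x,y\in\mathbb R^d$, $$|\mathcal L^*m(t,x)-\mathcal L^*m(s,y)|+|\partial_tm(t,x)-\partial_tm(s,y)|\le\omega(|t-s|+|x-y|).$$ -/

import Mathlib

open Set Filter Topology MeasureTheory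
open scoped ENNReal FourierTransform

noncomputable section

/-- The Euclidean space `ℝ^d`. -/
abbrev RSpace (d : ℕ) : Type := EuclideanSpace ℝ (Fin d)

/-! ### The Lévy operator, its adjoint and its heat kernel -/

/-- The quantity `∫ 1 ∧ |z|² dμ(z)`. The Lévy condition is that it is finite; then `μ` is
a Radon measure on `ℝ^d ∖ {0}` (a mass at the origin plays no role). -/
def levyIntegral {d : ℕ} (μ : Measure (RSpace d)) : ℝ≥0∞ :=
  ∫⁻ z, ENNReal.ofReal (min 1 (‖z‖ ^ 2)) ∂μ

/-- The integrand `u(x+z) - u(x) - Du(x)·z 1_{|z|<1}` of the Lévy operator. -/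
def levyIntegrand {d : ℕ} (u : RSpace d → ℝ) (x z : RSpace d) : ℝ :=
  u (x + z) - u x - (Metric.ball (0 : RSpace d) 1).indicator (fun z => fderiv ℝ u x z) z

/-- The Lévy operator `𝓛 u(x) = ∫ u(x+z) - u(x) - Du(x)·z 1_{|z|<1} dμ(z)`. -/
def levyOp {d : ℕ} (μ : Measure (RSpace d)) (u : RSpace d → ℝ) (x : RSpace d) : ℝ :=
  ∫ z, levyIntegrand u x z ∂μ

/-- The antipodal measure `μ*(B) = μ(-B)`. The adjoint `𝓛*` is the Lévy operator of `μ*`. -/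
def antipodal {d : ℕ} (μ : Measure (RSpace d)) : Measure (RSpace d) :=
  μ.map (fun z => -z)

/-- The Fourier multiplier
`𝓛^(ξ) = ∫ (exp(i z·ξ) - 1 - i ξ·z 1_{|z|<1}) dμ(z)` of the Lévy operator. -/
def levySymbol {d : ℕ} (μ : Measure (RSpace d)) (ξ : RSpace d) : ℂ :=
  ∫ z, (Complex.exp (Complex.I * (inner ℝ z ξ : ℝ)) - 1
    - (Metric.ball (0 : RSpace d) 1).indicator
        (fun z => Complex.I * ((inner ℝ ξ z : ℝ) : ℂ)) z) ∂μ

/-- The heat kernel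
`K(t,x) = (2π)^{-d} ∫ exp(i x·ξ) exp(t 𝓛^(ξ)) dξ`. In Mathlib's normalization of the inverse
Fourier transform the frequency is `v = ξ / (2π)`. The integral is real, because
`𝓛^(-ξ)` is the complex conjugate of `𝓛^(ξ)`. -/
def heatKernel {d : ℕ} (μ : Measure (RSpace d)) (t : ℝ) (x : RSpace d) : ℝ :=
  ((𝓕⁻ (fun v : RSpace d =>
    Complex.exp ((t : ℂ) * levySymbol μ ((2 * Real.pi) • v))) : RSpace d → ℂ) x).re

/-- The upper bound `r^σ ∫_{|z|<1} (|z|²/r²) ∧ 1 dμ(z) ≤ c₀` for `r ∈ (0,1)`. -/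
def LevyUpperBound {d : ℕ} (μ : Measure (RSpace d)) (σ c₀ : ℝ) : Prop :=
  ∀ r ∈ Ioo (0 : ℝ) 1,
    ENNReal.ofReal (r ^ σ) *
      ∫⁻ z in Metric.ball (0 : RSpace d) 1, ENNReal.ofReal (min (‖z‖ ^ 2 / r ^ 2) 1) ∂μ
        ≤ ENNReal.ofReal c₀

/-- The heat kernel `K` of the Lévy operator of `μ` is smooth, `K ≥ 0`, `‖K(t,·)‖_{L¹} = 1`, and
`‖Dⁿ K(t,·)‖_{L^p} ≤ 𝒦(n,p) t^{-(n + (1-1/p) d)/σ}` for all `n ∈ ℕ`, `p ∈ [1,∞)`, `t ∈ (0,T)`. -/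
def HeatKernelBounds {d : ℕ} (μ : Measure (RSpace d)) (T σ : ℝ) (𝒦 : ℕ → ℝ → ℝ) : Prop :=
  ∀ t ∈ Ioo (0 : ℝ) T,
    ContDiff ℝ ((⊤ : ℕ∞) : WithTop ℕ∞) (heatKernel μ t) ∧ (∀ x, 0 ≤ heatKernel μ t x) ∧
    eLpNorm (heatKernel μ t) 1 volume = 1 ∧
    ∀ (n : ℕ) (p : ℝ), 1 ≤ p →
      eLpNorm (fun x => iteratedFDeriv ℝ n (heatKernel μ t) x) (ENNReal.ofReal p) volume
        ≤ ENNReal.ofReal (𝒦 n p * t ^ (-(((n : ℝ) + (1 - 1 / p) * d) / σ)))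

/-- The assumptions on `μ` with their constants: the Lévy condition with
`∫ 1 ∧ |z|² dμ ≤ Λ`, the upper bound of order `σ ∈ (1,2)` with constant `c₀`, and the heat kernel
bounds on `(0,T)` with constants `𝒦` for both `𝓛` and `𝓛*`. -/
structure LevyAssumptions {d : ℕ} (T σ Λ c₀ : ℝ) (𝒦 : ℕ → ℝ → ℝ) (μ : Measure (RSpace d)) :
    Prop where
  one_lt : 1 < σ
  lt_two : σ < 2
  levy : levyIntegral μ ≤ ENNReal.ofReal Λ
  upper : LevyUpperBound μ σ c₀
  kernel : HeatKernelBounds μ T σ 𝒦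
  kernel_adjoint : HeatKernelBounds (antipodal μ) T σ 𝒦

/-! ### Function spaces -/

/-- `f, Df, …, D^k f ∈ C_b((0,T) × ℝ^d)` with sup norms at most `C`; `D` is the derivative in
the space variable. -/
structure SpaceDerivsBoundedBy {d : ℕ} {F : Type*} [NormedAddCommGroup F] [NormedSpace ℝ F]
    (k : ℕ) (T C : ℝ) (f : ℝ → RSpace d → F) : Prop where
  contDiff : ∀ t ∈ Ioo (0 : ℝ) T, ContDiff ℝ k (f t)
  continuousOn : ∀ j ≤ k, ContinuousOn
    (fun q : ℝ × RSpace d => iteratedFDeriv ℝ j (f q.1) q.2) (Ioo (0 : ℝ) T ×ˢ univ)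
  bound : ∀ j ≤ k, ∀ t ∈ Ioo (0 : ℝ) T, ∀ x, ‖iteratedFDeriv ℝ j (f t) x‖ ≤ C

/-- A probability density `m₀ ∈ C_b²(ℝ^d)` with `‖D^j m₀‖_∞ ≤ M` for `j = 0, 1, 2`. -/
structure IsInitialDensity {d : ℕ} (M : ℝ) (m₀ : RSpace d → ℝ) : Prop where
  nonneg : ∀ x, 0 ≤ m₀ x
  contDiff : ContDiff ℝ 2 m₀
  bound : ∀ j ≤ 2, ∀ x, ‖iteratedFDeriv ℝ j m₀ x‖ ≤ M
  integrable : Integrable m₀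
  integral_eq_one : ∫ x, m₀ x = 1

/-- A modulus of continuity: `ω` is nondecreasing on `[0,∞)` and `ω(r) → 0 = ω(0)` as `r → 0`. -/
structure IsModulus (ω : ℝ → ℝ) : Prop where
  mono : MonotoneOn ω (Ici 0)
  zero : ω 0 = 0
  tendsto : Tendsto ω (𝓝[>] 0) (𝓝 0)

/-! ### The Fokker–Planck equation -/

/-- The divergence of a vector field on `ℝ^d`. -/
def divergence {d : ℕ} (V : RSpace d → RSpace d) (x : RSpace d) : ℝ :=
  ∑ i : Fin d, (fderiv ℝ V x (EuclideanSpace.single i 1)) i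

/-- `m` is a classical solution of `∂_t m - 𝓛* m + div(b m) = 0` in `(0,T) × ℝ^d`,
`m(0,·) = m₀`: `m ∈ C([0,T] × ℝ^d)`; `Dm, D²m, 𝓛* m, ∂_t m` exist and are continuous on
`(0,T) × ℝ^d`; and the equation holds at every point. -/
structure IsClassicalSolution {d : ℕ} (T : ℝ) (μ : Measure (RSpace d))
    (b : ℝ → RSpace d → RSpace d) (m₀ : RSpace d → ℝ) (m : ℝ → RSpace d → ℝ) : Prop where
  continuousOn : ContinuousOn (fun q : ℝ × RSpace d => m q.1 q.2) (Icc (0 : ℝ) T ×ˢ univ)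
  contDiff : ∀ t ∈ Ioo (0 : ℝ) T, ContDiff ℝ 2 (m t)
  continuousOn_space : ∀ j ≤ 2, ContinuousOn
    (fun q : ℝ × RSpace d => iteratedFDeriv ℝ j (m q.1) q.2) (Ioo (0 : ℝ) T ×ˢ univ)
  integrable : ∀ t ∈ Ioo (0 : ℝ) T, ∀ x, Integrable (levyIntegrand (m t) x) (antipodal μ)
  continuousOn_levy : ContinuousOn
    (fun q : ℝ × RSpace d => levyOp (antipodal μ) (m q.1) q.2) (Ioo (0 : ℝ) T ×ˢ univ)
  differentiable_time : ∀ t ∈ Ioo (0 : ℝ) T, ∀ x, DifferentiableAt ℝ (fun τ => m τ x) t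
  continuousOn_time : ContinuousOn
    (fun q : ℝ × RSpace d => deriv (fun τ => m τ q.2) q.1) (Ioo (0 : ℝ) T ×ˢ univ)
  equation : ∀ t ∈ Ioo (0 : ℝ) T, ∀ x,
    deriv (fun τ => m τ x) t - levyOp (antipodal μ) (m t) x
      + divergence (fun y => m t y • b t y) x = 0
  initial : ∀ x, m 0 x = m₀ x

end

/-! The equation is driven by the antipodal measure, so the relevant semigroup is the one with
kernel K*. The bounds on K* are used only for n = 1 and p = 1: ‖DK*(t)‖ in L¹ is at most C t^(-1/σ),
which is integrable at t = 0 because σ > 1.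

Existence. Characteristic functions turn the kernels into a convolution semigroup P_t of probability
measures (`exists_isHeatSemigroup`), and P_h g - g = ∫_0^h P_r 𝓛*g dr for every bounded g with
bounded Lipschitz gradient (`HasLipGrad.generatorFormula`). The equation is solved in the mild form
m = P_t m₀ - ∑ ∂ᵢK* ⋆ (bᵢ m), a convolution in space and time. One derivative stays on the kernel
and all others fall on bᵢ m, so two derivatives of b and m₀ control two derivatives of m. In norms
weighted by exp(-l t) the convolution operator has norm at most 1/2 once l is large, and the Neumann
series converges in C² and in L¹ (`exists_mild_solution`). The slices of ∂ᵢK* have integral zero,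
hence the mass is conserved. Moving the derivative off the kernel gives Duhamel's formula with
source -div(b m). Restarting it at time t and using the generator identity yields a right derivative
in time (`IsHeatSemigroup.hasDerivWithinAt_duhamel`). That derivative is continuous, hence
two-sided, and it is the equation.

Sign and uniqueness. Both follow from comparison of bounded classical solutions
(`IsClassicalSolution.le_of_initial_le`). This rests on `maximum_principle`, where a slowly varying
cutoff forces a maximum to be attained on the unbounded space.

Continuity of m and Dm. The equation bounds ∂_t m, so m is Lipschitz in time. Two functions with
N-Lipschitz gradients that differ by at most δ have gradients that differ by at most a constant
times √δ, so Dm is 1/2-Hölder in time (`HasLipGrad.norm_fderiv_sub_le`). The same interpolation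
carries the regularity to t = 0 and t = T.

Continuity of 𝓛*m and ∂_t m. The Lévy integral is split at |z| = ρ. The inner part is O(ρ^(2-σ)) by
Taylor's formula and the upper bound on μ; the outer part is controlled by the closeness of m and
Dm, at the price of a factor ρ^(-2) (`abs_levyOp_sub_le`). The equation transfers this to ∂_t m on
the open interval, and completeness extends it to the end points. The modulus is a supremum over all
admissible data, which makes it depend on the constants alone. -/

noncomputable section

/-! ### Functions with Lipschitz gradient and the Lévy operator -/

/-- `g` is differentiable, `g` and `Dg` are bounded by `N`, and `Dg` is `N`-Lipschitz. -/
structure HasLipGrad {d : ℕ} (N : ℝ) (g : RSpace d → ℝ) : Prop where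
  diff : Differentiable ℝ g
  bound : ∀ x, |g x| ≤ N
  bound_fderiv : ∀ x, ‖fderiv ℝ g x‖ ≤ N
  lip : ∀ x y, ‖fderiv ℝ g x - fderiv ℝ g y‖ ≤ N * ‖x - y‖

/-- The weight `1 ∧ |z|²`. -/
def levyWeight {d : ℕ} (z : RSpace d) : ℝ := min 1 (‖z‖ ^ 2)

section
variable {d : ℕ}

lemma levyWeight_nonneg (z : RSpace d) : 0 ≤ levyWeight z := le_min zero_le_one (sq_nonneg _)

lemma continuous_levyWeight : Continuous (levyWeight : RSpace d → ℝ) := by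
  unfold levyWeight; fun_prop

lemma levyWeight_of_lt {z : RSpace d} (h : ‖z‖ < 1) : levyWeight z = ‖z‖ ^ 2 :=
  min_eq_right (by nlinarith [norm_nonneg z])

lemma levyWeight_of_le {z : RSpace d} (h : 1 ≤ ‖z‖) : levyWeight z = 1 :=
  min_eq_left (by nlinarith [norm_nonneg z])

lemma norm_fderiv_sub_le_of_iteratedFDeriv {F : Type*} [NormedAddCommGroup F] [NormedSpace ℝ F]
    {N : ℝ} {g : RSpace d → F} (hg : ContDiff ℝ 2 g)
    (h : ∀ x, ‖iteratedFDeriv ℝ 2 g x‖ ≤ N) (x y : RSpace d) :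
    ‖fderiv ℝ g x - fderiv ℝ g y‖ ≤ N * ‖x - y‖ := by
  have h1 : Differentiable ℝ (fderiv ℝ g) :=
    (hg.fderiv_right (m := 1) (by norm_num)).differentiable (by norm_num)
  refine convex_univ.norm_image_sub_le_of_norm_fderiv_le (fun z _ => h1 z) (fun z _ => ?_)
    (mem_univ y) (mem_univ x)
  have := h z
  rwa [← norm_iteratedFDeriv_fderiv, ← norm_iteratedFDeriv_fderiv, norm_iteratedFDeriv_zero] at this

lemma HasLipGrad.of_iteratedFDeriv {N : ℝ} {g : RSpace d → ℝ} (hg : ContDiff ℝ 2 g)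
    (h : ∀ j ≤ 2, ∀ x, ‖iteratedFDeriv ℝ j g x‖ ≤ N) : HasLipGrad N g where
  diff := hg.differentiable (by norm_num)
  bound x := by simpa using h 0 (by norm_num) x
  bound_fderiv x := by
    have := h 1 (by norm_num) x
    rwa [← norm_iteratedFDeriv_fderiv, norm_iteratedFDeriv_zero] at this
  lip := norm_fderiv_sub_le_of_iteratedFDeriv hg (h 2 le_rfl)

lemma HasLipGrad.nonneg {N : ℝ} {g : RSpace d → ℝ} (hg : HasLipGrad N g) : 0 ≤ N :=
  (abs_nonneg _).trans (hg.bound 0)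

/-- The mean value inequality on the segment, with the derivative at `x` subtracted, needs no second
derivative. The constant is twice the sharp one, which is harmless here. -/
lemma taylor_of_lip_fderiv {N : ℝ} {g : RSpace d → ℝ} (hd : Differentiable ℝ g)
    (hl : ∀ x y, ‖fderiv ℝ g x - fderiv ℝ g y‖ ≤ N * ‖x - y‖) (hN : 0 ≤ N) (x z : RSpace d) :
    |g (x + z) - g x - fderiv ℝ g x z| ≤ N * ‖z‖ ^ 2 := by
  have := (convex_segment x (x + z)).norm_image_sub_le_of_norm_fderiv_le'
    (f := g) (φ := fderiv ℝ g x) (C := N * ‖z‖) (fun y _ => hd y) (fun y hy => ?_)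
    (left_mem_segment ℝ _ _) (right_mem_segment ℝ _ _)
  · rw [add_sub_cancel_left, Real.norm_eq_abs] at this
    linarith [this]
  · refine (hl y x).trans ?_
    gcongr
    simpa using norm_sub_le_of_mem_segment hy

lemma HasLipGrad.taylor {N : ℝ} {g : RSpace d → ℝ} (hg : HasLipGrad N g) (x z : RSpace d) :
    |g (x + z) - g x - fderiv ℝ g x z| ≤ N * ‖z‖ ^ 2 :=
  taylor_of_lip_fderiv hg.diff hg.lip hg.nonneg x z

lemma levyIntegrand_of_lt (g : RSpace d → ℝ) (x : RSpace d) {z : RSpace d} (h : ‖z‖ < 1) :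
    levyIntegrand g x z = g (x + z) - g x - fderiv ℝ g x z := by
  rw [levyIntegrand, indicator_of_mem (by simpa using h)]

lemma levyIntegrand_of_le (g : RSpace d → ℝ) (x : RSpace d) {z : RSpace d} (h : 1 ≤ ‖z‖) :
    levyIntegrand g x z = g (x + z) - g x := by
  rw [levyIntegrand, indicator_of_notMem (by simpa using h), sub_zero]

lemma HasLipGrad.abs_levyIntegrand_le {N : ℝ} {g : RSpace d → ℝ} (hg : HasLipGrad N g)
    (x z : RSpace d) : |levyIntegrand g x z| ≤ 2 * N * levyWeight z := by
  have hN := hg.nonneg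
  rcases lt_or_ge ‖z‖ 1 with h | h
  · rw [levyIntegrand_of_lt g x h, levyWeight_of_lt h]
    have := hg.taylor x z
    nlinarith [sq_nonneg ‖z‖]
  · rw [levyIntegrand_of_le g x h, levyWeight_of_le h]
    have := abs_sub (g (x + z)) (g x)
    linarith [hg.bound (x + z), hg.bound x]

lemma measurable_levyIntegrand {g : RSpace d → ℝ} (hg : Continuous g) (x : RSpace d) :
    Measurable (levyIntegrand g x) := by
  unfold levyIntegrand
  refine Measurable.sub (by fun_prop) ?_
  exact (fderiv ℝ g x).continuous.measurable.indicator Metric.isOpen_ball.measurableSet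

variable {ν : Measure (RSpace d)}

lemma integrable_levyWeight (hν : levyIntegral ν < ∞) : Integrable (levyWeight (d := d)) ν := by
  refine ⟨continuous_levyWeight.aestronglyMeasurable, ?_⟩
  rw [hasFiniteIntegral_iff_ofReal (ae_of_all _ levyWeight_nonneg)]
  exact hν

lemma integral_levyWeight_le {Λ : ℝ} (hν : levyIntegral ν ≤ ENNReal.ofReal Λ) :
    ∫ z, levyWeight z ∂ν ≤ max Λ 0 := by
  rw [integral_eq_lintegral_of_nonneg_ae (ae_of_all _ levyWeight_nonneg)
    continuous_levyWeight.aestronglyMeasurable]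
  refine ENNReal.toReal_le_of_le_ofReal (le_max_right _ _) (hν.trans ?_)
  exact ENNReal.ofReal_le_ofReal (le_max_left _ _)

lemma HasLipGrad.integrable_levyIntegrand {N : ℝ} {g : RSpace d → ℝ} (hg : HasLipGrad N g)
    (hν : levyIntegral ν < ∞) (x : RSpace d) : Integrable (levyIntegrand g x) ν :=
  ((integrable_levyWeight hν).const_mul (2 * N)).mono'
    (measurable_levyIntegrand hg.diff.continuous x).aestronglyMeasurable
    (ae_of_all _ (hg.abs_levyIntegrand_le x))

lemma HasLipGrad.abs_levyOp_le {N Λ : ℝ} {g : RSpace d → ℝ} (hg : HasLipGrad N g)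
    (hν : levyIntegral ν ≤ ENNReal.ofReal Λ) (x : RSpace d) :
    |levyOp ν g x| ≤ 2 * N * max Λ 0 := by
  have hν' : levyIntegral ν < ∞ := hν.trans_lt ENNReal.ofReal_lt_top
  refine (norm_integral_le_of_norm_le (f := levyIntegrand g x) ((integrable_levyWeight hν').const_mul (2 * N))
    (ae_of_all _ (hg.abs_levyIntegrand_le x))).trans ?_
  rw [integral_const_mul]
  have := hg.nonneg
  gcongr
  exact integral_levyWeight_le hν

/-- Dominated convergence with majorant `2 * N * levyWeight`. Function and base point vary together,
so one statement serves continuity in x, joint continuity in (t, x) and the approximation arguments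
for the generator. -/
lemma tendsto_levyOp {ι : Type*} {l : Filter ι} [l.IsCountablyGenerated] {N : ℝ}
    {g : ι → RSpace d → ℝ} {g₀ : RSpace d → ℝ} {x : ι → RSpace d} {x₀ : RSpace d}
    (hν : levyIntegral ν < ∞) (hg : ∀ᶠ i in l, HasLipGrad N (g i))
    (h0 : Tendsto (fun i => g i (x i)) l (𝓝 (g₀ x₀)))
    (h1 : ∀ z, Tendsto (fun i => g i (x i + z)) l (𝓝 (g₀ (x₀ + z))))
    (h2 : ∀ z, Tendsto (fun i => fderiv ℝ (g i) (x i) z) l (𝓝 (fderiv ℝ g₀ x₀ z))) :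
    Tendsto (fun i => levyOp ν (g i) (x i)) l (𝓝 (levyOp ν g₀ x₀)) := by
  refine tendsto_integral_filter_of_dominated_convergence (fun z => 2 * N * levyWeight z)
    (hg.mono fun i hi => (measurable_levyIntegrand hi.diff.continuous _).aestronglyMeasurable)
    (hg.mono fun i hi => ae_of_all _ (hi.abs_levyIntegrand_le _))
    ((integrable_levyWeight hν).const_mul (2 * N)) (ae_of_all _ fun z => ?_)
  rcases lt_or_ge ‖z‖ 1 with h | h
  · simp only [levyIntegrand_of_lt _ _ h]
    exact ((h1 z).sub h0).sub (h2 z)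
  · simp only [levyIntegrand_of_le _ _ h]
    exact (h1 z).sub h0

lemma HasLipGrad.continuous_fderiv {N : ℝ} {g : RSpace d → ℝ} (hg : HasLipGrad N g) :
    Continuous (fderiv ℝ g) :=
  (LipschitzWith.of_dist_le_mul (K := N.toNNReal) fun x y => by
    rw [dist_eq_norm, dist_eq_norm, Real.coe_toNNReal _ hg.nonneg]; exact hg.lip x y).continuous

lemma HasLipGrad.continuous_levyOp {N : ℝ} {g : RSpace d → ℝ} (hg : HasLipGrad N g)
    (hν : levyIntegral ν < ∞) : Continuous (levyOp ν g) := by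
  refine continuous_iff_continuousAt.2 fun x₀ => ?_
  have hc := hg.diff.continuous
  refine tendsto_levyOp (g := fun _ => g) (N := N) (x := fun x => x) hν
    (Eventually.of_forall fun _ => hg) (hc.tendsto x₀) (fun z => ?_) (fun z => ?_)
  · exact (hc.comp (continuous_id.add continuous_const)).tendsto x₀
  · exact (hg.continuous_fderiv.clm_apply continuous_const).tendsto x₀

/-! ### The antipodal measure -/

lemma lintegral_antipodal (μ : Measure (RSpace d)) {f : RSpace d → ℝ≥0∞} (hf : Measurable f) :
    ∫⁻ z, f z ∂(antipodal μ) = ∫⁻ z, f (-z) ∂μ :=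
  lintegral_map hf measurable_neg

lemma levyIntegral_antipodal (μ : Measure (RSpace d)) :
    levyIntegral (antipodal μ) = levyIntegral μ := by
  rw [levyIntegral, lintegral_antipodal _ (by fun_prop)]
  simp [levyIntegral]

lemma levyUpperBound_antipodal {μ : Measure (RSpace d)} {σ c₀ : ℝ} (h : LevyUpperBound μ σ c₀) :
    LevyUpperBound (antipodal μ) σ c₀ := by
  intro r hr
  refine le_trans (le_of_eq ?_) (h r hr)
  congr 1
  rw [← lintegral_indicator Metric.isOpen_ball.measurableSet,
    ← lintegral_indicator Metric.isOpen_ball.measurableSet, lintegral_antipodal]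
  · refine lintegral_congr fun z => ?_
    simp [indicator]
  · exact Measurable.indicator (by fun_prop) Metric.isOpen_ball.measurableSet

/-! ### Construction of moduli of continuity -/

/-- The modulus is the running supremum of the second coordinates over all pairs whose first
coordinate is at most r. Adjoining 0 keeps these sets nonempty and the supremum nonnegative. -/
lemma exists_isModulus (S : Set (ℝ × ℝ)) (C : ℝ) (h0 : ∀ p ∈ S, 0 ≤ p.1)
    (hC : ∀ p ∈ S, p.2 ≤ C) (hz : ∀ p ∈ S, p.1 = 0 → p.2 ≤ 0)
    (hε : ∀ ε > 0, ∃ δ > 0, ∀ p ∈ S, p.1 < δ → p.2 ≤ ε) :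
    ∃ ω : ℝ → ℝ, IsModulus ω ∧ ∀ p ∈ S, p.2 ≤ ω p.1 := by
  let A : ℝ → Set ℝ := fun r => insert 0 {v | ∃ s ≤ r, (s, v) ∈ S}
  have hA : ∀ r, BddAbove (A r) := fun r => by
    refine ⟨max C 0, ?_⟩
    rintro v (rfl | ⟨s, -, hs⟩)
    · exact le_max_right _ _
    · exact (hC _ hs).trans (le_max_left _ _)
  have hA0 : ∀ r, (A r).Nonempty := fun r => ⟨0, mem_insert _ _⟩
  have hpos : ∀ r, 0 ≤ sSup (A r) := fun r => le_csSup (hA r) (mem_insert _ _)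
  have hle : ∀ p ∈ S, p.2 ≤ sSup (A p.1) := fun p hp =>
    le_csSup (hA _) (mem_insert_of_mem _ ⟨p.1, le_rfl, hp⟩)
  refine ⟨fun r => sSup (A r), ⟨?_, ?_, ?_⟩, hle⟩
  · intro r _ r' _ hrr
    refine csSup_le_csSup (hA _) (hA0 _) (insert_subset_insert ?_)
    rintro v ⟨s, hs, hv⟩
    exact ⟨s, hs.trans hrr, hv⟩
  · refine le_antisymm (csSup_le (hA0 _) ?_) (hpos 0)
    rintro v (rfl | ⟨s, hs, hv⟩)
    · exact le_rfl
    · exact hz _ hv (le_antisymm hs (h0 _ hv))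
  · rw [Metric.tendsto_nhdsWithin_nhds]
    intro ε hε'
    obtain ⟨δ, hδ, h⟩ := hε (ε / 2) (half_pos hε')
    refine ⟨δ, hδ, fun {r} hr hrd => ?_⟩
    rw [Real.dist_eq, sub_zero] at hrd ⊢
    rw [abs_of_nonneg (hpos r)]
    refine lt_of_le_of_lt (csSup_le (hA0 _) ?_) (half_lt_self hε')
    rintro v (rfl | ⟨s, hs, hv⟩)
    · exact (half_pos hε').le
    · exact h _ hv (lt_of_le_of_lt hs (lt_of_le_of_lt (le_abs_self r) hrd))

end

/-! ### Bounds and uniform continuity for classical solutions with bounded derivatives -/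

section
variable {d : ℕ}

lemma SpaceDerivsBoundedBy.norm_le {F : Type*} [NormedAddCommGroup F] [NormedSpace ℝ F]
    {k : ℕ} {T C : ℝ} {f : ℝ → RSpace d → F} (h : SpaceDerivsBoundedBy k T C f) {t : ℝ}
    (ht : t ∈ Ioo 0 T) (x : RSpace d) : ‖f t x‖ ≤ C := by
  simpa using h.bound 0 (Nat.zero_le _) t ht x

lemma SpaceDerivsBoundedBy.norm_fderiv_le {F : Type*} [NormedAddCommGroup F] [NormedSpace ℝ F]
    {k : ℕ} {T C : ℝ} {f : ℝ → RSpace d → F} (h : SpaceDerivsBoundedBy k T C f) (hk : 1 ≤ k)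
    {t : ℝ} (ht : t ∈ Ioo 0 T) (x : RSpace d) : ‖fderiv ℝ (f t) x‖ ≤ C := by
  have := h.bound 1 hk t ht x
  rwa [← norm_iteratedFDeriv_fderiv, norm_iteratedFDeriv_zero] at this

lemma SpaceDerivsBoundedBy.hasLipGrad {T C : ℝ} {f : ℝ → RSpace d → ℝ}
    (h : SpaceDerivsBoundedBy 2 T C f) {t : ℝ} (ht : t ∈ Ioo 0 T) : HasLipGrad C (f t) :=
  .of_iteratedFDeriv (h.contDiff t ht) fun j hj x => h.bound j hj t ht x

lemma SpaceDerivsBoundedBy.differentiable {F : Type*} [NormedAddCommGroup F] [NormedSpace ℝ F]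
    {T C : ℝ} {f : ℝ → RSpace d → F}
    (h : SpaceDerivsBoundedBy 2 T C f) {t : ℝ} (ht : t ∈ Ioo 0 T) : Differentiable ℝ (f t) :=
  (h.contDiff t ht).differentiable (by norm_num)

lemma abs_divergence_le_of_norm (A : RSpace d →L[ℝ] RSpace d) :
    |∑ i : Fin d, (A (EuclideanSpace.single i 1)) i| ≤ d * ‖A‖ := by
  refine (Finset.abs_sum_le_sum_abs _ _).trans ?_
  calc ∑ i : Fin d, |(A (EuclideanSpace.single i 1)) i| ≤ ∑ i : Fin d, ‖A‖ := by
        refine Finset.sum_le_sum fun i _ => ?_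
        rw [← Real.norm_eq_abs]
        refine (PiLp.norm_apply_le _ i).trans ?_
        simpa using A.le_opNorm (EuclideanSpace.single i (1 : ℝ))
    _ = d * ‖A‖ := by simp

lemma abs_divergence_le (V : RSpace d → RSpace d) (x : RSpace d) :
    |divergence V x| ≤ d * ‖fderiv ℝ V x‖ := abs_divergence_le_of_norm _

lemma abs_divergence_sub_le (V W : RSpace d → RSpace d) (x y : RSpace d) :
    |divergence V x - divergence W y| ≤ d * ‖fderiv ℝ V x - fderiv ℝ W y‖ := by
  refine le_trans (le_of_eq ?_) (abs_divergence_le_of_norm (fderiv ℝ V x - fderiv ℝ W y))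
  simp [divergence]

lemma clm_eq_sum_single (A : RSpace d →L[ℝ] ℝ) (v : RSpace d) :
    A v = ∑ i : Fin d, v i * A (EuclideanSpace.single i 1) := by
  conv_lhs => rw [← (EuclideanSpace.basisFun (Fin d) ℝ).sum_repr v]
  simp

lemma divergence_smul {f : RSpace d → ℝ} {V : RSpace d → RSpace d} {x : RSpace d}
    (hf : DifferentiableAt ℝ f x) (hV : DifferentiableAt ℝ V x) :
    divergence (fun y => f y • V y) x = f x * divergence V x + fderiv ℝ f x (V x) := by
  rw [divergence, fderiv_fun_smul hf hV, clm_eq_sum_single (fderiv ℝ f x), divergence,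
    Finset.mul_sum, ← Finset.sum_add_distrib]
  refine Finset.sum_congr rfl fun i _ => ?_
  simp [mul_comm]

/-- The bound for the time derivative of a solution. -/
def timeDerivBound (d : ℕ) (Λ B N : ℝ) : ℝ := 2 * N * max Λ 0 + (d + 1) * (N * B)

variable {T σ Λ c₀ B M N : ℝ} {𝒦 : ℕ → ℝ → ℝ} {μ : Measure (RSpace d)}
  {b : ℝ → RSpace d → RSpace d} {m₀ : RSpace d → ℝ} {m : ℝ → RSpace d → ℝ}

lemma LevyAssumptions.levy_antipodal (h : LevyAssumptions T σ Λ c₀ 𝒦 μ) :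
    levyIntegral (antipodal μ) ≤ ENNReal.ofReal Λ :=
  (levyIntegral_antipodal μ).trans_le h.levy

lemma LevyAssumptions.levy_antipodal_lt (h : LevyAssumptions T σ Λ c₀ 𝒦 μ) :
    levyIntegral (antipodal μ) < ∞ := h.levy_antipodal.trans_lt ENNReal.ofReal_lt_top

lemma IsClassicalSolution.deriv_eq (hm : IsClassicalSolution T μ b m₀ m)
    (hb : SpaceDerivsBoundedBy 2 T B b) {t : ℝ} (ht : t ∈ Ioo 0 T) (x : RSpace d) :
    deriv (fun τ => m τ x) t = levyOp (antipodal μ) (m t) x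
      - (m t x * divergence (b t) x + fderiv ℝ (m t) x (b t x)) := by
  have h := hm.equation t ht x
  rw [divergence_smul (((hm.contDiff t ht).differentiable (by norm_num)) x)
    (hb.differentiable ht x)] at h
  linarith

lemma abs_deriv_le (hμ : levyIntegral (antipodal μ) ≤ ENNReal.ofReal Λ)
    (hb : SpaceDerivsBoundedBy 2 T B b) (hm : IsClassicalSolution T μ b m₀ m)
    (hN : SpaceDerivsBoundedBy 2 T N m) {t : ℝ} (ht : t ∈ Ioo 0 T) (x : RSpace d) :
    |deriv (fun τ => m τ x) t| ≤ timeDerivBound d Λ B N := by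
  rw [hm.deriv_eq hb ht x]
  have h1 := (hN.hasLipGrad ht).abs_levyOp_le hμ x
  have h2 : |m t x * divergence (b t) x| ≤ N * (d * B) := by
    rw [abs_mul]
    refine mul_le_mul (hN.norm_le ht x) ((abs_divergence_le _ _).trans ?_) (abs_nonneg _)
      (hN.hasLipGrad ht).nonneg
    gcongr
    exact hb.norm_fderiv_le (by norm_num) ht x
  have h3 : |fderiv ℝ (m t) x (b t x)| ≤ N * B := by
    refine ((fderiv ℝ (m t) x).le_opNorm _).trans ?_
    exact mul_le_mul (hN.norm_fderiv_le (by norm_num) ht x) (hb.norm_le ht x) (norm_nonneg _)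
      (hN.hasLipGrad ht).nonneg
  have h4 := abs_sub (levyOp (antipodal μ) (m t) x)
    (m t x * divergence (b t) x + fderiv ℝ (m t) x (b t x))
  have h5 := abs_add_le (m t x * divergence (b t) x) (fderiv ℝ (m t) x (b t x))
  unfold timeDerivBound
  linarith

/-! ### Lipschitz bounds in time and passage to the end points of the time interval. -/

lemma abs_sub_le_of_abs_deriv_le {f : ℝ → ℝ} {C : ℝ} (hc : ContinuousOn f (Icc 0 T))
    (hd : ∀ t ∈ Ioo 0 T, DifferentiableAt ℝ f t) (hC : ∀ t ∈ Ioo 0 T, |deriv f t| ≤ C)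
    {s t : ℝ} (hs : s ∈ Icc 0 T) (ht : t ∈ Icc 0 T) : |f t - f s| ≤ C * |t - s| := by
  wlog h : s < t generalizing s t
  · rcases eq_or_lt_of_le (not_lt.1 h) with rfl | h'
    · simp
    · rw [abs_sub_comm, abs_sub_comm t s]; exact this ht hs h'
  have hsub : Ioo s t ⊆ Ioo 0 T := Ioo_subset_Ioo hs.1 ht.2
  obtain ⟨c, hc, he⟩ := exists_deriv_eq_slope f h (hc.mono (Icc_subset_Icc hs.1 ht.2))
    (fun c hc => (hd c (hsub hc)).differentiableWithinAt)
  have h1 : f t - f s = deriv f c * (t - s) := by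
    rw [he, div_mul_cancel₀ _ (sub_pos.2 h).ne']
  rw [h1, abs_mul]
  gcongr
  exact hC c (hsub hc)

lemma IsClassicalSolution.continuousOn_apply (hm : IsClassicalSolution T μ b m₀ m)
    (x : RSpace d) : ContinuousOn (fun τ => m τ x) (Icc 0 T) :=
  hm.continuousOn.comp (f := fun τ : ℝ => (τ, x)) (by fun_prop) fun τ hτ => ⟨hτ, mem_univ _⟩

/-- Interpolation: functions with Lipschitz gradient that are uniformly close have close
gradients. -/
lemma HasLipGrad.norm_fderiv_sub_le {f g : RSpace d → ℝ} {δ : ℝ} (hf : HasLipGrad N f)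
    (hg : HasLipGrad N g) (h : ∀ x, |f x - g x| ≤ δ) (x : RSpace d) :
    ‖fderiv ℝ f x - fderiv ℝ g x‖ ≤ (2 + 2 * N) * √δ := by
  have hN := hf.nonneg
  have hδ : 0 ≤ δ := (abs_nonneg _).trans (h 0)
  rcases hδ.eq_or_lt with rfl | hδ
  · have : f = g := by
      funext y
      simpa [sub_eq_zero] using h y
    simp [this]
  have hs := Real.sqrt_pos.2 hδ
  refine ContinuousLinearMap.opNorm_le_bound _ (by positivity) fun v => ?_
  rcases eq_or_ne v 0 with rfl | hv
  · simp
  have hv' : 0 < ‖v‖ := norm_pos_iff.2 hv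
  -- The length √δ balances the Taylor error N‖z‖² against the uniform distance δ.
  set z := (√δ / ‖v‖) • v with hz
  have hzn : ‖z‖ ^ 2 = δ := by
    rw [hz, norm_smul, Real.norm_of_nonneg (by positivity), div_mul_cancel₀ _ hv'.ne',
      Real.sq_sqrt hδ.le]
  have h1 := hf.taylor x z
  have h2 := hg.taylor x z
  rw [hzn] at h1 h2
  have h3 := h (x + z)
  have h4 := h x
  have h5 : |fderiv ℝ f x z - fderiv ℝ g x z| ≤ (2 + 2 * N) * δ := by
    rw [abs_le] at *
    constructor <;> linarith
  have h6 : fderiv ℝ f x z - fderiv ℝ g x z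
      = (√δ / ‖v‖) * (fderiv ℝ f x v - fderiv ℝ g x v) := by
    simp [hz, mul_sub]
  rw [h6, abs_mul, abs_of_nonneg (by positivity), div_mul_eq_mul_div, div_le_iff₀ hv'] at h5
  have h7 : √δ * |fderiv ℝ f x v - fderiv ℝ g x v| ≤ √δ * ((2 + 2 * N) * √δ * ‖v‖) := by
    refine h5.trans (le_of_eq ?_)
    nth_rewrite 1 [← Real.mul_self_sqrt hδ.le]
    ring
  simpa using le_of_mul_le_mul_left h7 hs

/-- By the interpolation inequality, uniform convergence of the functions already makes the
gradients uniformly Cauchy, so nothing need be assumed about convergence of gradients. -/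
lemma HasLipGrad.of_tendsto {f : ℕ → RSpace d → ℝ} {g : RSpace d → ℝ} {δ : ℕ → ℝ}
    (hf : ∀ n, HasLipGrad N (f n)) (hδ : Tendsto δ atTop (𝓝 0))
    (h : ∀ n x, |f n x - g x| ≤ δ n) : HasLipGrad N g := by
  have hlim : ∀ x, Tendsto (fun n => f n x) atTop (𝓝 (g x)) := fun x => by
    rw [tendsto_iff_norm_sub_tendsto_zero]
    exact squeeze_zero (fun n => norm_nonneg _) (fun n => h n x) hδ
  have hb : ∀ n k x, ‖fderiv ℝ (f n) x - fderiv ℝ (f k) x‖ ≤ (2 + 2 * N) * √(δ n + δ k) :=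
    fun n k => (hf n).norm_fderiv_sub_le (hf k) fun x => by
      have h1 := h n x
      have h2 := h k x
      rw [abs_le] at *
      constructor <;> linarith
  have hδ2 : Tendsto (fun p : ℕ × ℕ => (2 + 2 * N) * √(δ p.1 + δ p.2)) (atTop ×ˢ atTop)
      (𝓝 0) := by
    have : Tendsto (fun p : ℕ × ℕ => δ p.1 + δ p.2) (atTop ×ˢ atTop) (𝓝 (0 + 0)) :=
      (hδ.comp tendsto_fst).add (hδ.comp tendsto_snd)
    simpa using ((Real.continuous_sqrt.tendsto _).comp this).const_mul (2 + 2 * N)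
  have hcau : UniformCauchySeqOn (fun n => fderiv ℝ (f n)) atTop univ := by
    rw [Metric.uniformCauchySeqOn_iff]
    intro ε hε
    rw [prod_atTop_atTop_eq] at hδ2
    obtain ⟨K, hK⟩ := (eventually_atTop_prod_self'.1
      ((hδ2.eventually_lt_const hε)))
    refine ⟨K, fun n hn k hk x _ => ?_⟩
    rw [dist_eq_norm]
    exact (hb n k x).trans_lt (hK n hn k hk)
  have hex : ∀ x, ∃ G, Tendsto (fun n => fderiv ℝ (f n) x) atTop (𝓝 G) := fun x =>
    cauchySeq_tendsto_of_complete (hcau.cauchySeq (mem_univ x))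
  choose G hG using hex
  have hunif := hcau.tendstoUniformlyOn_of_tendsto (fun x _ => hG x)
  rw [tendstoUniformlyOn_univ] at hunif
  have hd : ∀ x, HasFDerivAt g (G x) x := hasFDerivAt_of_tendstoUniformly hunif
    (fun n x => ((hf n).diff x).hasFDerivAt) hlim
  refine ⟨fun x => (hd x).differentiableAt, fun x => ?_, fun x => ?_, fun x y => ?_⟩
  · exact le_of_tendsto (hlim x).abs (Eventually.of_forall fun n => (hf n).bound x)
  · rw [(hd x).fderiv]
    exact le_of_tendsto (hG x).norm (Eventually.of_forall fun n => (hf n).bound_fderiv x)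
  · rw [(hd x).fderiv, (hd y).fderiv]
    exact le_of_tendsto ((hG x).sub (hG y)).norm (Eventually.of_forall fun n => (hf n).lip x y)

lemma exists_seq_Ioo_tendsto (hT : 0 < T) {t : ℝ} (ht : t ∈ Icc 0 T) :
    ∃ τ : ℕ → ℝ, (∀ n, τ n ∈ Ioo 0 T) ∧ Tendsto τ atTop (𝓝 t) := by
  have : t ∈ closure (Ioo 0 T) := by rwa [closure_Ioo hT.ne]
  exact mem_closure_iff_seq_limit.1 this

lemma abs_sub_time_le (hμ : levyIntegral (antipodal μ) ≤ ENNReal.ofReal Λ)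
    (hb : SpaceDerivsBoundedBy 2 T B b) (hm : IsClassicalSolution T μ b m₀ m)
    (hN : SpaceDerivsBoundedBy 2 T N m) {s t : ℝ} (hs : s ∈ Icc 0 T) (ht : t ∈ Icc 0 T)
    (x : RSpace d) : |m t x - m s x| ≤ timeDerivBound d Λ B N * |t - s| :=
  abs_sub_le_of_abs_deriv_le (hm.continuousOn_apply x)
    (fun _ hτ => hm.differentiable_time _ hτ x) (fun _ hτ => abs_deriv_le hμ hb hm hN hτ x) hs ht

/-- The hypotheses bound space derivatives only for t in the open interval. At 0 and T the function
is a uniform limit of interior slices; C² regularity may be lost there, but the Lipschitz gradient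
survives and is all that the Lévy operator needs. -/
lemma hasLipGrad_of_mem_Icc (hT : 0 < T) (hμ : levyIntegral (antipodal μ) ≤ ENNReal.ofReal Λ)
    (hb : SpaceDerivsBoundedBy 2 T B b) (hm : IsClassicalSolution T μ b m₀ m)
    (hN : SpaceDerivsBoundedBy 2 T N m) {t : ℝ} (ht : t ∈ Icc 0 T) : HasLipGrad N (m t) := by
  obtain ⟨τ, hτ, hτt⟩ := exists_seq_Ioo_tendsto hT ht
  refine HasLipGrad.of_tendsto (f := fun n => m (τ n))
    (δ := fun n => timeDerivBound d Λ B N * |τ n - t|) (fun n => hN.hasLipGrad (hτ n)) ?_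
    fun n x => abs_sub_time_le hμ hb hm hN ht (Ioo_subset_Icc_self (hτ n)) x
  simpa using ((hτt.sub_const t).abs).const_mul (timeDerivBound d Λ B N)

lemma abs_sub_le_of_classical (hT : 0 < T)
    (hμ : levyIntegral (antipodal μ) ≤ ENNReal.ofReal Λ)
    (hb : SpaceDerivsBoundedBy 2 T B b) (hm : IsClassicalSolution T μ b m₀ m)
    (hN : SpaceDerivsBoundedBy 2 T N m) {s t : ℝ} (hs : s ∈ Icc 0 T) (ht : t ∈ Icc 0 T)
    (x y : RSpace d) :
    |m t x - m s y| ≤ timeDerivBound d Λ B N * |t - s| + N * ‖x - y‖ := by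
  have h1 := abs_sub_time_le hμ hb hm hN hs ht x
  have hL := hasLipGrad_of_mem_Icc hT hμ hb hm hN hs
  have h2 := convex_univ.norm_image_sub_le_of_norm_fderiv_le (fun z _ => hL.diff z)
    (fun z _ => hL.bound_fderiv z) (mem_univ y) (mem_univ x)
  rw [Real.norm_eq_abs] at h2
  have := abs_sub_le (m t x) (m s x) (m s y)
  linarith

lemma norm_fderiv_sub_le_of_classical (hT : 0 < T)
    (hμ : levyIntegral (antipodal μ) ≤ ENNReal.ofReal Λ)
    (hb : SpaceDerivsBoundedBy 2 T B b) (hm : IsClassicalSolution T μ b m₀ m)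
    (hN : SpaceDerivsBoundedBy 2 T N m) {s t : ℝ} (hs : s ∈ Icc 0 T) (ht : t ∈ Icc 0 T)
    (x y : RSpace d) :
    ‖fderiv ℝ (m t) x - fderiv ℝ (m s) y‖
      ≤ (2 + 2 * N) * √(timeDerivBound d Λ B N * |t - s|) + N * ‖x - y‖ := by
  have hs' := hasLipGrad_of_mem_Icc hT hμ hb hm hN hs
  have ht' := hasLipGrad_of_mem_Icc hT hμ hb hm hN ht
  have h1 := ht'.norm_fderiv_sub_le hs' (fun x => abs_sub_time_le hμ hb hm hN hs ht x) x
  have h2 := hs'.lip x y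
  have := norm_sub_le_norm_sub_add_norm_sub (fderiv ℝ (m t) x) (fderiv ℝ (m s) x)
    (fderiv ℝ (m s) y)
  linarith

lemma timeDerivBound_nonneg (hB : 0 ≤ B) (hN : 0 ≤ N) : 0 ≤ timeDerivBound d Λ B N := by
  unfold timeDerivBound; positivity

lemma SpaceDerivsBoundedBy.const_nonneg {F : Type*} [NormedAddCommGroup F] [NormedSpace ℝ F]
    {k : ℕ} {f : ℝ → RSpace d → F} (h : SpaceDerivsBoundedBy k T B f) (hT : 0 < T) : 0 ≤ B :=
  (norm_nonneg _).trans (h.norm_le (t := T / 2) ⟨by linarith, by linarith⟩ 0)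

theorem exists_modulus_solution_gradient (d : ℕ) (Λ B N : ℝ) : ∃ ω' : ℝ → ℝ, IsModulus ω' ∧
      ∀ (T σ c₀ : ℝ) (𝒦 : ℕ → ℝ → ℝ) (M : ℝ), 0 < T →
      ∀ (μ : Measure (RSpace d)) (b : ℝ → RSpace d → RSpace d) (m₀ : RSpace d → ℝ),
        LevyAssumptions T σ Λ c₀ 𝒦 μ → SpaceDerivsBoundedBy 2 T B b → IsInitialDensity M m₀ →
        ∀ m : ℝ → RSpace d → ℝ,
          IsClassicalSolution T μ b m₀ m → SpaceDerivsBoundedBy 2 T N m →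
          (∀ t ∈ Icc (0 : ℝ) T, Differentiable ℝ (m t)) ∧
          ∀ s ∈ Icc (0 : ℝ) T, ∀ t ∈ Icc (0 : ℝ) T, ∀ x y : RSpace d,
            |m t x - m s y| + ‖fderiv ℝ (m t) x - fderiv ℝ (m s) y‖
              ≤ ω' (|t - s| + ‖x - y‖) := by
  -- The modulus is fixed before any solution is given, when `B` and `N` are arbitrary reals. Their
  -- positive parts make it monotone; any actual b and m force both constants to be nonnegative.
  set K := timeDerivBound d Λ (max B 0) (max N 0) with hK
  have hK0 : 0 ≤ K := timeDerivBound_nonneg (le_max_right _ _) (le_max_right _ _)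
  have hN0 : 0 ≤ max N 0 := le_max_right _ _
  refine ⟨fun r => (K + 2 * max N 0) * r + (2 + 2 * max N 0) * √(K * r), ⟨?_, ?_, ?_⟩, ?_⟩
  · intro r _ s _ hrs
    dsimp only
    gcongr
  · simp
  · have : Continuous fun r => (K + 2 * max N 0) * r + (2 + 2 * max N 0) * √(K * r) := by
      fun_prop
    simpa using (this.tendsto 0).mono_left nhdsWithin_le_nhds
  · intro T σ c₀ 𝒦 M hT μ b m₀ hμ hb hm₀ m hm hN
    refine ⟨fun t ht => (hasLipGrad_of_mem_Icc hT hμ.levy_antipodal hb hm hN ht).diff, ?_⟩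
    intro s hs t ht x y
    have h1 := abs_sub_le_of_classical hT hμ.levy_antipodal hb hm hN hs ht x y
    have h2 := norm_fderiv_sub_le_of_classical hT hμ.levy_antipodal hb hm hN hs ht x y
    rw [max_eq_left (hb.const_nonneg hT), max_eq_left (hN.const_nonneg hT)] at hK
    rw [max_eq_left (hN.const_nonneg hT)] at hN0 ⊢
    rw [← hK] at h1 h2
    have h3 : √(K * |t - s|) ≤ √(K * (|t - s| + ‖x - y‖)) := by
      gcongr; linarith [norm_nonneg (x - y)]
    have h4 : (2 + 2 * N) * √(K * |t - s|) ≤ (2 + 2 * N) * √(K * (|t - s| + ‖x - y‖)) := by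
      gcongr
    nlinarith [norm_nonneg (x - y), abs_nonneg (t - s), mul_nonneg hK0 (norm_nonneg (x - y)),
      mul_nonneg hN0 (abs_nonneg (t - s))]

end

/-! ### Uniform continuity of the terms of the equation -/

section
variable {d : ℕ}

/-- For |z| < ρ the minimum in the upper bound with r = ρ is |z|²/ρ², so the integral is at most ρ²
· ρ^(-σ) c₀. -/
lemma integral_indicator_sq_le {ν : Measure (RSpace d)} {σ c₀ ρ : ℝ} (h : LevyUpperBound ν σ c₀)
    (hρ : ρ ∈ Ioo (0 : ℝ) 1) :
    ∫ z, (Metric.ball (0 : RSpace d) ρ).indicator (fun z => ‖z‖ ^ 2) z ∂ν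
      ≤ ρ ^ (2 - σ) * max c₀ 0 := by
  have hmeas : Measurable ((Metric.ball (0 : RSpace d) ρ).indicator (fun z => ‖z‖ ^ 2)) :=
    Measurable.indicator (by fun_prop) Metric.isOpen_ball.measurableSet
  have hρ0 := hρ.1
  have hpow : 0 ≤ ρ ^ (2 - σ) := Real.rpow_nonneg hρ0.le _
  rw [integral_eq_lintegral_of_nonneg_ae
    (ae_of_all _ fun z => indicator_nonneg (fun _ _ => sq_nonneg _) z) hmeas.aestronglyMeasurable]
  refine ENNReal.toReal_le_of_le_ofReal (by positivity) ?_
  calc ∫⁻ z, ENNReal.ofReal ((Metric.ball (0 : RSpace d) ρ).indicator (fun z => ‖z‖ ^ 2) z) ∂ν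
      ≤ ∫⁻ z, ENNReal.ofReal (ρ ^ 2) * (Metric.ball (0 : RSpace d) 1).indicator
          (fun z => ENNReal.ofReal (min (‖z‖ ^ 2 / ρ ^ 2) 1)) z ∂ν := by
        refine lintegral_mono fun z => ?_
        by_cases hz : z ∈ Metric.ball (0 : RSpace d) ρ
        · have hz' : ‖z‖ < ρ := by simpa using hz
          have hz1 : z ∈ Metric.ball (0 : RSpace d) 1 := by
            simpa using hz'.trans hρ.2
          rw [indicator_of_mem hz, indicator_of_mem hz1, ← ENNReal.ofReal_mul (by positivity)]
          refine ENNReal.ofReal_le_ofReal ?_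
          rw [min_eq_left]
          · rw [mul_div_cancel₀ _ (by positivity)]
          · rw [div_le_one (by positivity)]
            gcongr
        · rw [indicator_of_notMem hz]; simp
    _ = ENNReal.ofReal (ρ ^ (2 - σ)) * (ENNReal.ofReal (ρ ^ σ) *
          ∫⁻ z in Metric.ball (0 : RSpace d) 1, ENNReal.ofReal (min (‖z‖ ^ 2 / ρ ^ 2) 1) ∂ν) := by
        rw [lintegral_const_mul, lintegral_indicator Metric.isOpen_ball.measurableSet, ← mul_assoc,
          ← ENNReal.ofReal_mul hpow, ← Real.rpow_add hρ0]
        · simp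
        · exact Measurable.indicator (by fun_prop) Metric.isOpen_ball.measurableSet
    _ ≤ ENNReal.ofReal (ρ ^ (2 - σ)) * ENNReal.ofReal c₀ := by gcongr; exact h ρ hρ
    _ ≤ ENNReal.ofReal (ρ ^ (2 - σ) * max c₀ 0) := by
        rw [← ENNReal.ofReal_mul hpow]
        refine ENNReal.ofReal_le_ofReal ?_
        gcongr
        exact le_max_left _ _

/-- For |z| < ρ each integrand is at most N|z|² by Taylor. For |z| ≥ ρ the difference of the
integrands is at most 2δ₀ + δ₁, and 1 ≤ `levyWeight z` / ρ² there. -/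
lemma abs_levyOp_sub_le {ν : Measure (RSpace d)} {σ c₀ Λ ρ N δ₀ δ₁ : ℝ} {g h : RSpace d → ℝ}
    {x y : RSpace d} (hν : levyIntegral ν ≤ ENNReal.ofReal Λ) (hu : LevyUpperBound ν σ c₀)
    (hρ : ρ ∈ Ioo (0 : ℝ) 1) (hg : HasLipGrad N g) (hh : HasLipGrad N h)
    (h0 : ∀ z, |g (x + z) - h (y + z)| ≤ δ₀) (h1 : ‖fderiv ℝ g x - fderiv ℝ h y‖ ≤ δ₁) :
    |levyOp ν g x - levyOp ν h y|
      ≤ 2 * N * (ρ ^ (2 - σ) * max c₀ 0) + (2 * δ₀ + δ₁) / ρ ^ 2 * max Λ 0 := by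
  have hν' : levyIntegral ν < ∞ := hν.trans_lt ENNReal.ofReal_lt_top
  have hρ0 := hρ.1
  have hN := hg.nonneg
  have hδ₀ : 0 ≤ δ₀ := (abs_nonneg _).trans (h0 0)
  have hδ₁ : 0 ≤ δ₁ := (norm_nonneg _).trans h1
  have hW := integrable_levyWeight hν'
  have hmeas : Measurable ((Metric.ball (0 : RSpace d) ρ).indicator (fun z => ‖z‖ ^ 2)) :=
    Measurable.indicator (by fun_prop) Metric.isOpen_ball.measurableSet
  have hI : Integrable ((Metric.ball (0 : RSpace d) ρ).indicator (fun z => ‖z‖ ^ 2)) ν := by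
    refine hW.mono' hmeas.aestronglyMeasurable (ae_of_all _ fun z => ?_)
    by_cases hz : z ∈ Metric.ball (0 : RSpace d) ρ
    · have hz' : ‖z‖ < 1 := lt_trans (by simpa using hz) hρ.2
      rw [indicator_of_mem hz, levyWeight_of_lt hz', Real.norm_of_nonneg (sq_nonneg _)]
    · rw [indicator_of_notMem hz, norm_zero]; exact levyWeight_nonneg z
  have hsub : levyOp ν g x - levyOp ν h y = ∫ z, (levyIntegrand g x z - levyIntegrand h y z) ∂ν :=
    (integral_sub (hg.integrable_levyIntegrand hν' x) (hh.integrable_levyIntegrand hν' y)).symm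
  rw [hsub]
  refine (norm_integral_le_of_norm_le (f := fun z => levyIntegrand g x z - levyIntegrand h y z)
    ((hI.const_mul (2 * N)).add (hW.const_mul ((2 * δ₀ + δ₁) / ρ ^ 2)))
    (ae_of_all _ fun z => ?_)).trans ?_
  · simp only [Pi.add_apply, Real.norm_eq_abs]
    have hW0 : 0 ≤ (2 * δ₀ + δ₁) / ρ ^ 2 * levyWeight z :=
      mul_nonneg (by positivity) (levyWeight_nonneg z)
    have hz0 := h0 z
    have hz1 : |g x - h y| ≤ δ₀ := by simpa using h0 0
    rcases lt_or_ge ‖z‖ ρ with hz | hz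
    · have hz1 : ‖z‖ < 1 := hz.trans hρ.2
      rw [indicator_of_mem (by simpa using hz), levyIntegrand_of_lt _ _ hz1,
        levyIntegrand_of_lt _ _ hz1]
      have := hg.taylor x z
      have := hh.taylor y z
      have := abs_sub (g (x + z) - g x - fderiv ℝ g x z) (h (y + z) - h y - fderiv ℝ h y z)
      linarith
    · rw [indicator_of_notMem (by simpa using hz), mul_zero, zero_add]
      rcases lt_or_ge ‖z‖ 1 with hz' | hz'
      · rw [levyIntegrand_of_lt _ _ hz', levyIntegrand_of_lt _ _ hz', levyWeight_of_lt hz',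
          div_mul_eq_mul_div, le_div_iff₀ (by positivity)]
        have h3 : |fderiv ℝ g x z - fderiv ℝ h y z| ≤ δ₁ := by
          refine ((fderiv ℝ g x - fderiv ℝ h y).le_opNorm z).trans ?_
          nlinarith [norm_nonneg (fderiv ℝ g x - fderiv ℝ h y), norm_nonneg z]
        have h4 : |g (x + z) - g x - fderiv ℝ g x z - (h (y + z) - h y - fderiv ℝ h y z)|
            ≤ 2 * δ₀ + δ₁ := by
          rw [abs_le] at *
          constructor <;> linarith
        refine mul_le_mul h4 (by gcongr) (by positivity) (by positivity)
      · rw [levyIntegrand_of_le _ _ hz', levyIntegrand_of_le _ _ hz', levyWeight_of_le hz', mul_one]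
        have h4 : |g (x + z) - g x - (h (y + z) - h y)| ≤ 2 * δ₀ + δ₁ := by
          rw [abs_le] at *
          constructor <;> linarith
        refine h4.trans (le_div_self (by positivity) (by positivity) ?_)
        nlinarith [hρ.2]
  · rw [integral_add' (hI.const_mul _) (hW.const_mul _), integral_const_mul, integral_const_mul]
    gcongr
    · exact integral_indicator_sq_le hu hρ
    · exact integral_levyWeight_le hν

variable {T σ Λ c₀ B M N : ℝ} {𝒦 : ℕ → ℝ → ℝ} {μ : Measure (RSpace d)}
  {b : ℝ → RSpace d → RSpace d} {m₀ : RSpace d → ℝ} {m : ℝ → RSpace d → ℝ}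

lemma exists_delta_levyOp (d : ℕ) {σ B N : ℝ} (Λ c₀ : ℝ) (hσ : σ < 2) {ε : ℝ} (hε : 0 < ε) :
    ∃ δ > 0, ∀ (T : ℝ) (𝒦 : ℕ → ℝ → ℝ) (μ : Measure (RSpace d))
      (b : ℝ → RSpace d → RSpace d) (m₀ : RSpace d → ℝ) (m : ℝ → RSpace d → ℝ), 0 < T →
      LevyAssumptions T σ Λ c₀ 𝒦 μ → SpaceDerivsBoundedBy 2 T B b →
      IsClassicalSolution T μ b m₀ m → SpaceDerivsBoundedBy 2 T N m →
      ∀ s ∈ Icc (0 : ℝ) T, ∀ t ∈ Icc (0 : ℝ) T, ∀ x y : RSpace d, |t - s| + ‖x - y‖ < δ →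
        |levyOp (antipodal μ) (m t) x - levyOp (antipodal μ) (m s) y| ≤ ε := by
  set K := timeDerivBound d Λ B N with hK
  have hlim : Tendsto (fun ρ : ℝ => 2 * N * (ρ ^ (2 - σ) * max c₀ 0)) (𝓝[>] 0) (𝓝 0) := by
    have h1 : Tendsto (fun ρ : ℝ => ρ ^ (2 - σ)) (𝓝[>] 0) (𝓝 0) := by
      have := (Real.continuousAt_rpow_const 0 (2 - σ) (Or.inr (by linarith))).tendsto
      rw [Real.zero_rpow (by linarith)] at this
      exact this.mono_left nhdsWithin_le_nhds
    simpa using (h1.mul_const (max c₀ 0)).const_mul (2 * N)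
  -- The radius is fixed first, using only σ < 2. The factor ρ^(-2) is then a constant, and δ is
  -- chosen small against it.
  obtain ⟨ρ, hρ1, hρ⟩ := ((hlim.eventually_lt_const (half_pos hε)).and
    (Ioo_mem_nhdsGT (zero_lt_one' ℝ))).exists
  have hcont : Continuous fun r : ℝ => (2 * (K * r + N * r) +
      ((2 + 2 * N) * √(K * r) + N * r)) / ρ ^ 2 * max Λ 0 := by fun_prop
  have hlim2 := hcont.tendsto 0
  simp only [mul_zero, add_zero, Real.sqrt_zero, zero_div, zero_mul] at hlim2
  obtain ⟨δ, hδ, hδ'⟩ := Metric.eventually_nhds_iff.1 (hlim2.eventually_lt_const (half_pos hε))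
  refine ⟨δ, hδ, fun T 𝒦 μ b m₀ m hT hμ hb hm hN s hs t ht x y hr => ?_⟩
  have hN0 := hN.const_nonneg hT
  have hK0 : 0 ≤ K := timeDerivBound_nonneg (hb.const_nonneg hT) hN0
  set r := |t - s| + ‖x - y‖ with hrdef
  have hr0 : 0 ≤ r := by positivity
  have h2 := hδ' (y := r) (by rwa [Real.dist_eq, sub_zero, abs_of_nonneg hr0])
  have htr : |t - s| ≤ r := le_add_of_nonneg_right (norm_nonneg _)
  have hxr : ‖x - y‖ ≤ r := le_add_of_nonneg_left (abs_nonneg _)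
  have h3 := abs_levyOp_sub_le (δ₀ := K * r + N * r)
    (δ₁ := (2 + 2 * N) * √(K * r) + N * r) (x := x) (y := y) hμ.levy_antipodal
    (levyUpperBound_antipodal hμ.upper) hρ
    (hasLipGrad_of_mem_Icc hT hμ.levy_antipodal hb hm hN ht)
    (hasLipGrad_of_mem_Icc hT hμ.levy_antipodal hb hm hN hs) (fun z => ?_) ?_
  · linarith
  · refine (abs_sub_le_of_classical hT hμ.levy_antipodal hb hm hN hs ht _ _).trans ?_
    rw [add_sub_add_right_eq_sub]
    gcongr
  · refine (norm_fderiv_sub_le_of_classical hT hμ.levy_antipodal hb hm hN hs ht _ _).trans ?_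
    gcongr

lemma exists_delta_deriv (d : ℕ) {σ B N : ℝ} (Λ c₀ : ℝ) (hσ : σ < 2) {ωb ωDb : ℝ → ℝ}
    (hωb : IsModulus ωb) (hωDb : IsModulus ωDb) {ε : ℝ} (hε : 0 < ε) :
    ∃ δ > 0, ∀ (T : ℝ) (𝒦 : ℕ → ℝ → ℝ) (μ : Measure (RSpace d))
      (b : ℝ → RSpace d → RSpace d) (m₀ : RSpace d → ℝ) (m : ℝ → RSpace d → ℝ), 0 < T →
      LevyAssumptions T σ Λ c₀ 𝒦 μ → SpaceDerivsBoundedBy 2 T B b →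
      (∀ s ∈ Ioo (0 : ℝ) T, ∀ t ∈ Ioo (0 : ℝ) T, ∀ x y : RSpace d,
          ‖b t x - b s y‖ ≤ ωb (|t - s| + ‖x - y‖) ∧
          ‖fderiv ℝ (b t) x - fderiv ℝ (b s) y‖ ≤ ωDb (|t - s| + ‖x - y‖)) →
      IsClassicalSolution T μ b m₀ m → SpaceDerivsBoundedBy 2 T N m →
      ∀ s ∈ Ioo (0 : ℝ) T, ∀ t ∈ Ioo (0 : ℝ) T, ∀ x y : RSpace d, |t - s| + ‖x - y‖ < δ →
        |deriv (fun τ => m τ x) t - deriv (fun τ => m τ y) s| ≤ ε := by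
  obtain ⟨δ₁, hδ₁, h₁⟩ := exists_delta_levyOp d (B := B) (N := N) Λ c₀ hσ (half_pos hε)
  set K := timeDerivBound d Λ B N with hK
  have hω : Tendsto (fun r => N * (d * ωDb r) + (K * r + N * r) * (d * B) + (N * ωb r +
      ((2 + 2 * N) * √(K * r) + N * r) * B)) (𝓝[≥] 0) (𝓝 0) := by
    -- The point r = 0 must be included, since (s, y) = (t, x) is allowed; there the limit statement
    -- is replaced by ω(0) = 0.
    have e1 : ∀ {ω : ℝ → ℝ}, IsModulus ω → Tendsto ω (𝓝[≥] 0) (𝓝 0) := fun {ω} h => by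
      rw [← Ioi_insert, nhdsWithin_insert]
      have h0 := tendsto_pure_nhds ω 0
      rw [h.zero] at h0
      exact h0.sup h.tendsto
    have e2 : Continuous fun r : ℝ => (K * r + N * r) * (d * B) := by fun_prop
    have e3 : Continuous fun r : ℝ => ((2 + 2 * N) * √(K * r) + N * r) * B := by fun_prop
    have e2' := (e2.tendsto 0).mono_left (nhdsWithin_le_nhds (s := Ici 0))
    have e3' := (e3.tendsto 0).mono_left (nhdsWithin_le_nhds (s := Ici 0))
    simpa using ((((e1 hωDb).const_mul (d : ℝ)).const_mul N).add e2').add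
      (((e1 hωb).const_mul N).add e3')
  obtain ⟨δ₂, hδ₂, h₂⟩ := Metric.mem_nhdsWithin_iff.1 (hω.eventually_lt_const (half_pos hε))
  refine ⟨min δ₁ δ₂, lt_min hδ₁ hδ₂, fun T 𝒦 μ b m₀ m hT hμ hb hω hm hN s hs t ht x y hr => ?_⟩
  have hN0 := hN.const_nonneg hT
  have hB0 := hb.const_nonneg hT
  have hs' := Ioo_subset_Icc_self hs
  have ht' := Ioo_subset_Icc_self ht
  have hK0 : 0 ≤ K := timeDerivBound_nonneg hB0 hN0
  have i1 := h₁ T 𝒦 μ b m₀ m hT hμ hb hm hN s hs' t ht' x y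
    (hr.trans_le (min_le_left _ _))
  obtain ⟨i2, i3⟩ := hω s hs t ht x y
  have i4 := abs_sub_le_of_classical hT hμ.levy_antipodal hb hm hN hs' ht' x y
  have i5 := norm_fderiv_sub_le_of_classical hT hμ.levy_antipodal hb hm hN hs' ht' x y
  set r := |t - s| + ‖x - y‖ with hrdef
  have hr0 : 0 ≤ r := by positivity
  have i6 := @h₂ r ⟨by
    rw [Metric.mem_ball, Real.dist_eq, sub_zero, abs_of_nonneg hr0]
    exact hr.trans_le (min_le_right _ _), hr0⟩
  change _ < ε / 2 at i6
  have htr : |t - s| ≤ r := le_add_of_nonneg_right (norm_nonneg _)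
  have hxr : ‖x - y‖ ≤ r := le_add_of_nonneg_left (abs_nonneg _)
  have i4' : |m t x - m s y| ≤ K * r + N * r := i4.trans (by gcongr)
  have i5' : ‖fderiv ℝ (m t) x - fderiv ℝ (m s) y‖ ≤ (2 + 2 * N) * √(K * r) + N * r :=
    i5.trans (by gcongr)
  have j1 : |m t x * divergence (b t) x - m s y * divergence (b s) y|
      ≤ N * (d * ωDb r) + (K * r + N * r) * (d * B) := by
    have e : m t x * divergence (b t) x - m s y * divergence (b s) y
        = m t x * (divergence (b t) x - divergence (b s) y)
          + (m t x - m s y) * divergence (b s) y := by ring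
    rw [e]
    refine (abs_add_le _ _).trans (add_le_add ?_ ?_)
    · rw [abs_mul]
      refine mul_le_mul (hN.norm_le ht x) ((abs_divergence_sub_le _ _ _ _).trans ?_)
        (abs_nonneg _) hN0
      gcongr
    · rw [abs_mul]
      refine mul_le_mul i4' ((abs_divergence_le _ _).trans ?_) (abs_nonneg _) (by positivity)
      gcongr
      exact hb.norm_fderiv_le (by norm_num) hs y
  have j2 : |fderiv ℝ (m t) x (b t x) - fderiv ℝ (m s) y (b s y)|
      ≤ N * ωb r + ((2 + 2 * N) * √(K * r) + N * r) * B := by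
    have e : fderiv ℝ (m t) x (b t x) - fderiv ℝ (m s) y (b s y)
        = fderiv ℝ (m t) x (b t x - b s y)
          + (fderiv ℝ (m t) x - fderiv ℝ (m s) y) (b s y) := by simp
    rw [e]
    refine (abs_add_le _ _).trans (add_le_add ?_ ?_)
    · refine ((fderiv ℝ (m t) x).le_opNorm _).trans ?_
      exact mul_le_mul (hN.norm_fderiv_le (by norm_num) ht x) i2 (norm_nonneg _) hN0
    · refine ((fderiv ℝ (m t) x - fderiv ℝ (m s) y).le_opNorm _).trans ?_
      exact mul_le_mul i5' (hb.norm_le hs y) (norm_nonneg _) (by positivity)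
  rw [hm.deriv_eq hb ht x, hm.deriv_eq hb hs y]
  rw [abs_le] at *
  constructor <;> linarith

/-- A uniformly continuous derivative maps the filter at an end point to a Cauchy filter, hence has
a limit, and the limit of the derivative is then the one-sided derivative. -/
lemma exists_hasDerivWithinAt_of_uniformContinuousOn_deriv {f : ℝ → ℝ} (hT : 0 < T)
    (hc : ContinuousOn f (Icc 0 T)) (hd : ∀ t ∈ Ioo 0 T, DifferentiableAt ℝ f t)
    (hu : UniformContinuousOn (deriv f) (Ioo 0 T)) {t : ℝ} (ht : t ∈ Icc 0 T) :
    ∃ e, HasDerivWithinAt f e (Icc 0 T) t ∧ Tendsto (deriv f) (𝓝[Ioo 0 T] t) (𝓝 e) := by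
  have hcl : closure (Ioo 0 T) = Icc 0 T := closure_Ioo hT.ne
  have hne : (𝓝[Ioo 0 T] t).NeBot := mem_closure_iff_nhdsWithin_neBot.1 (by rwa [hcl])
  have hcau : Cauchy (map (deriv f) (𝓝[Ioo 0 T] t)) :=
    Cauchy.map_of_le (cauchy_nhds.mono nhdsWithin_le_nhds) hu inf_le_right
  obtain ⟨e, he⟩ := CompleteSpace.complete hcau
  refine ⟨e, ?_, he⟩
  have h := hasFDerivWithinAt_closure_of_tendsto_fderiv (f := f) (s := Ioo 0 T) (x := t)
    (f' := ContinuousLinearMap.toSpanSingleton ℝ e)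
    (fun τ hτ => (hd τ hτ).differentiableWithinAt) (convex_Ioo 0 T) isOpen_Ioo
    (fun y hy => (hc y (by rwa [hcl] at hy)).mono Ioo_subset_Icc_self) ?_
  · rwa [hcl] at h
  · have : (fun x => fderiv ℝ f x)
        = fun x => ContinuousLinearMap.toSpanSingleton ℝ (deriv f x) := by
      funext x
      exact toSpanSingleton_deriv.symm
    rw [this]
    exact ((ContinuousLinearMap.toSpanSingletonCLE (𝕜 := ℝ) (E := ℝ)).continuous.tendsto e).comp he

theorem exists_modulus_equation_terms (d : ℕ) (T σ Λ c₀ B N : ℝ) (ωb ωDb : ℝ → ℝ) (hT : 0 < T)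
    (hωb : IsModulus ωb) (hωDb : IsModulus ωDb) : ∃ ω : ℝ → ℝ, IsModulus ω ∧
      ∀ (𝒦 : ℕ → ℝ → ℝ) (M : ℝ)
        (μ : Measure (RSpace d)) (b : ℝ → RSpace d → RSpace d) (m₀ : RSpace d → ℝ),
        LevyAssumptions T σ Λ c₀ 𝒦 μ → SpaceDerivsBoundedBy 2 T B b → IsInitialDensity M m₀ →
        (∀ s ∈ Ioo (0 : ℝ) T, ∀ t ∈ Ioo (0 : ℝ) T, ∀ x y : RSpace d,
          ‖b t x - b s y‖ ≤ ωb (|t - s| + ‖x - y‖) ∧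
          ‖fderiv ℝ (b t) x - fderiv ℝ (b s) y‖ ≤ ωDb (|t - s| + ‖x - y‖)) →
        ∀ m : ℝ → RSpace d → ℝ,
          IsClassicalSolution T μ b m₀ m → SpaceDerivsBoundedBy 2 T N m →
          (∀ t ∈ Icc (0 : ℝ) T, ∀ x,
            Integrable (levyIntegrand (m t) x) (antipodal μ) ∧
            DifferentiableWithinAt ℝ (fun τ => m τ x) (Icc (0 : ℝ) T) t) ∧
          ∀ s ∈ Icc (0 : ℝ) T, ∀ t ∈ Icc (0 : ℝ) T, ∀ x y : RSpace d,
            |levyOp (antipodal μ) (m t) x - levyOp (antipodal μ) (m s) y|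
              + |derivWithin (fun τ => m τ x) (Icc (0 : ℝ) T) t
                  - derivWithin (fun τ => m τ y) (Icc (0 : ℝ) T) s|
              ≤ ω (|t - s| + ‖x - y‖) := by
  -- The kernel constants and the initial datum are quantified inside, so the supremum that defines
  -- the modulus runs over them and the modulus cannot depend on them.
  let Adm : Measure (RSpace d) → (ℝ → RSpace d → RSpace d) → (ℝ → RSpace d → ℝ) → Prop :=
    fun μ b m => ∃ (𝒦 : ℕ → ℝ → ℝ) (m₀ : RSpace d → ℝ), LevyAssumptions T σ Λ c₀ 𝒦 μ ∧
      SpaceDerivsBoundedBy 2 T B b ∧ (∀ s ∈ Ioo (0 : ℝ) T, ∀ t ∈ Ioo (0 : ℝ) T,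
        ∀ x y : RSpace d, ‖b t x - b s y‖ ≤ ωb (|t - s| + ‖x - y‖) ∧
          ‖fderiv ℝ (b t) x - fderiv ℝ (b s) y‖ ≤ ωDb (|t - s| + ‖x - y‖)) ∧
      IsClassicalSolution T μ b m₀ m ∧ SpaceDerivsBoundedBy 2 T N m
  have hder : ∀ μ b m, Adm μ b m → ∀ t ∈ Icc (0 : ℝ) T, ∀ x : RSpace d,
      DifferentiableWithinAt ℝ (fun τ => m τ x) (Icc 0 T) t ∧
      Tendsto (deriv fun τ => m τ x) (𝓝[Ioo 0 T] t)
        (𝓝 (derivWithin (fun τ => m τ x) (Icc 0 T) t)) := by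
    rintro μ b m ⟨𝒦, m₀, hμ, hb, hω, hm, hN⟩ t ht x
    have hu : UniformContinuousOn (deriv fun τ => m τ x) (Ioo 0 T) := by
      rw [Metric.uniformContinuousOn_iff]
      intro ε hε
      obtain ⟨δ, hδ, h⟩ := exists_delta_deriv d (B := B) (N := N) Λ c₀ hμ.lt_two hωb hωDb
        (half_pos hε)
      refine ⟨δ, hδ, fun s hs τ hτ hd => ?_⟩
      rw [Real.dist_eq] at hd ⊢
      exact (h T 𝒦 μ b m₀ m hT hμ hb hω hm hN τ hτ s hs x x (by simpa using hd)).trans_lt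
        (half_lt_self hε)
    obtain ⟨e, he, hl⟩ := exists_hasDerivWithinAt_of_uniformContinuousOn_deriv hT
      (hm.continuousOn_apply x) (fun τ hτ => hm.differentiable_time τ hτ x) hu ht
    refine ⟨he.differentiableWithinAt, ?_⟩
    rwa [he.derivWithin (uniqueDiffOn_Icc hT t ht)]
  let S : Set (ℝ × ℝ) := {p | ∃ μ b m, Adm μ b m ∧ ∃ s ∈ Icc (0 : ℝ) T, ∃ t ∈ Icc (0 : ℝ) T,
    ∃ x y : RSpace d, p = (|t - s| + ‖x - y‖,
      |levyOp (antipodal μ) (m t) x - levyOp (antipodal μ) (m s) y|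
              + |derivWithin (fun τ => m τ x) (Icc (0 : ℝ) T) t
                  - derivWithin (fun τ => m τ y) (Icc (0 : ℝ) T) s|)}
  suffices h : ∃ ω : ℝ → ℝ, IsModulus ω ∧ ∀ p ∈ S, p.2 ≤ ω p.1 by
    obtain ⟨ω, hω, hS⟩ := h
    refine ⟨ω, hω, fun 𝒦 M μ b m₀ hμ hb _ hωb' m hm hN => ?_⟩
    have hA : Adm μ b m := ⟨𝒦, m₀, hμ, hb, hωb', hm, hN⟩
    refine ⟨fun t ht x => ⟨?_, (hder μ b m hA t ht x).1⟩, fun s hs t ht x y => ?_⟩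
    · exact (hasLipGrad_of_mem_Icc hT hμ.levy_antipodal hb hm hN ht).integrable_levyIntegrand
        hμ.levy_antipodal_lt x
    · exact hS (_, _) ⟨μ, b, m, hA, s, hs, t, ht, x, y, rfl⟩
  refine exists_isModulus S (2 * (2 * N * max Λ 0) + 2 * timeDerivBound d Λ B N) ?_ ?_ ?_ ?_
  · rintro _ ⟨μ, b, m, hA, s, hs, t, ht, x, y, rfl⟩
    positivity
  · rintro _ ⟨μ, b, m, hA, s, hs, t, ht, x, y, rfl⟩
    obtain ⟨𝒦, m₀, hμ, hb, hω, hm, hN⟩ := id hA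
    have h1 : ∀ t ∈ Icc 0 T, ∀ x, |levyOp (antipodal μ) (m t) x| ≤ 2 * N * max Λ 0 :=
      fun t ht x => (hasLipGrad_of_mem_Icc hT hμ.levy_antipodal hb hm hN ht).abs_levyOp_le
        hμ.levy_antipodal x
    have h2 : ∀ t ∈ Icc 0 T, ∀ x, |derivWithin (fun τ => m τ x) (Icc 0 T) t|
        ≤ timeDerivBound d Λ B N := fun t ht x => by
      have hne : (𝓝[Ioo 0 T] t).NeBot :=
        mem_closure_iff_nhdsWithin_neBot.1 (by rwa [closure_Ioo hT.ne])
      refine le_of_tendsto (hder μ b m hA t ht x).2.abs ?_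
      filter_upwards [self_mem_nhdsWithin] with τ hτ
      exact abs_deriv_le hμ.levy_antipodal hb hm hN hτ x
    have := abs_sub (levyOp (antipodal μ) (m t) x) (levyOp (antipodal μ) (m s) y)
    have := abs_sub (derivWithin (fun τ => m τ x) (Icc (0 : ℝ) T) t)
      (derivWithin (fun τ => m τ y) (Icc (0 : ℝ) T) s)
    linarith [h1 t ht x, h1 s hs y, h2 t ht x, h2 s hs y]
  · rintro _ ⟨μ, b, m, hA, s, hs, t, ht, x, y, rfl⟩ h0
    dsimp only at h0
    have h1 : |t - s| = 0 := by linarith [norm_nonneg (x - y), abs_nonneg (t - s)]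
    have h2 : ‖x - y‖ = 0 := by linarith [norm_nonneg (x - y), abs_nonneg (t - s)]
    obtain rfl : t = s := sub_eq_zero.1 (abs_eq_zero.1 h1)
    obtain rfl : x = y := sub_eq_zero.1 (norm_eq_zero.1 h2)
    simp
  · intro ε hε
    -- The bound σ < 2 is part of the assumptions on the measure, so it is only available once some
    -- admissible datum exists.
    rcases S.eq_empty_or_nonempty with hS | ⟨_, μ', b', m', ⟨𝒦', m₀', hμ', -⟩, -⟩
    · exact ⟨1, one_pos, by simp [hS]⟩
    obtain ⟨δ₁, hδ₁, h₁⟩ := exists_delta_levyOp d (B := B) (N := N) Λ c₀ hμ'.lt_two (half_pos hε)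
    obtain ⟨δ₂, hδ₂, h₂⟩ := exists_delta_deriv d (B := B) (N := N) Λ c₀ hμ'.lt_two hωb hωDb
        (half_pos hε)
    refine ⟨min δ₁ δ₂, lt_min hδ₁ hδ₂, ?_⟩
    rintro _ ⟨μ, b, m, hA, s, hs, t, ht, x, y, rfl⟩ hr
    dsimp only at hr ⊢
    obtain ⟨𝒦, m₀, hμ, hb, hω, hm, hN⟩ := id hA
    have i1 := h₁ T 𝒦 μ b m₀ m hT hμ hb hm hN s hs t ht x y (hr.trans_le (min_le_left _ _))
    have i2 : |derivWithin (fun τ => m τ x) (Icc (0 : ℝ) T) t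
        - derivWithin (fun τ => m τ y) (Icc (0 : ℝ) T) s| ≤ ε / 2 := by
      -- The interior estimate passes to the end points along interior sequences; because the
      -- distance is strictly below δ, it stays so eventually.
      obtain ⟨τ, hτ, hτt⟩ := exists_seq_Ioo_tendsto hT ht
      obtain ⟨θ, hθ, hθs⟩ := exists_seq_Ioo_tendsto hT hs
      have l1 := (hder μ b m hA t ht x).2.comp (tendsto_nhdsWithin_iff.2
        ⟨hτt, Eventually.of_forall hτ⟩)
      have l2 := (hder μ b m hA s hs y).2.comp (tendsto_nhdsWithin_iff.2
        ⟨hθs, Eventually.of_forall hθ⟩)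
      refine le_of_tendsto (l1.sub l2).abs ?_
      have l3 : Tendsto (fun n => |τ n - θ n| + ‖x - y‖) atTop (𝓝 (|t - s| + ‖x - y‖)) :=
        ((hτt.sub hθs).abs).add_const _
      filter_upwards [l3.eventually_lt_const (hr.trans_le (min_le_right _ _))] with n hn
      exact h₂ T 𝒦 μ b m₀ m hT hμ hb hω hm hN (θ n) (hθ n) (τ n) (hτ n) x y hn
    linarith

end

/-! ### The maximum principle -/

section
variable {d : ℕ}

lemma exists_hasLipGrad_of_hasCompactSupport {g : RSpace d → ℝ} (hg : ContDiff ℝ 2 g)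
    (hc : HasCompactSupport g) : ∃ A, HasLipGrad A g := by
  have h : ∀ j : ℕ, j ≤ 2 → ∃ A, ∀ x, ‖iteratedFDeriv ℝ j g x‖ ≤ A := fun j hj =>
    (hc.iteratedFDeriv j).exists_bound_of_continuous
      (hg.continuous_iteratedFDeriv (by exact_mod_cast hj))
  obtain ⟨A0, h0⟩ := h 0 (by norm_num)
  obtain ⟨A1, h1⟩ := h 1 (by norm_num)
  obtain ⟨A2, h2⟩ := h 2 (by norm_num)
  refine ⟨max A0 (max A1 A2), .of_iteratedFDeriv hg fun j hj x => ?_⟩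
  interval_cases j
  · exact (h0 x).trans (le_max_left _ _)
  · exact (h1 x).trans ((le_max_left _ _).trans (le_max_right _ _))
  · exact (h2 x).trans ((le_max_right _ _).trans (le_max_right _ _))

lemma HasLipGrad.one_sub {N : ℝ} {g : RSpace d → ℝ} (hg : HasLipGrad N g) :
    HasLipGrad (1 + N) (fun x => 1 - g x) := by
  have hf : ∀ x, fderiv ℝ (fun x => 1 - g x) x = -fderiv ℝ g x := fun x => fderiv_const_sub _
  refine ⟨hg.diff.const_sub 1, fun x => ?_, fun x => ?_, fun x y => ?_⟩
  · exact (abs_sub _ _).trans (by simpa using hg.bound x)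
  · rw [hf, norm_neg]; linarith [hg.bound_fderiv x]
  · rw [hf, hf, neg_sub_neg, norm_sub_rev]
    nlinarith [hg.lip x y, norm_nonneg (x - y)]

lemma HasLipGrad.fderiv_comp_smul {N : ℝ} {g : RSpace d → ℝ} (hg : HasLipGrad N g) (r : ℝ)
    (x : RSpace d) : fderiv ℝ (fun x => g (r • x)) x = r • fderiv ℝ g (r • x) := by
  have h1 : HasFDerivAt (fun x : RSpace d => r • x)
      (r • ContinuousLinearMap.id ℝ (RSpace d)) x := (hasFDerivAt_id x).const_smul r
  have := ((hg.diff (r • x)).hasFDerivAt.comp x h1).fderiv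
  rw [show (fun x => g (r • x)) = g ∘ fun x => r • x from rfl, this]
  ext v
  simp

lemma HasLipGrad.comp_smul {N : ℝ} {g : RSpace d → ℝ} (hg : HasLipGrad N g) {r : ℝ}
    (hr : r ∈ Icc (0 : ℝ) 1) : HasLipGrad N (fun x => g (r • x)) := by
  have hN := hg.nonneg
  refine ⟨hg.diff.comp (by fun_prop), fun x => hg.bound _, fun x => ?_, fun x y => ?_⟩
  · rw [hg.fderiv_comp_smul, norm_smul, Real.norm_of_nonneg hr.1]
    exact (mul_le_of_le_one_left (norm_nonneg _) hr.2).trans (hg.bound_fderiv _)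
  · rw [hg.fderiv_comp_smul, hg.fderiv_comp_smul, ← smul_sub, norm_smul, Real.norm_of_nonneg hr.1]
    refine (mul_le_of_le_one_left (norm_nonneg _) hr.2).trans ((hg.lip _ _).trans ?_)
    rw [← smul_sub, norm_smul, Real.norm_of_nonneg hr.1]
    gcongr
    exact mul_le_of_le_one_left (norm_nonneg _) hr.2

/-- Stretching g makes it nearly constant on the scale of most jumps. The smallness is uniform in x,
which lets the stretched function serve as a penalty in the maximum principle. -/
lemma HasLipGrad.eventually_abs_levyOp_comp_smul_le {ν : Measure (RSpace d)}
    (hν : levyIntegral ν < ∞) {N : ℝ} {g : RSpace d → ℝ} (hg : HasLipGrad N g) {ε : ℝ}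
    (hε : 0 < ε) :
    ∀ᶠ n : ℕ in atTop, ∀ x, |levyOp ν (fun x => g (((n : ℝ) + 1)⁻¹ • x)) x| ≤ ε := by
  have hN := hg.nonneg
  -- Both entries bound the integrand independently of x. The first is integrable; the second tends
  -- to 0 for fixed z, with the Lipschitz bound used for |z| ≥ 1 and the Taylor bound for |z| < 1.
  let β : ℕ → RSpace d → ℝ := fun n z => min (2 * N * levyWeight z)
    (N * (((n : ℝ) + 1)⁻¹ * ‖z‖ + ((n : ℝ) + 1)⁻¹ ^ 2 * ‖z‖ ^ 2))
  have hβ0 : ∀ n z, 0 ≤ β n z := fun n z =>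
    le_min (mul_nonneg (by positivity) (levyWeight_nonneg z)) (by positivity)
  have hβc : ∀ n, Continuous (β n) := fun n => by
    have := continuous_levyWeight (d := d)
    fun_prop
  have hβi : ∀ n, Integrable (β n) ν := fun n =>
    ((integrable_levyWeight hν).const_mul (2 * N)).mono' (hβc n).aestronglyMeasurable
      (ae_of_all _ fun z => by
        rw [Real.norm_of_nonneg (hβ0 n z)]; exact min_le_left _ _)
  have hlim : Tendsto (fun n => ∫ z, β n z ∂ν) atTop (𝓝 (∫ _, (0 : ℝ) ∂ν)) := by
    refine tendsto_integral_of_dominated_convergence (fun z => 2 * N * levyWeight z)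
      (fun n => (hβc n).aestronglyMeasurable) ((integrable_levyWeight hν).const_mul (2 * N))
      (fun n => ae_of_all _ fun z => by
        rw [Real.norm_of_nonneg (hβ0 n z)]; exact min_le_left _ _) (ae_of_all _ fun z => ?_)
    refine squeeze_zero (fun n => hβ0 n z) (fun n => min_le_right _ _) ?_
    have h1 : Tendsto (fun n : ℕ => ((n : ℝ) + 1)⁻¹) atTop (𝓝 0) := by
      simpa using tendsto_one_div_add_atTop_nhds_zero_nat (𝕜 := ℝ)
    simpa using ((h1.mul_const ‖z‖).add ((h1.pow 2).mul_const (‖z‖ ^ 2))).const_mul N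
  rw [integral_zero] at hlim
  filter_upwards [hlim.eventually_lt_const hε] with n hn x
  have hr : ((n : ℝ) + 1)⁻¹ ∈ Icc (0 : ℝ) 1 :=
    ⟨by positivity, inv_le_one_of_one_le₀ (by linarith [n.cast_nonneg (α := ℝ)])⟩
  refine (norm_integral_le_of_norm_le (f := levyIntegrand (fun x => g (((n : ℝ) + 1)⁻¹ • x)) x)
    (hβi n) (ae_of_all _ fun z => ?_)).trans hn.le
  refine le_min ((hg.comp_smul hr).abs_levyIntegrand_le x z) ?_
  set r := ((n : ℝ) + 1)⁻¹
  rw [Real.norm_eq_abs]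
  rcases lt_or_ge ‖z‖ 1 with hz | hz
  · rw [levyIntegrand_of_lt _ _ hz, hg.fderiv_comp_smul]
    have := hg.taylor (r • x) (r • z)
    rw [norm_smul, Real.norm_of_nonneg hr.1, mul_pow] at this
    have h2 : (r • fderiv ℝ g (r • x)) z = fderiv ℝ g (r • x) (r • z) := by simp
    rw [smul_add, h2]
    refine this.trans ?_
    have := mul_nonneg hN (mul_nonneg hr.1 (norm_nonneg z))
    linarith
  · rw [levyIntegrand_of_le _ _ hz, smul_add]
    have := convex_univ.norm_image_sub_le_of_norm_fderiv_le (fun z _ => hg.diff z)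
      (fun z _ => hg.bound_fderiv z) (mem_univ (r • x)) (mem_univ (r • x + r • z))
    rw [add_sub_cancel_left, norm_smul, Real.norm_of_nonneg hr.1, Real.norm_eq_abs] at this
    refine this.trans ?_
    gcongr
    exact le_add_of_nonneg_right (by positivity)

/-- Only slopes from the left enter, because the maximum may sit at the last time considered. -/
lemma nonneg_of_hasDerivAt_of_le {f : ℝ → ℝ} {f' t₀ : ℝ} (hf : HasDerivAt f f' t₀) (ht₀ : 0 < t₀)
    (h : ∀ t ∈ Icc 0 t₀, f t ≤ f t₀) : 0 ≤ f' := by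
  have h1 := (hasDerivWithinAt_iff_tendsto_slope' (s := Iio t₀) (by simp)).1 hf.hasDerivWithinAt
  refine ge_of_tendsto h1 ?_
  filter_upwards [Ioo_mem_nhdsLT ht₀] with t ht
  rw [slope_def_field]
  exact div_nonneg_of_nonpos (sub_nonpos.2 (h t ⟨ht.1.le, ht.2.le⟩)) (sub_nonpos.2 ht.2.le)

/-- The maximum principle for bounded classical subsolutions. -/
theorem maximum_principle {ν : Measure (RSpace d)} (hν : levyIntegral ν < ∞) {T B C : ℝ}
    (hT : 0 < T) (hB : 0 ≤ B) {w : ℝ → RSpace d → ℝ}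
    (hc : ContinuousOn (fun q : ℝ × RSpace d => w q.1 q.2) (Icc (0 : ℝ) T ×ˢ univ))
    (hd : ∀ t ∈ Ioo 0 T, Differentiable ℝ (w t))
    (hdt : ∀ t ∈ Ioo 0 T, ∀ x, DifferentiableAt ℝ (fun τ => w τ x) t)
    (hI : ∀ t ∈ Ioo 0 T, ∀ x, Integrable (levyIntegrand (w t) x) ν)
    (hC : ∀ t ∈ Icc 0 T, ∀ x, |w t x| ≤ C) (h0 : ∀ x, w 0 x ≤ 0)
    (heq : ∀ t ∈ Ioo 0 T, ∀ x, deriv (fun τ => w τ x) t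
      ≤ levyOp ν (w t) x + B * ‖fderiv ℝ (w t) x‖ + B * |w t x|) :
    ∀ t ∈ Icc 0 T, ∀ x, w t x ≤ 0 := by
  -- Working with t₁ < T keeps the maximum over [0, t₁] away from T, so that the equation is
  -- available at the maximum point.
  suffices h : ∀ t ∈ Ioo 0 T, ∀ x, w t x ≤ 0 by
    intro t ht x
    obtain ⟨τ, hτ, hτt⟩ := exists_seq_Ioo_tendsto hT ht
    have hcx : ContinuousWithinAt (fun τ => w τ x) (Icc 0 T) t :=
      (hc.comp (f := fun τ : ℝ => (τ, x)) (by fun_prop) fun τ hτ => ⟨hτ, mem_univ _⟩) t ht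
    exact le_of_tendsto (hcx.tendsto.comp (tendsto_nhdsWithin_iff.2
      ⟨hτt, Eventually.of_forall fun n => Ioo_subset_Icc_self (hτ n)⟩))
      (Eventually.of_forall fun n => h _ (hτ n) x)
  intro t₁ ht₁ x₁
  by_contra! hpos
  have hCpos : 0 < C := hpos.trans_le ((le_abs_self _).trans (hC t₁ (Ioo_subset_Icc_self ht₁) x₁))
  -- The factor exp(-l t) with l = B + 1 absorbs the zero-order term and leaves a surplus of -exp(-l
  -- t) w, which is at most -η at the maximum point.
  set l := B + 1 with hl
  set η := Real.exp (-l * t₁) * w t₁ x₁ with hη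
  have hη0 : 0 < η := by positivity
  let χ : ContDiffBump (0 : RSpace d) := ⟨1, 2, one_pos, one_lt_two⟩
  obtain ⟨A, hA⟩ := exists_hasLipGrad_of_hasCompactSupport (χ.contDiff (n := 2))
    χ.hasCompactSupport
  have hφ := hA.one_sub
  set A' := 1 + A
  have hA' := hφ.nonneg
  -- With this choice the total error 2Cε(1 + B) equals η/2.
  set ε := η / (4 * C * (1 + B)) with hε
  have hε0 : 0 < ε := by positivity
  have hr : Tendsto (fun n : ℕ => ((n : ℝ) + 1)⁻¹) atTop (𝓝 0) := by
    simpa using tendsto_one_div_add_atTop_nhds_zero_nat (𝕜 := ℝ)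
  have e1 : ∀ᶠ n : ℕ in atTop, ((n : ℝ) + 1)⁻¹ * ‖x₁‖ < 1 := by
    refine Tendsto.eventually_lt_const one_pos ?_
    simpa using hr.mul_const ‖x₁‖
  have e2 : ∀ᶠ n : ℕ in atTop, ((n : ℝ) + 1)⁻¹ * A' < ε := by
    refine Tendsto.eventually_lt_const hε0 ?_
    simpa using hr.mul_const A'
  obtain ⟨n, hn1, hn2, hn3⟩ := (e1.and (e2.and
    (hφ.eventually_abs_levyOp_comp_smul_le hν hε0))).exists
  have hrm : ((n : ℝ) + 1)⁻¹ ∈ Icc (0 : ℝ) 1 :=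
    ⟨by positivity, inv_le_one_of_one_le₀ (by linarith [n.cast_nonneg (α := ℝ)])⟩
  have hr0 : 0 < ((n : ℝ) + 1)⁻¹ := by positivity
  set r := ((n : ℝ) + 1)⁻¹ with hrdef
  set φ : RSpace d → ℝ := fun x => 1 - χ (r • x) with hφdef
  have hφL : HasLipGrad A' φ := hφ.comp_smul hrm
  have hφ0 : ∀ x, 0 ≤ φ x := fun x => sub_nonneg.2 χ.le_one
  have hφD : ∀ x, ‖fderiv ℝ φ x‖ ≤ ε := fun x => by
    rw [hφdef, hφ.fderiv_comp_smul, norm_smul, Real.norm_of_nonneg hrm.1]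
    refine le_trans ?_ hn2.le
    gcongr
    exact hφ.bound_fderiv _
  have hφx₁ : φ x₁ = 0 := by
    rw [hφdef]
    simp only
    rw [χ.one_of_mem_closedBall, sub_self]
    rw [mem_closedBall_zero_iff, norm_smul, Real.norm_of_nonneg hrm.1]
    exact hn1.le
  have hφfar : ∀ x, 2 * r⁻¹ ≤ ‖x‖ → φ x = 1 := fun x hx => by
    rw [hφdef]
    simp only
    rw [χ.zero_of_le_dist, sub_zero]
    rw [dist_zero_right, norm_smul, Real.norm_of_nonneg hrm.1]
    calc (2 : ℝ) = r * (2 * r⁻¹) := by field_simp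
      _ ≤ r * ‖x‖ := by gcongr
  -- The penalty vanishes at x₁, so the value η is kept. Far out it equals 2C, which makes Φ
  -- negative there, so the maximum over a compact set is a global one.
  let Φ : ℝ × RSpace d → ℝ := fun q => Real.exp (-l * q.1) * w q.1 q.2 - 2 * C * φ q.2
  have hsub : Icc 0 t₁ ×ˢ Metric.closedBall (0 : RSpace d) (2 * r⁻¹) ⊆ Icc 0 T ×ˢ univ :=
    prod_mono (Icc_subset_Icc_right ht₁.2.le) (subset_univ _)
  have hΦc : ContinuousOn Φ (Icc 0 t₁ ×ˢ Metric.closedBall (0 : RSpace d) (2 * r⁻¹)) := by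
    refine ContinuousOn.sub (ContinuousOn.mul (by fun_prop) (hc.mono hsub)) ?_
    exact ((continuous_const.mul (hφL.diff.continuous.comp continuous_snd))).continuousOn
  have hx₁ : ‖x₁‖ ≤ 2 * r⁻¹ := by
    have : ‖x₁‖ ≤ r⁻¹ := by
      rw [← one_div, le_div_iff₀ hr0, mul_comm]; exact hn1.le
    have : 0 ≤ r⁻¹ := by positivity
    linarith
  have hmem : (t₁, x₁) ∈ Icc 0 t₁ ×ˢ Metric.closedBall (0 : RSpace d) (2 * r⁻¹) :=
    ⟨right_mem_Icc.2 ht₁.1.le, by simpa using hx₁⟩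
  obtain ⟨⟨t₀, x₀⟩, ⟨ht₀, hx₀⟩, hmax⟩ := (isCompact_Icc.prod
    (isCompact_closedBall (0 : RSpace d) (2 * r⁻¹))).exists_isMaxOn ⟨_, hmem⟩ hΦc
  have hΦ₁ : Φ (t₁, x₁) = η := by simp [Φ, hφx₁, hη]
  have hΦη : η ≤ Φ (t₀, x₀) := hΦ₁ ▸ hmax hmem
  have hglob : ∀ t ∈ Icc 0 t₁, ∀ x, Φ (t, x) ≤ Φ (t₀, x₀) := by
    intro t ht x
    by_cases hx : ‖x‖ ≤ 2 * r⁻¹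
    · exact hmax (show (t, x) ∈ _ from ⟨ht, by simpa using hx⟩)
    · refine le_trans ?_ (hη0.le.trans hΦη)
      have h1 : |w t x| ≤ C := hC t (Icc_subset_Icc_right ht₁.2.le ht) x
      have h2 : Real.exp (-l * t) ≤ 1 := Real.exp_le_one_iff.2 (by nlinarith [ht.1])
      have h3 : Real.exp (-l * t) * w t x ≤ 1 * C :=
        (mul_le_mul_of_nonneg_left ((le_abs_self _).trans h1) (Real.exp_pos _).le).trans
          (mul_le_mul_of_nonneg_right h2 hCpos.le)
      simp only [Φ, hφfar x (not_le.1 hx).le]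
      linarith
  have hew : η ≤ Real.exp (-l * t₀) * w t₀ x₀ := by
    have := hφ0 x₀
    have h2 : 0 ≤ 2 * C * φ x₀ := by positivity
    have h3 : Φ (t₀, x₀) = Real.exp (-l * t₀) * w t₀ x₀ - 2 * C * φ x₀ := rfl
    linarith
  set e := Real.exp (-l * t₀) with he
  have he0 : 0 < e := Real.exp_pos _
  have hwpos : 0 < w t₀ x₀ := pos_of_mul_pos_right (hη0.trans_le hew) he0.le
  have ht₀pos : 0 < t₀ := by
    rcases ht₀.1.eq_or_lt with h | h
    · have h' : t₀ = 0 := h.symm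
      exact absurd hwpos (by rw [h']; exact not_lt.2 (h0 x₀))
    · exact h
  have ht₀' : t₀ ∈ Ioo 0 T := ⟨ht₀pos, ht₀.2.trans_lt ht₁.2⟩
  have htime : 0 ≤ e * (deriv (fun τ => w τ x₀) t₀ - l * w t₀ x₀) := by
    have h1 : HasDerivAt (fun t => Real.exp (-l * t) * w t x₀)
        (e * (deriv (fun τ => w τ x₀) t₀ - l * w t₀ x₀)) t₀ := by
      have h2 : HasDerivAt (fun t : ℝ => Real.exp (-l * t)) (Real.exp (-l * t₀) * (-l * 1)) t₀ :=
        ((hasDerivAt_id t₀).const_mul (-l)).exp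
      refine (h2.fun_mul (hdt t₀ ht₀' x₀).hasDerivAt).congr_deriv ?_
      rw [he]; ring
    refine nonneg_of_hasDerivAt_of_le h1 ht₀pos fun t ht => ?_
    have := hglob t ⟨ht.1, ht.2.trans ht₀.2⟩ x₀
    simp only [Φ] at this
    linarith
  have hspace : e • fderiv ℝ (w t₀) x₀ = (2 * C) • fderiv ℝ φ x₀ := by
    have h1 : HasFDerivAt (fun x => e * w t₀ x - 2 * C * φ x)
        (e • fderiv ℝ (w t₀) x₀ - (2 * C) • fderiv ℝ φ x₀) x₀ :=
      ((hd t₀ ht₀' x₀).hasFDerivAt.const_mul e).sub ((hφL.diff x₀).hasFDerivAt.const_mul (2 * C))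
    have h2 : IsLocalMax (fun x => e * w t₀ x - 2 * C * φ x) x₀ :=
      Eventually.of_forall fun x => hglob t₀ ht₀ x
    exact sub_eq_zero.1 (h2.hasFDerivAt_eq_zero h1)
  have hspace' : ∀ z, e * fderiv ℝ (w t₀) x₀ z = 2 * C * fderiv ℝ φ x₀ z := fun z => by
    simpa using congrArg (fun A => A z) hspace
  -- At a global maximum in x the increments of exp(-l t₀) w are dominated by those of the penalty,
  -- and the gradient terms agree, so the integrands are ordered pointwise.
  have hlevy : e * levyOp ν (w t₀) x₀ ≤ 2 * C * levyOp ν φ x₀ := by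
    rw [levyOp, levyOp, ← integral_const_mul, ← integral_const_mul]
    refine integral_mono ((hI t₀ ht₀' x₀).const_mul e)
      ((hφL.integrable_levyIntegrand hν x₀).const_mul (2 * C)) fun z => ?_
    have h1 := hglob t₀ ht₀ (x₀ + z)
    simp only [Φ] at h1
    rcases lt_or_ge ‖z‖ 1 with hz | hz
    · simp only [levyIntegrand_of_lt _ _ hz, mul_sub, hspace' z]
      linarith
    · simp only [levyIntegrand_of_le _ _ hz, mul_sub]
      linarith
  have hgrad : e * ‖fderiv ℝ (w t₀) x₀‖ ≤ 2 * C * ε := by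
    have := congrArg norm hspace
    rw [norm_smul, norm_smul, Real.norm_of_nonneg he0.le, Real.norm_of_nonneg (by positivity)]
      at this
    rw [this]
    gcongr
    exact hφD x₀
  have heq' := heq t₀ ht₀' x₀
  rw [abs_of_pos hwpos] at heq'
  have hφlevy : levyOp ν φ x₀ ≤ ε := (le_abs_self _).trans (hn3 x₀)
  have key : e * (deriv (fun τ => w τ x₀) t₀ - l * w t₀ x₀)
      ≤ 2 * C * ε + B * (2 * C * ε) - η := by
    have k1 : e * deriv (fun τ => w τ x₀) t₀ ≤ e * (levyOp ν (w t₀) x₀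
        + B * ‖fderiv ℝ (w t₀) x₀‖ + B * w t₀ x₀) := by gcongr
    have k2 : 2 * C * levyOp ν φ x₀ ≤ 2 * C * ε := by gcongr
    have k3 : B * (e * ‖fderiv ℝ (w t₀) x₀‖) ≤ B * (2 * C * ε) := by gcongr
    rw [hl]
    nlinarith
  have hfin : 2 * C * ε + B * (2 * C * ε) = η / 2 := by
    rw [hε]; field_simp; ring
  linarith

end

/-! ### The symbol of the Lévy operator -/

section
variable {d : ℕ}

/-- The integrand of the Fourier multiplier of the Lévy operator. -/
def levyPhase (ξ z : RSpace d) : ℂ :=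
  Complex.exp (Complex.I * (inner ℝ z ξ : ℝ)) - 1
    - (Metric.ball (0 : RSpace d) 1).indicator
        (fun z => Complex.I * ((inner ℝ ξ z : ℝ) : ℂ)) z

lemma levyPhase_of_lt (ξ : RSpace d) {z : RSpace d} (h : ‖z‖ < 1) :
    levyPhase ξ z = Complex.exp (Complex.I * (inner ℝ z ξ : ℝ)) - 1
      - Complex.I * (inner ℝ z ξ : ℝ) := by
  rw [levyPhase, indicator_of_mem (by simpa using h), real_inner_comm]

lemma levyPhase_of_le (ξ : RSpace d) {z : RSpace d} (h : 1 ≤ ‖z‖) :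
    levyPhase ξ z = Complex.exp (Complex.I * (inner ℝ z ξ : ℝ)) - 1 := by
  rw [levyPhase, indicator_of_notMem (by simpa using h), sub_zero]

lemma norm_exp_I_mul (r : ℝ) : ‖Complex.exp (Complex.I * (r : ℂ))‖ = 1 := by
  rw [mul_comm]; exact Complex.norm_exp_ofReal_mul_I r

lemma norm_exp_I_sub_le (r : ℝ) :
    ‖Complex.exp (Complex.I * (r : ℂ)) - 1 - Complex.I * r‖ ≤ 3 * r ^ 2 := by
  have hr : ‖Complex.I * (r : ℂ)‖ = |r| := by simp
  rcases le_or_gt |r| 1 with h | h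
  · have := Complex.norm_exp_sub_one_sub_id_le (x := Complex.I * r) (by rwa [hr])
    rw [hr, sq_abs] at this
    nlinarith [sq_nonneg r]
  · have h1 := norm_sub_le (Complex.exp (Complex.I * (r : ℂ)) - 1) (Complex.I * r)
    have h2 := norm_sub_le (Complex.exp (Complex.I * (r : ℂ))) 1
    rw [norm_exp_I_mul, norm_one] at h2
    rw [hr] at h1
    nlinarith [sq_abs r]

lemma norm_levyPhase_le (ξ z : RSpace d) :
    ‖levyPhase ξ z‖ ≤ (2 + 3 * ‖ξ‖ ^ 2) * levyWeight z := by
  rcases lt_or_ge ‖z‖ 1 with h | h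
  · rw [levyPhase_of_lt ξ h, levyWeight_of_lt h]
    refine (norm_exp_I_sub_le _).trans ?_
    have h1 : (inner ℝ z ξ) ^ 2 ≤ (‖z‖ * ‖ξ‖) ^ 2 := by
      rw [← sq_abs]
      have := abs_real_inner_le_norm z ξ
      gcongr
    nlinarith [sq_nonneg ‖z‖]
  · rw [levyPhase_of_le ξ h, levyWeight_of_le h]
    have h2 := norm_sub_le (Complex.exp (Complex.I * ((inner ℝ z ξ : ℝ) : ℂ))) 1
    rw [norm_exp_I_mul, norm_one] at h2
    nlinarith [sq_nonneg ‖ξ‖]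

lemma measurable_levyPhase_uncurry :
    Measurable (fun p : RSpace d × RSpace d => levyPhase p.1 p.2) := by
  have h : (fun p : RSpace d × RSpace d => levyPhase p.1 p.2) = fun p =>
      Complex.exp (Complex.I * (inner ℝ p.2 p.1 : ℝ)) - 1
      - (univ ×ˢ Metric.ball (0 : RSpace d) 1).indicator
        (fun p : RSpace d × RSpace d => Complex.I * ((inner ℝ p.1 p.2 : ℝ) : ℂ)) p := by
    funext p
    by_cases hp : p.2 ∈ Metric.ball (0 : RSpace d) 1
    · have hp' : p ∈ univ ×ˢ Metric.ball (0 : RSpace d) 1 := ⟨mem_univ _, hp⟩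
      rw [levyPhase, indicator_of_mem hp, indicator_of_mem hp']
    · have hp' : p ∉ univ ×ˢ Metric.ball (0 : RSpace d) 1 := fun h => hp h.2
      rw [levyPhase, indicator_of_notMem hp, indicator_of_notMem hp']
  rw [h]
  refine Measurable.sub (Continuous.measurable (by fun_prop)) ?_
  exact (Continuous.measurable (by fun_prop)).indicator
    (MeasurableSet.univ.prod Metric.isOpen_ball.measurableSet)

lemma measurable_levyPhase (ξ : RSpace d) : Measurable (levyPhase ξ) := by
  unfold levyPhase
  refine Measurable.sub (Continuous.measurable (by fun_prop)) ?_
  exact (Continuous.measurable (by fun_prop)).indicator Metric.isOpen_ball.measurableSet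

lemma continuous_levyPhase (z : RSpace d) : Continuous fun ξ => levyPhase ξ z := by
  rcases lt_or_ge ‖z‖ 1 with h | h
  · simp only [levyPhase_of_lt _ h]; fun_prop
  · simp only [levyPhase_of_le _ h]; fun_prop

/-! ### Integrability, continuity and sign of the symbol. -/

variable {ν : Measure (RSpace d)}

lemma integrable_levyPhase (hν : levyIntegral ν < ∞) (ξ : RSpace d) :
    Integrable (levyPhase ξ) ν :=
  ((integrable_levyWeight hν).const_mul (2 + 3 * ‖ξ‖ ^ 2)).mono'
    (measurable_levyPhase ξ).aestronglyMeasurable (ae_of_all _ (norm_levyPhase_le ξ))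

lemma norm_levySymbol_le (hν : levyIntegral ν < ∞) (ξ : RSpace d) :
    ‖levySymbol ν ξ‖ ≤ (2 + 3 * ‖ξ‖ ^ 2) * ∫ z, levyWeight z ∂ν := by
  rw [← integral_const_mul]
  exact norm_integral_le_of_norm_le ((integrable_levyWeight hν).const_mul _)
    (ae_of_all _ (norm_levyPhase_le ξ))

lemma continuous_levySymbol (hν : levyIntegral ν < ∞) : Continuous (levySymbol ν) := by
  refine continuous_iff_continuousAt.2 fun ξ₀ => ?_
  refine tendsto_integral_filter_of_dominated_convergence
    (F := fun ξ z => levyPhase ξ z) (f := levyPhase ξ₀)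
    (fun z => (2 + 3 * (‖ξ₀‖ + 1) ^ 2) * levyWeight z)
    (Eventually.of_forall fun ξ => (measurable_levyPhase ξ).aestronglyMeasurable) ?_
    ((integrable_levyWeight hν).const_mul _)
    (ae_of_all _ fun z => (continuous_levyPhase z).tendsto ξ₀)
  filter_upwards [continuous_norm.continuousAt.eventually_lt_const (lt_add_one ‖ξ₀‖)] with ξ hξ
  refine ae_of_all _ fun z => (norm_levyPhase_le ξ z).trans ?_
  have := levyWeight_nonneg z
  gcongr

lemma re_levySymbol_nonpos (hν : levyIntegral ν < ∞) (ξ : RSpace d) :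
    (levySymbol ν ξ).re ≤ 0 := by
  have h : (levySymbol ν ξ).re = ∫ z, (levyPhase ξ z).re ∂ν :=
    (integral_re (integrable_levyPhase hν ξ)).symm
  rw [h]
  refine integral_nonpos fun z => ?_
  have h1 : (Complex.exp (Complex.I * ((inner ℝ z ξ : ℝ) : ℂ))).re ≤ 1 := by
    refine (Complex.re_le_norm _).trans (norm_exp_I_mul _).le
  rcases lt_or_ge ‖z‖ 1 with hz | hz
  · simpa [levyPhase_of_lt _ hz] using h1
  · simpa [levyPhase_of_le _ hz] using h1

lemma levySymbol_neg (ξ : RSpace d) :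
    levySymbol ν (-ξ) = (starRingEnd ℂ) (levySymbol ν ξ) := by
  change ∫ z, levyPhase (-ξ) z ∂ν = (starRingEnd ℂ) (∫ z, levyPhase ξ z ∂ν)
  rw [← integral_conj]
  refine integral_congr_ae (ae_of_all _ fun z => ?_)
  rcases lt_or_ge ‖z‖ 1 with hz | hz
  · simp only [levyPhase_of_lt _ hz, map_sub, map_mul, map_one, ← Complex.exp_conj,
      Complex.conj_I, Complex.conj_ofReal, inner_neg_right, Complex.ofReal_neg, mul_neg, neg_mul]
  · simp only [levyPhase_of_le _ hz, map_sub, map_mul, map_one, ← Complex.exp_conj,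
      Complex.conj_I, Complex.conj_ofReal, inner_neg_right, Complex.ofReal_neg, mul_neg, neg_mul]

lemma norm_exp_mul_levySymbol_le (hν : levyIntegral ν < ∞) {t : ℝ} (ht : 0 ≤ t) (ξ : RSpace d) :
    ‖Complex.exp ((t : ℂ) * levySymbol ν ξ)‖ ≤ 1 := by
  rw [Complex.norm_exp, Real.exp_le_one_iff]
  simpa using mul_nonpos_of_nonneg_of_nonpos ht (re_levySymbol_nonpos hν ξ)

/-- Fubini needs an s-finite measure, but nothing restricts the mass at the origin. Away from 0 the
weight is positive, so the measure is absolutely continuous with respect to the finite measure with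
density `levyWeight`. -/
lemma sFinite_restrict_compl_zero (hν : levyIntegral ν < ∞) : SFinite (ν.restrict {0}ᶜ) := by
  have hf : Measurable fun z : RSpace d => ENNReal.ofReal (levyWeight z) :=
    continuous_levyWeight.measurable.ennreal_ofReal
  have h1 : IsFiniteMeasure ((ν.restrict {0}ᶜ).withDensity fun z => ENNReal.ofReal (levyWeight z)) :=
    isFiniteMeasure_withDensity ((setLIntegral_le_lintegral _ _).trans_lt hν).ne
  refine sFinite_of_absolutelyContinuous
    (ν := (ν.restrict {0}ᶜ).withDensity fun z => ENNReal.ofReal (levyWeight z)) ?_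
  refine withDensity_absolutelyContinuous' hf.aemeasurable ?_
  refine (ae_restrict_iff' (measurableSet_singleton 0).compl).2 (ae_of_all _ fun z hz => ?_)
  have hz' : 0 < ‖z‖ := norm_pos_iff.2 hz
  simp only [ne_eq, ENNReal.ofReal_eq_zero, not_le]
  exact lt_min one_pos (by positivity)

/-! ### Action on superpositions of characters -/

/-- The character `x ↦ exp(2πi v·x)`. -/
def character (v x : RSpace d) : ℂ :=
  Complex.exp (Complex.I * ((inner ℝ x ((2 * Real.pi) • v) : ℝ) : ℂ))

lemma norm_character (v x : RSpace d) : ‖character v x‖ = 1 := norm_exp_I_mul _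

lemma continuous_character : Continuous fun p : RSpace d × RSpace d => character p.1 p.2 := by
  unfold character; fun_prop

lemma continuous_character_left (x : RSpace d) : Continuous fun v => character v x := by
  unfold character; fun_prop

lemma character_add (v x y : RSpace d) :
    character v (x + y) = character v x * character v y := by
  rw [character, character, character, ← Complex.exp_add, inner_add_left]
  push_cast; ring_nf

lemma integrable_mul_character {f : RSpace d → ℂ} (hf : Integrable f) (x : RSpace d) :
    Integrable fun v => f v * character v x := by
  refine hf.mono (hf.aestronglyMeasurable.mul
    (continuous_character_left x).aestronglyMeasurable) (ae_of_all _ fun v => ?_)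
  rw [norm_mul, norm_character, mul_one]

/-- The superposition `∫ f(v) exp(2πi v·x) dv`. -/
def superpose (f : RSpace d → ℂ) (x : RSpace d) : ℂ := ∫ v, f v * character v x

lemma superpose_eq_fourierInv (f : RSpace d → ℂ) : superpose f = 𝓕⁻ f := by
  funext x
  rw [Real.fourierInv_eq', superpose]
  refine integral_congr_ae (ae_of_all _ fun v => ?_)
  simp only [character, inner_smul_right, smul_eq_mul]
  rw [mul_comm, real_inner_comm]
  push_cast; ring_nf

/-- Convolution with p multiplies each character by a value of the characteristic function. The
reflection y ↦ x - y produces the minus sign, which is why `IsHeatLaw` involves the symbol at -ξ. -/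
lemma integral_superpose_sub {f : RSpace d → ℂ} (hf : Integrable f) (p : Measure (RSpace d))
    [IsProbabilityMeasure p] (x : RSpace d) :
    ∫ y, superpose f (x - y) ∂p
      = superpose (fun v => f v * charFun p (-((2 * Real.pi) • v))) x := by
  unfold superpose
  rw [integral_integral_swap]
  · refine integral_congr_ae (ae_of_all _ fun v => ?_)
    simp only [sub_eq_add_neg, character_add, ← mul_assoc]
    rw [integral_const_mul, charFun_apply, mul_right_comm]
    congr 2
    refine integral_congr_ae (ae_of_all _ fun y => ?_)
    simp only [character, inner_neg_left, inner_neg_right, mul_comm]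
  · have h1 : Integrable (fun q : RSpace d × RSpace d => (1 : ℝ) * ‖f q.2‖) (p.prod volume) :=
      Integrable.mul_prod (f := fun _ => (1 : ℝ)) (integrable_const 1) hf.norm
    refine h1.mono' (hf.aestronglyMeasurable.comp_snd.mul ?_) (ae_of_all _ fun q => ?_)
    · exact (continuous_character.comp (g := fun q : RSpace d × RSpace d => character q.1 q.2)
        (f := fun q : RSpace d × RSpace d => (q.2, x - q.1)) (by fun_prop)).aestronglyMeasurable
    · simp [Function.uncurry, norm_character]

lemma levyOp_eq_restrict (ν : Measure (RSpace d)) (g : RSpace d → ℝ) (x : RSpace d) :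
    levyOp ν g x = levyOp (ν.restrict {0}ᶜ) g x := by
  refine (setIntegral_eq_integral_of_forall_compl_eq_zero fun z hz => ?_).symm
  obtain rfl : z = 0 := by simpa using hz
  rw [levyIntegrand_of_lt _ _ (by simp)]
  simp

lemma levySymbol_eq_restrict (ν : Measure (RSpace d)) (ξ : RSpace d) :
    levySymbol ν ξ = levySymbol (ν.restrict {0}ᶜ) ξ := by
  refine (setIntegral_eq_integral_of_forall_compl_eq_zero fun z hz => ?_).symm
  obtain rfl : z = 0 := by simpa using hz
  simp

lemma fderiv_eq_superpose {g : RSpace d → ℝ} (hg : Differentiable ℝ g) {f : RSpace d → ℂ}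
    (hf : Integrable f) (hf1 : Integrable fun v => ‖v‖ * ‖f v‖)
    (hgf : ∀ x, (g x : ℂ) = superpose f x) (x z : RSpace d) :
    (fderiv ℝ g x z : ℂ)
      = superpose (fun v => f v * (Complex.I * (inner ℝ z ((2 * Real.pi) • v) : ℝ))) x := by
  have h1 : HasDerivAt (fun s : ℝ => ((g (x + s • z) : ℝ) : ℂ)) (fderiv ℝ g x z : ℂ) 0 := by
    have h2 : HasDerivAt (fun s : ℝ => x + s • z) z 0 := by
      simpa using (((hasDerivAt_id (0 : ℝ)).smul_const z).const_add x : HasDerivAt _ _ _)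
    have h3 : HasFDerivAt g (fderiv ℝ g x) (x + (0 : ℝ) • z) := by
      simpa using (hg x).hasFDerivAt
    exact (h3.comp_hasDerivAt (0 : ℝ) h2).ofReal_comp
  have h4 : ∀ v s, HasDerivAt (fun s : ℝ => f v * character v (x + s • z))
      (f v * (character v (x + s • z) * (Complex.I * (inner ℝ z ((2 * Real.pi) • v) : ℝ)))) s := by
    intro v s
    refine HasDerivAt.const_mul _ ?_
    have h5 : HasDerivAt (fun s : ℝ => Complex.I *
        ((inner ℝ (x + s • z) ((2 * Real.pi) • v) : ℝ) : ℂ))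
        (Complex.I * (inner ℝ z ((2 * Real.pi) • v) : ℝ)) s := by
      refine HasDerivAt.const_mul _ (HasDerivAt.ofReal_comp ?_)
      simp only [inner_add_left, inner_smul_left]
      simpa using ((hasDerivAt_id s).mul_const (inner ℝ z ((2 * Real.pi) • v))).const_add
        (inner ℝ x ((2 * Real.pi) • v))
    exact h5.cexp
  have h6 := hasDerivAt_integral_of_dominated_loc_of_deriv_le (μ := volume)
    (F := fun (s : ℝ) v => f v * character v (x + s • z)) (x₀ := (0 : ℝ)) (s := univ)
    (F' := fun (s : ℝ) v => f v * (character v (x + s • z) *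
      (Complex.I * (inner ℝ z ((2 * Real.pi) • v) : ℝ))))
    (bound := fun v => (‖z‖ * (2 * Real.pi)) * (‖v‖ * ‖f v‖)) univ_mem
    (Eventually.of_forall fun s => (integrable_mul_character hf _).aestronglyMeasurable)
    (integrable_mul_character hf _)
    (hf.aestronglyMeasurable.mul (((continuous_character_left _).mul
      (by fun_prop)).aestronglyMeasurable))
    (ae_of_all _ fun v s _ => ?_) (hf1.const_mul _) (ae_of_all _ fun v s _ => h4 v s)
  · have h7 : (fun s : ℝ => ((g (x + s • z) : ℝ) : ℂ))
        = fun s : ℝ => ∫ v, f v * character v (x + s • z) := by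
      funext s; exact hgf _
    rw [h7] at h1
    rw [h1.unique h6.2, superpose]
    refine integral_congr_ae (ae_of_all _ fun v => ?_)
    simp only [zero_smul, add_zero]
    ring
  · rw [norm_mul, norm_mul, norm_character, one_mul, norm_mul, Complex.norm_I, one_mul,
      Complex.norm_real, Real.norm_eq_abs]
    have h8 := abs_real_inner_le_norm z ((2 * Real.pi) • v)
    rw [norm_smul, Real.norm_of_nonneg (by positivity)] at h8
    nlinarith [norm_nonneg (f v), mul_le_mul_of_nonneg_left h8 (norm_nonneg (f v))]

lemma integrable_mul_levySymbol (hν : levyIntegral ν < ∞) {f : RSpace d → ℂ}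
    (hf : Integrable f) (hf2 : Integrable fun v => ‖v‖ ^ 2 * ‖f v‖) :
    Integrable fun v => f v * levySymbol ν ((2 * Real.pi) • v) := by
  have h : Integrable fun v => (2 * ∫ z, levyWeight z ∂ν) * ‖f v‖
      + (3 * (2 * Real.pi) ^ 2 * ∫ z, levyWeight z ∂ν) * (‖v‖ ^ 2 * ‖f v‖) :=
    (hf.norm.const_mul _).add (hf2.const_mul _)
  refine h.mono' (hf.aestronglyMeasurable.mul ((continuous_levySymbol hν).comp
    (continuous_const_smul _)).aestronglyMeasurable) (ae_of_all _ fun v => ?_)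
  rw [norm_mul]
  refine (mul_le_mul_of_nonneg_left (norm_levySymbol_le hν _) (norm_nonneg _)).trans (le_of_eq ?_)
  rw [norm_smul, Real.norm_of_nonneg (by positivity)]
  ring

/-- Characters are eigenfunctions of the Lévy operator with eigenvalue the symbol. The two integrals
may be exchanged since `levyPhase` is bounded by the weight times a quadratic in the frequency, and
f has two integrable moments. -/
lemma levyOp_eq_superpose (hν : levyIntegral ν < ∞) {g : RSpace d → ℝ}
    (hg : Differentiable ℝ g) {f : RSpace d → ℂ}
    (hf : Integrable f) (hf1 : Integrable fun v => ‖v‖ * ‖f v‖)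
    (hf2 : Integrable fun v => ‖v‖ ^ 2 * ‖f v‖)
    (hgf : ∀ x, (g x : ℂ) = superpose f x) (x : RSpace d) :
    (levyOp ν g x : ℂ) = superpose (fun v => f v * levySymbol ν ((2 * Real.pi) • v)) x := by
  rw [levyOp_eq_restrict]
  simp only [levySymbol_eq_restrict ν]
  have := sFinite_restrict_compl_zero hν
  have hν₀ : levyIntegral (ν.restrict {0}ᶜ) < ∞ := (setLIntegral_le_lintegral _ _).trans_lt hν
  set ν₀ := ν.restrict {0}ᶜ
  have hint : ∀ z, (levyIntegrand g x z : ℂ)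
      = ∫ v, f v * character v x * levyPhase ((2 * Real.pi) • v) z := by
    intro z
    have hfi : Integrable fun v => f v * (Complex.I * (inner ℝ z ((2 * Real.pi) • v) : ℝ)) := by
      refine (hf1.const_mul (‖z‖ * (2 * Real.pi))).mono' (hf.aestronglyMeasurable.mul
        (Continuous.aestronglyMeasurable (by fun_prop))) (ae_of_all _ fun v => ?_)
      rw [norm_mul, norm_mul, Complex.norm_I, one_mul, Complex.norm_real, Real.norm_eq_abs]
      have h8 := abs_real_inner_le_norm z ((2 * Real.pi) • v)
      rw [norm_smul, Real.norm_of_nonneg (by positivity)] at h8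
      nlinarith [norm_nonneg (f v), mul_le_mul_of_nonneg_left h8 (norm_nonneg (f v))]
    have hsub : Integrable fun v => f v * character v (x + z) - f v * character v x :=
      (integrable_mul_character hf _).sub (integrable_mul_character hf _)
    rcases lt_or_ge ‖z‖ 1 with hz | hz
    · rw [levyIntegrand_of_lt _ _ hz]
      simp only [levyPhase_of_lt _ hz]
      push_cast
      rw [hgf, hgf, fderiv_eq_superpose hg hf hf1 hgf, superpose, superpose, superpose,
        ← integral_sub (integrable_mul_character hf _) (integrable_mul_character hf _),
        ← integral_sub hsub (integrable_mul_character hfi _)]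
      refine integral_congr_ae (ae_of_all _ fun v => ?_)
      simp only [character_add]
      rw [show character v z = Complex.exp (Complex.I * (inner ℝ z ((2 * Real.pi) • v) : ℝ))
        from rfl]
      ring
    · rw [levyIntegrand_of_le _ _ hz]
      simp only [levyPhase_of_le _ hz]
      push_cast
      rw [hgf, hgf, superpose, superpose,
        ← integral_sub (integrable_mul_character hf _) (integrable_mul_character hf _)]
      refine integral_congr_ae (ae_of_all _ fun v => ?_)
      simp only [character_add]
      rw [show character v z = Complex.exp (Complex.I * (inner ℝ z ((2 * Real.pi) • v) : ℝ))
        from rfl]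
      ring
  rw [levyOp, ← integral_complex_ofReal]
  simp only [hint]
  rw [integral_integral_swap]
  · rw [superpose]
    refine integral_congr_ae (ae_of_all _ fun v => ?_)
    simp only
    rw [integral_const_mul, mul_right_comm]
    rfl
  · have h1 : Integrable (fun q : RSpace d × RSpace d => levyWeight q.1 *
        (2 * ‖f q.2‖ + 3 * (2 * Real.pi) ^ 2 * (‖q.2‖ ^ 2 * ‖f q.2‖))) (ν₀.prod volume) :=
      (integrable_levyWeight hν₀).mul_prod ((hf.norm.const_mul _).add (hf2.const_mul _))
    refine h1.mono' (((integrable_mul_character hf x).aestronglyMeasurable.comp_snd).mul ?_)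
      (ae_of_all _ fun q => ?_)
    · have : Measurable fun q : RSpace d × RSpace d => ((2 * Real.pi) • q.2, q.1) := by fun_prop
      exact (measurable_levyPhase_uncurry.comp this).aestronglyMeasurable
    · simp only [Function.uncurry, norm_mul, norm_character, mul_one]
      refine (mul_le_mul_of_nonneg_left (norm_levyPhase_le _ _) (norm_nonneg _)).trans
        (le_of_eq ?_)
      rw [norm_smul, Real.norm_of_nonneg (by positivity)]
      ring

end

/-! ### The laws of the heat semigroup -/

section
variable {d : ℕ} {ν : Measure (RSpace d)} {T σ : ℝ} {𝒦 : ℕ → ℝ → ℝ}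

/-- The multiplier `exp(t 𝓛^(2πv))` of the heat semigroup. -/
def heatMultiplier (ν : Measure (RSpace d)) (t : ℝ) (v : RSpace d) : ℂ :=
  Complex.exp ((t : ℂ) * levySymbol ν ((2 * Real.pi) • v))

lemma continuous_heatMultiplier (hν : levyIntegral ν < ∞) (t : ℝ) :
    Continuous (heatMultiplier ν t) := by
  have := continuous_levySymbol hν
  unfold heatMultiplier
  fun_prop

lemma norm_heatMultiplier (t : ℝ) (v : RSpace d) :
    ‖heatMultiplier ν t v‖ = Real.exp (t * (levySymbol ν ((2 * Real.pi) • v)).re) := by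
  rw [heatMultiplier, Complex.norm_exp]
  simp

lemma norm_heatMultiplier_anti (hν : levyIntegral ν < ∞) {s t : ℝ} (hst : s ≤ t) (v : RSpace d) :
    ‖heatMultiplier ν t v‖ ≤ ‖heatMultiplier ν s v‖ := by
  rw [norm_heatMultiplier, norm_heatMultiplier]
  exact Real.exp_le_exp.2 (mul_le_mul_of_nonpos_right hst (re_levySymbol_nonpos hν _))

lemma heatKernel_eq_re (t : ℝ) (x : RSpace d) :
    heatKernel ν t x = (superpose (heatMultiplier ν t) x).re := by
  rw [superpose_eq_fourierInv]; rfl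

/-- Integrability is hidden in the normalisation of the kernel: the Bochner integral of a
non-integrable function is 0, so the kernel would vanish identically and could not have L¹ norm 1.
-/
lemma integrable_heatMultiplier (hν : levyIntegral ν < ∞) (hK : HeatKernelBounds ν T σ 𝒦)
    {t : ℝ} (ht : t ∈ Ioo 0 T) : Integrable (heatMultiplier ν t) := by
  by_contra hni
  have h0 : heatKernel ν t = 0 := by
    funext x
    rw [heatKernel_eq_re, superpose, integral_undef]
    · rfl
    · refine fun hi => hni (hi.mono (continuous_heatMultiplier hν t).aestronglyMeasurable
        (ae_of_all _ fun v => ?_))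
      rw [norm_mul, norm_character, mul_one]
  have := (hK t ht).2.2.1
  rw [h0, eLpNorm_zero] at this
  exact zero_ne_one this

/-- Conjugation sends the symbol at ξ to the symbol at -ξ, and the substitution v ↦ -v undoes it, so
the inverse transform is real. -/
lemma superpose_heatMultiplier (t : ℝ) (x : RSpace d) :
    superpose (heatMultiplier ν t) x = (heatKernel ν t x : ℂ) := by
  rw [heatKernel_eq_re]
  refine (Complex.conj_eq_iff_re.1 ?_).symm
  rw [superpose, ← integral_conj, ← integral_neg_eq_self]
  refine integral_congr_ae (ae_of_all _ fun v => ?_)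
  simp only [heatMultiplier, character, map_mul, map_neg, ← Complex.exp_conj, Complex.conj_I,
    Complex.conj_ofReal, smul_neg, levySymbol_neg, inner_neg_right, Complex.ofReal_neg,
    Complex.conj_conj, mul_neg, neg_mul, neg_neg]

lemma integrable_heatKernel (hK : HeatKernelBounds ν T σ 𝒦) {t : ℝ} (ht : t ∈ Ioo 0 T) :
    Integrable (heatKernel ν t) := by
  obtain ⟨h1, -, h3, -⟩ := hK t ht
  rw [← memLp_one_iff_integrable]
  exact ⟨h1.continuous.aestronglyMeasurable, by rw [h3]; exact ENNReal.one_lt_top⟩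

/-- The probability measure with density the heat kernel. -/
def heatMeasure (ν : Measure (RSpace d)) (t : ℝ) : Measure (RSpace d) :=
  volume.withDensity fun x => ENNReal.ofReal (heatKernel ν t x)

/-- `p` is the law with characteristic function `exp(t 𝓛^(-ξ))`. -/
def IsHeatLaw (ν : Measure (RSpace d)) (t : ℝ) (p : Measure (RSpace d)) : Prop :=
  IsProbabilityMeasure p ∧ ∀ ξ, charFun p ξ = Complex.exp ((t : ℂ) * levySymbol ν (-ξ))

/-- Fourier inversion: the multiplier is continuous and integrable, and its transform is the
reflected kernel, which is integrable too. -/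
lemma isHeatLaw_heatMeasure (hν : levyIntegral ν < ∞) (hK : HeatKernelBounds ν T σ 𝒦)
    {t : ℝ} (ht : t ∈ Ioo 0 T) : IsHeatLaw ν t (heatMeasure ν t) := by
  obtain ⟨hcd, hpos, h1, -⟩ := hK t ht
  have hKi := integrable_heatKernel hK ht
  have hmeas : Measurable fun x => ENNReal.ofReal (heatKernel ν t x) :=
    hcd.continuous.measurable.ennreal_ofReal
  refine ⟨⟨?_⟩, fun ξ => ?_⟩
  · rw [heatMeasure, withDensity_apply _ MeasurableSet.univ, Measure.restrict_univ, ← h1,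
      eLpNorm_one_eq_lintegral_enorm]
    exact lintegral_congr fun x => (Real.enorm_of_nonneg (hpos x)).symm
  · have hmi := integrable_heatMultiplier hν hK ht
    have hKc : (fun x => (heatKernel ν t x : ℂ)) = 𝓕⁻ (heatMultiplier ν t) := by
      rw [← superpose_eq_fourierInv]
      exact (funext fun x => superpose_heatMultiplier t x).symm
    have hFi : Integrable (𝓕 (heatMultiplier ν t)) := by
      have h2 : (𝓕 (heatMultiplier ν t) : RSpace d → ℂ) = fun x => (heatKernel ν t (-x) : ℂ) := by
        funext x
        have := congrFun hKc (-x)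
        rw [this, Real.fourierInv_eq_fourier_neg, neg_neg]
      rw [h2]
      exact hKi.comp_neg.ofReal
    have hinv := (continuous_heatMultiplier hν t).fourier_fourierInv_eq hmi hFi
    have h3 : charFun (heatMeasure ν t) ξ
        = 𝓕 (fun x => (heatKernel ν t x : ℂ)) (-((2 * Real.pi)⁻¹ • ξ)) := by
      rw [charFun_apply, heatMeasure, integral_withDensity_eq_integral_toReal_smul hmeas
        (ae_of_all _ fun x => ENNReal.ofReal_lt_top), Real.fourier_eq']
      refine integral_congr_ae (ae_of_all _ fun x => ?_)
      simp only [ENNReal.toReal_ofReal (hpos x), Complex.real_smul, smul_eq_mul, inner_neg_right,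
        inner_smul_right]
      rw [mul_comm]
      congr 3
      push_cast
      field_simp
    rw [h3, hKc, hinv, heatMultiplier, smul_neg, smul_smul, mul_inv_cancel₀ (by positivity),
      one_smul]

lemma isHeatLaw_zero : IsHeatLaw ν 0 (Measure.dirac 0) :=
  ⟨inferInstance, fun ξ => by simp [charFun_dirac]⟩

lemma IsHeatLaw.conv {s t : ℝ} {p q : Measure (RSpace d)} (hp : IsHeatLaw ν s p)
    (hq : IsHeatLaw ν t q) : IsHeatLaw ν (s + t) (p.conv q) := by
  have := hp.1
  have := hq.1
  refine ⟨inferInstance, fun ξ => ?_⟩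
  rw [charFun_conv, hp.2, hq.2, ← Complex.exp_add]
  push_cast; ring_nf

lemma IsHeatLaw.unique {t : ℝ} {p q : Measure (RSpace d)} (hp : IsHeatLaw ν t p)
    (hq : IsHeatLaw ν t q) : p = q := by
  have := hp.1
  have := hq.1
  exact Measure.ext_of_charFun (funext fun ξ => by rw [hp.2, hq.2])

/-- The kernel hypotheses cover only 0 < t < T, while the flow is needed at t = T as well.
Convolving the law at t/2 with itself doubles the range of times at each step. -/
lemma exists_isHeatLaw (hν : levyIntegral ν < ∞) (hK : HeatKernelBounds ν T σ 𝒦) (hT : 0 < T)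
    {t : ℝ} (ht : 0 ≤ t) : ∃ p, IsHeatLaw ν t p := by
  have h : ∀ n : ℕ, ∀ t ∈ Ico 0 (2 ^ n * T), ∃ p, IsHeatLaw ν t p := by
    intro n
    induction n with
    | zero =>
      rintro t ⟨h0, h1⟩
      rcases h0.eq_or_lt with rfl | h0
      · exact ⟨_, isHeatLaw_zero⟩
      · exact ⟨_, isHeatLaw_heatMeasure hν hK ⟨h0, by simpa using h1⟩⟩
    | succ n ih =>
      rintro t ⟨h0, h1⟩
      obtain ⟨p, hp⟩ := ih (t / 2) ⟨by positivity, by rw [pow_succ] at h1; linarith⟩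
      exact ⟨_, by simpa using hp.conv hp⟩
  obtain ⟨n, hn⟩ := pow_unbounded_of_one_lt (t / T) one_lt_two
  exact h n t ⟨ht, by rwa [div_lt_iff₀ hT] at hn⟩

/-- The symbol has nonpositive real part, so the modulus of the multiplier decreases in time. Near t
it is dominated by its value at t/2, which is integrable. -/
lemma continuousOn_heatKernel (hν : levyIntegral ν < ∞) (hK : HeatKernelBounds ν T σ 𝒦) :
    ContinuousOn (fun q : ℝ × RSpace d => heatKernel ν q.1 q.2) (Ioo (0 : ℝ) T ×ˢ univ) := by
  rintro ⟨t, x⟩ ⟨ht, -⟩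
  refine ContinuousAt.continuousWithinAt ?_
  have ht2 : t / 2 ∈ Ioo 0 T := ⟨half_pos ht.1, (half_lt_self ht.1).trans ht.2⟩
  simp only [heatKernel_eq_re]
  refine Complex.continuous_re.continuousAt.comp
    (f := fun q : ℝ × RSpace d => superpose (heatMultiplier ν q.1) q.2) ?_
  refine tendsto_integral_filter_of_dominated_convergence
    (F := fun (q : ℝ × RSpace d) v => heatMultiplier ν q.1 v * character v q.2)
    (fun v => ‖heatMultiplier ν (t / 2) v‖)
    (Eventually.of_forall fun q => ((continuous_heatMultiplier hν _).mul
      (continuous_character_left _)).aestronglyMeasurable) ?_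
    (integrable_heatMultiplier hν hK ht2).norm (ae_of_all _ fun v => ?_)
  · have : ∀ᶠ q : ℝ × RSpace d in 𝓝 (t, x), t / 2 < q.1 :=
      continuous_fst.continuousAt.eventually_const_lt (half_lt_self ht.1)
    filter_upwards [this] with q hq
    refine ae_of_all _ fun v => ?_
    rw [norm_mul, norm_character, mul_one]
    exact norm_heatMultiplier_anti hν hq.le v
  · have : Continuous fun q : ℝ × RSpace d => heatMultiplier ν q.1 v * character v q.2 := by
      unfold heatMultiplier character; fun_prop
    exact this.tendsto _

/-! ### Averages and products of functions with Lipschitz gradient -/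

lemma HasLipGrad.hasFDerivAt_average {N : ℝ} {g : RSpace d → ℝ} (hg : HasLipGrad N g)
    {p : Measure (RSpace d)} {k : RSpace d → ℝ} (hk : Integrable k p) (x : RSpace d) :
    HasFDerivAt (fun x => ∫ y, k y * g (x - y) ∂p) (∫ y, k y • fderiv ℝ g (x - y) ∂p) x := by
  have hc := hg.diff.continuous
  refine hasFDerivAt_integral_of_dominated_of_fderiv_le (s := univ)
    (F := fun x y => k y * g (x - y)) (F' := fun x y => k y • fderiv ℝ g (x - y))
    (bound := fun y => ‖k y‖ * N) univ_mem ?_ ?_ ?_ ?_ (hk.norm.mul_const N) ?_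
  · exact Eventually.of_forall fun x => hk.aestronglyMeasurable.mul
      (Continuous.aestronglyMeasurable (by fun_prop))
  · refine (hk.norm.mul_const N).mono' (hk.aestronglyMeasurable.mul
      (Continuous.aestronglyMeasurable (by fun_prop))) (ae_of_all _ fun y => ?_)
    rw [norm_mul]
    gcongr
    exact hg.bound _
  · exact hk.aestronglyMeasurable.smul (hg.continuous_fderiv.comp
      (continuous_const.sub continuous_id)).aestronglyMeasurable
  · refine ae_of_all _ fun y z _ => ?_
    rw [norm_smul]
    gcongr
    exact hg.bound_fderiv _
  · refine ae_of_all _ fun y z _ => ?_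
    have h1 : HasFDerivAt (fun x => g (x - y)) (fderiv ℝ g (z - y)) z := by
      have h2 := (hg.diff (z - y)).hasFDerivAt.comp z ((hasFDerivAt_id z).sub_const y)
      rwa [ContinuousLinearMap.comp_id] at h2
    exact h1.const_mul (k y)

/-- Stated with a density k over a measure p to cover both uses: mollification (p = Lebesgue
measure, k a normalised bump) and the heat flow (p = P_t, k = 1). -/
lemma HasLipGrad.average {N : ℝ} {g : RSpace d → ℝ} (hg : HasLipGrad N g)
    {p : Measure (RSpace d)} {k : RSpace d → ℝ} (hk : Integrable k p) (hk1 : ∫ y, ‖k y‖ ∂p ≤ 1) :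
    HasLipGrad N (fun x => ∫ y, k y * g (x - y) ∂p) := by
  have hN := hg.nonneg
  have hb : ∀ {F : Type} [NormedAddCommGroup F] [NormedSpace ℝ F] (G : RSpace d → F) (C : ℝ),
      0 ≤ C → (∀ y, ‖G y‖ ≤ C) → ‖∫ y, k y • G y ∂p‖ ≤ C := by
    intro F _ _ G C hC hG
    refine (norm_integral_le_of_norm_le (hk.norm.mul_const C) (ae_of_all _ fun y => ?_)).trans ?_
    · rw [norm_smul]; gcongr; exact hG y
    · rw [integral_mul_const]; exact mul_le_of_le_one_left hC hk1
  have hki : ∀ x, Integrable (fun y => k y • fderiv ℝ g (x - y)) p := fun x => by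
    refine (hk.norm.mul_const N).mono' (hk.aestronglyMeasurable.smul (hg.continuous_fderiv.comp
      (continuous_const.sub continuous_id)).aestronglyMeasurable) (ae_of_all _ fun y => ?_)
    rw [norm_smul]
    gcongr
    exact hg.bound_fderiv _
  refine ⟨fun x => (hg.hasFDerivAt_average hk x).differentiableAt, fun x => ?_, fun x => ?_,
    fun x y => ?_⟩
  · exact hb (fun y => g (x - y)) N hN fun y => hg.bound _
  · rw [(hg.hasFDerivAt_average hk x).fderiv]
    exact hb _ N hN fun y => hg.bound_fderiv _
  · rw [(hg.hasFDerivAt_average hk x).fderiv, (hg.hasFDerivAt_average hk y).fderiv,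
      ← integral_sub (hki x) (hki y)]
    simp only [← smul_sub]
    refine hb _ _ (by positivity) fun z => (hg.lip _ _).trans ?_
    rw [sub_sub_sub_cancel_right]

lemma HasLipGrad.abs_sub_le {N : ℝ} {g : RSpace d → ℝ} (hg : HasLipGrad N g) (x y : RSpace d) :
    |g x - g y| ≤ N * ‖x - y‖ :=
  convex_univ.norm_image_sub_le_of_norm_fderiv_le (fun z _ => hg.diff z)
    (fun z _ => hg.bound_fderiv z) (mem_univ y) (mem_univ x)

lemma HasLipGrad.mul {A N : ℝ} {f g : RSpace d → ℝ} (hf : HasLipGrad A f) (hg : HasLipGrad N g) :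
    HasLipGrad (4 * (A * N)) (fun x => f x * g x) := by
  have hA := hf.nonneg
  have hN := hg.nonneg
  have hAN := mul_nonneg hA hN
  have hfd : ∀ x, fderiv ℝ (fun x => f x * g x) x = f x • fderiv ℝ g x + g x • fderiv ℝ f x :=
    fun x => fderiv_fun_mul (hf.diff x) (hg.diff x)
  have hs : ∀ (a b : ℝ) (φ : RSpace d →L[ℝ] ℝ) (c : ℝ), |a| ≤ b → ‖φ‖ ≤ c → ‖a • φ‖ ≤ b * c := by
    intro a b φ c ha hφ
    rw [norm_smul]
    exact mul_le_mul ha hφ (norm_nonneg _) ((abs_nonneg _).trans ha)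
  refine ⟨hf.diff.mul hg.diff, fun x => ?_, fun x => ?_, fun x y => ?_⟩
  · rw [abs_mul]
    have := mul_le_mul (hf.bound x) (hg.bound x) (abs_nonneg _) hA
    linarith
  · rw [hfd]
    have h1 := hs _ _ _ _ (hf.bound x) (hg.bound_fderiv x)
    have h2 := hs _ _ _ _ (hg.bound x) (hf.bound_fderiv x)
    have := norm_add_le (f x • fderiv ℝ g x) (g x • fderiv ℝ f x)
    linarith
  · rw [hfd, hfd]
    have e : f x • fderiv ℝ g x + g x • fderiv ℝ f x - (f y • fderiv ℝ g y + g y • fderiv ℝ f y)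
        = (f x • (fderiv ℝ g x - fderiv ℝ g y) + (f x - f y) • fderiv ℝ g y)
          + (g x • (fderiv ℝ f x - fderiv ℝ f y) + (g x - g y) • fderiv ℝ f y) := by
      simp only [smul_sub, sub_smul]; abel
    rw [e]
    have h1 := hs _ _ _ _ (hf.bound x) (hg.lip x y)
    have h2 := hs _ _ _ _ (hf.abs_sub_le x y) (hg.bound_fderiv y)
    have h3 := hs _ _ _ _ (hg.bound x) (hf.lip x y)
    have h4 := hs _ _ _ _ (hg.abs_sub_le x y) (hf.bound_fderiv y)
    refine (norm_add_le _ _).trans ((add_le_add (norm_add_le _ _) (norm_add_le _ _)).trans ?_)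
    linarith

end

/-! ### The generator of the heat semigroup -/

section
variable {d : ℕ} {ν : Measure (RSpace d)} {T σ : ℝ} {𝒦 : ℕ → ℝ → ℝ}

/-- The identity `P_h g - g = ∫_0^h P_r 𝓛g dr`. -/
def GeneratorFormula (ν : Measure (RSpace d)) (P : ℝ → Measure (RSpace d)) (g : RSpace d → ℝ) :
    Prop :=
  ∀ h, 0 ≤ h → ∀ x, IntervalIntegrable (fun r => ∫ y, levyOp ν g (x - y) ∂(P r)) volume 0 h ∧
    (∫ y, g (x - y) ∂(P h)) - g x = ∫ r in 0..h, ∫ y, levyOp ν g (x - y) ∂(P r)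

lemma exists_superpose_eq {g : RSpace d → ℝ} (hg : ContDiff ℝ ((⊤ : ℕ∞) : WithTop ℕ∞) g)
    (hc : HasCompactSupport g) : ∃ f : RSpace d → ℂ, Integrable f ∧
      (Integrable fun v => ‖v‖ * ‖f v‖) ∧ (Integrable fun v => ‖v‖ ^ 2 * ‖f v‖) ∧
      ∀ x, (g x : ℂ) = superpose f x := by
  have hc' : HasCompactSupport fun x => (g x : ℂ) := hc.comp_left Complex.ofReal_zero
  have hg' : ContDiff ℝ ((⊤ : ℕ∞) : WithTop ℕ∞) fun x => (g x : ℂ) :=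
    Complex.ofRealCLM.contDiff.comp hg
  let G : SchwartzMap (RSpace d) ℂ := hc'.toSchwartzMap hg'
  let F : SchwartzMap (RSpace d) ℂ := 𝓕 G
  refine ⟨F, F.integrable, by simpa using F.integrable_pow_mul volume 1,
    F.integrable_pow_mul volume 2, fun x => ?_⟩
  rw [superpose_eq_fourierInv]
  have h1 : (F : RSpace d → ℂ) = 𝓕 (G : RSpace d → ℂ) := SchwartzMap.fourier_coe G
  have h2 : Integrable (𝓕 (G : RSpace d → ℂ)) := h1 ▸ F.integrable
  rw [h1, G.continuous.fourierInv_fourier_eq G.integrable h2]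
  rfl

/-- For g = ∫ f(v) exp(2πi v·x) dv and ψ the symbol, the identity is exp(hψ) - 1 = ∫_0^h ψ exp(rψ)
dr at each frequency. The Schwartz decay of f makes f ψ integrable and justifies Fubini. -/
lemma generatorFormula_of_smooth (hν : levyIntegral ν < ∞) {P : ℝ → Measure (RSpace d)}
    (hP : ∀ t, 0 ≤ t → IsHeatLaw ν t (P t)) {g : RSpace d → ℝ}
    (hg : ContDiff ℝ ((⊤ : ℕ∞) : WithTop ℕ∞) g) (hc : HasCompactSupport g) :
    GeneratorFormula ν P g := by
  obtain ⟨f, hf, hf1, hf2, hgf⟩ := exists_superpose_eq hg hc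
  have hgd : Differentiable ℝ g := hg.differentiable (by simp)
  intro h hh x
  have hlevy := levyOp_eq_superpose hν hgd hf hf1 hf2 hgf
  have hfψ := integrable_mul_levySymbol hν hf hf2
  have hm : ∀ r, 0 ≤ r → ∀ v, charFun (P r) (-((2 * Real.pi) • v)) = heatMultiplier ν r v := by
    intro r hr v
    rw [(hP r hr).2, neg_neg, heatMultiplier]
  have hlaw : ∀ {f : RSpace d → ℂ}, Integrable f → ∀ r, 0 ≤ r →
      ∫ y, superpose f (x - y) ∂(P r) = superpose (fun v => f v * heatMultiplier ν r v) x := by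
    intro f hf r hr
    have := (hP r hr).1
    rw [integral_superpose_sub hf]
    simp only [hm r hr]
  have hbd : ∀ r, 0 ≤ r → ∀ v, ‖heatMultiplier ν r v‖ ≤ 1 := fun r hr v =>
    norm_exp_mul_levySymbol_le hν hr _
  have hcψ : Continuous fun v : RSpace d => levySymbol ν ((2 * Real.pi) • v) :=
    (continuous_levySymbol hν).comp (continuous_const_smul _)
  have hcm : Continuous fun q : ℝ × RSpace d => heatMultiplier ν q.1 q.2 := by
    unfold heatMultiplier
    exact Complex.continuous_exp.comp ((Complex.continuous_ofReal.comp continuous_fst).mul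
      (hcψ.comp continuous_snd))
  set k : RSpace d → ℂ := fun v => f v * levySymbol ν ((2 * Real.pi) • v) with hk
  have hinner : ∀ r, 0 ≤ r → ((∫ y, levyOp ν g (x - y) ∂(P r) : ℝ) : ℂ)
      = ∫ v, k v * heatMultiplier ν r v * character v x := by
    intro r hr
    rw [← integral_complex_ofReal]
    simp only [hlevy]
    exact hlaw hfψ r hr
  have hcont : ContinuousOn (fun r => ∫ v, k v * heatMultiplier ν r v * character v x)
      (Ici 0) := by
    intro r₀ _
    refine tendsto_integral_filter_of_dominated_convergence (fun v => ‖k v‖) ?_ ?_ hfψ.norm ?_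
    · exact Eventually.of_forall fun r => (hfψ.aestronglyMeasurable.mul
        (continuous_heatMultiplier hν r).aestronglyMeasurable).mul
        (continuous_character_left x).aestronglyMeasurable
    · filter_upwards [self_mem_nhdsWithin] with r hr
      refine ae_of_all _ fun v => ?_
      rw [norm_mul, norm_mul, norm_character, mul_one]
      exact mul_le_of_le_one_right (norm_nonneg _) (hbd r hr v)
    · refine ae_of_all _ fun v => ?_
      have h1 : Continuous fun r : ℝ => k v * heatMultiplier ν r v * character v x :=
        (continuous_const.mul (hcm.comp (Continuous.prodMk_left v))).mul continuous_const
      exact h1.continuousWithinAt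
  have hcont' : ContinuousOn (fun r => ∫ y, levyOp ν g (x - y) ∂(P r)) (Ici 0) := by
    have h1 := Complex.continuous_re.comp_continuousOn hcont
    refine h1.congr fun r hr => ?_
    simp only [Function.comp]
    rw [← hinner r hr, Complex.ofReal_re]
  refine ⟨(hcont'.mono (by rw [uIcc_of_le hh]; exact Icc_subset_Ici_self)).intervalIntegrable, ?_⟩
  have hL : ((∫ y, g (x - y) ∂(P h) : ℝ) : ℂ) = superpose (fun v => f v * heatMultiplier ν h v) x := by
    rw [← integral_complex_ofReal]
    simp only [hgf]
    exact hlaw hf h hh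
  have hR : ((∫ r in 0..h, ∫ y, levyOp ν g (x - y) ∂(P r) : ℝ) : ℂ)
      = ∫ r in 0..h, ∫ v, k v * heatMultiplier ν r v * character v x := by
    rw [← intervalIntegral.integral_ofReal]
    refine intervalIntegral.integral_congr fun r hr => ?_
    rw [uIcc_of_le hh] at hr
    exact hinner r hr.1
  rw [← Complex.ofReal_inj]
  push_cast
  rw [hL, hgf, hR, intervalIntegral.integral_of_le hh, integral_integral_swap]
  · have hfm : Integrable fun v => f v * heatMultiplier ν h v := by
      refine hf.mono (hf.aestronglyMeasurable.mul
        (continuous_heatMultiplier hν h).aestronglyMeasurable) (ae_of_all _ fun v => ?_)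
      rw [norm_mul]
      exact mul_le_of_le_one_right (norm_nonneg _) (hbd h hh v)
    rw [superpose, superpose, ← integral_sub (integrable_mul_character hfm x)
      (integrable_mul_character hf x)]
    refine integral_congr_ae (ae_of_all _ fun v => ?_)
    simp only
    rw [← intervalIntegral.integral_of_le hh]
    have hder : ∀ r : ℝ, HasDerivAt (fun r : ℝ => f v * heatMultiplier ν r v * character v x)
        (k v * heatMultiplier ν r v * character v x) r := by
      intro r
      have h1 : HasDerivAt (fun r : ℝ => (r : ℂ) * levySymbol ν ((2 * Real.pi) • v))
          (1 * levySymbol ν ((2 * Real.pi) • v)) r :=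
        (HasDerivAt.ofReal_comp (hasDerivAt_id r)).mul_const _
      refine ((h1.cexp.const_mul (f v)).mul_const (character v x)).congr_deriv ?_
      simp only [hk, heatMultiplier]
      ring
    rw [intervalIntegral.integral_eq_sub_of_hasDerivAt (fun r _ => hder r)]
    · simp [heatMultiplier]
    · refine Continuous.intervalIntegrable ?_ _ _
      exact (continuous_const.mul (hcm.comp (Continuous.prodMk_left v))).mul continuous_const
  · have h1 : Integrable (fun q : ℝ × RSpace d => (1 : ℝ) * ‖k q.2‖)
        ((volume.restrict (Ioc 0 h)).prod volume) :=
      Integrable.mul_prod (f := fun _ => (1 : ℝ)) (integrable_const 1) hfψ.norm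
    have hpos : ∀ᵐ q : ℝ × RSpace d ∂((volume.restrict (Ioc 0 h)).prod volume), 0 ≤ q.1 := by
      have h2 : ∀ᵐ r : ℝ ∂(volume.restrict (Ioc 0 h)), 0 ≤ r :=
        (ae_restrict_iff' measurableSet_Ioc).2 (ae_of_all _ fun r hr => hr.1.le)
      exact Measure.quasiMeasurePreserving_fst.ae h2
    refine h1.mono' ((hfψ.aestronglyMeasurable.comp_snd.mul hcm.aestronglyMeasurable).mul
      ((continuous_character_left x).comp continuous_snd).aestronglyMeasurable) ?_
    filter_upwards [hpos] with q hq
    simp only [Function.uncurry, norm_mul, norm_character, mul_one, one_mul]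
    exact mul_le_of_le_one_right (norm_nonneg _) (hbd _ hq _)

/-- Pointwise convergence of values and gradients under one common bound `N` suffices: 𝓛g_n is then
bounded and converges pointwise, and dominated convergence applies in y and in r. -/
lemma GeneratorFormula.of_tendsto (hν : levyIntegral ν < ∞) {P : ℝ → Measure (RSpace d)}
    (hP : ∀ t, IsProbabilityMeasure (P t)) {N : ℝ} {g : ℕ → RSpace d → ℝ}
    {g₀ : RSpace d → ℝ} (hg : ∀ n, HasLipGrad N (g n))
    (hG : ∀ n, GeneratorFormula ν P (g n))
    (h0 : ∀ x, Tendsto (fun n => g n x) atTop (𝓝 (g₀ x)))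
    (h1 : ∀ x, Tendsto (fun n => fderiv ℝ (g n) x) atTop (𝓝 (fderiv ℝ g₀ x))) :
    GeneratorFormula ν P g₀ := by
  have hlevy : ∀ x, Tendsto (fun n => levyOp ν (g n) x) atTop (𝓝 (levyOp ν g₀ x)) := fun x =>
    tendsto_levyOp (x := fun _ => x) hν (Eventually.of_forall hg) (h0 x) (fun z => h0 (x + z))
      fun z => ((ContinuousLinearMap.apply ℝ ℝ z).continuous.tendsto _).comp (h1 x)
  obtain ⟨Λ, hΛ⟩ : ∃ Λ : ℝ, levyIntegral ν ≤ ENNReal.ofReal Λ :=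
    ⟨(levyIntegral ν).toReal, (ENNReal.ofReal_toReal hν.ne).ge⟩
  set c := 2 * N * max Λ 0
  have hP1 : ∀ r, ∀ x, Tendsto (fun n => ∫ y, levyOp ν (g n) (x - y) ∂(P r)) atTop
      (𝓝 (∫ y, levyOp ν g₀ (x - y) ∂(P r))) := fun r x => by
    refine tendsto_integral_of_dominated_convergence (fun _ => c) (fun n => ?_)
      (integrable_const c) (fun n => ae_of_all _ fun y => (hg n).abs_levyOp_le hΛ _)
      (ae_of_all _ fun y => hlevy _)
    exact (((hg n).continuous_levyOp hν).comp (by fun_prop)).aestronglyMeasurable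
  have hbd : ∀ n r x, ‖∫ y, levyOp ν (g n) (x - y) ∂(P r)‖ ≤ c := fun n r x => by
    refine (norm_integral_le_of_norm_le (integrable_const c)
      (ae_of_all _ fun y => (hg n).abs_levyOp_le hΛ (x - y))).trans ?_
    simp
  intro h hh x
  have hmeas : ∀ n, AEStronglyMeasurable (fun r => ∫ y, levyOp ν (g n) (x - y) ∂(P r))
      (volume.restrict (uIoc 0 h)) := fun n => 
    (intervalIntegrable_iff.1 (hG n h hh x).1).aestronglyMeasurable
  refine ⟨?_, ?_⟩
  · rw [intervalIntegrable_iff]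
    have : IsFiniteMeasure (volume.restrict (uIoc 0 h)) := by
      rw [uIoc_of_le hh]; infer_instance
    refine Integrable.mono' (integrable_const c)
      (aestronglyMeasurable_of_tendsto_ae atTop hmeas (ae_of_all _ fun r => hP1 r x)) ?_
    refine ae_of_all _ fun r => ?_
    exact le_of_tendsto (hP1 r x).norm (Eventually.of_forall fun n => hbd n r x)
  · have l1 : Tendsto (fun n => (∫ y, g n (x - y) ∂(P h)) - g n x) atTop
        (𝓝 ((∫ y, g₀ (x - y) ∂(P h)) - g₀ x)) := by
      refine Tendsto.sub ?_ (h0 x)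
      refine tendsto_integral_of_dominated_convergence (fun _ => N) (fun n => ?_)
        (integrable_const N) (fun n => ae_of_all _ fun y => (hg n).bound _)
        (ae_of_all _ fun y => h0 _)
      exact ((hg n).diff.continuous.comp (by fun_prop)).aestronglyMeasurable
    have l2 : Tendsto (fun n => ∫ r in 0..h, ∫ y, levyOp ν (g n) (x - y) ∂(P r)) atTop
        (𝓝 (∫ r in 0..h, ∫ y, levyOp ν g₀ (x - y) ∂(P r))) :=
      intervalIntegral.tendsto_integral_filter_of_dominated_convergence (fun _ => c)
        (Eventually.of_forall hmeas)
        (Eventually.of_forall fun n => ae_of_all _ fun r _ => hbd n r x)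
        intervalIntegrable_const (ae_of_all _ fun r _ => hP1 r x)
    exact tendsto_nhds_unique l1 (l2.congr fun n => ((hG n h hh x).2).symm)

lemma generatorFormula_of_hasCompactSupport (hν : levyIntegral ν < ∞)
    {P : ℝ → Measure (RSpace d)} (hP : ∀ t, IsProbabilityMeasure (P t))
    (hPl : ∀ t, 0 ≤ t → IsHeatLaw ν t (P t)) {N : ℝ} {g : RSpace d → ℝ} (hg : HasLipGrad N g)
    (hc : HasCompactSupport g) : GeneratorFormula ν P g := by
  -- Mollification preserves the bound `N` and the compact support, so the smooth case passes to the
  -- limit.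
  let φ : ℕ → ContDiffBump (0 : RSpace d) := fun n =>
    ⟨1 / ((n : ℝ) + 2), 1 / ((n : ℝ) + 1), by positivity, by gcongr; norm_num⟩
  have hφ : Tendsto (fun n => (φ n).rOut) atTop (𝓝 0) :=
    tendsto_one_div_add_atTop_nhds_zero_nat (𝕜 := ℝ)
  have hint : ∀ n, Integrable ((φ n).normed volume) := fun n => (φ n).integrable_normed
  have hint1 : ∀ n, ∫ y, ‖(φ n).normed volume y‖ ≤ 1 := fun n => by
    have : ∀ y, ‖(φ n).normed volume y‖ = (φ n).normed volume y := fun y =>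
      Real.norm_of_nonneg ((φ n).nonneg_normed y)
    simp only [this]
    exact (φ n).integral_normed.le
  refine GeneratorFormula.of_tendsto hν hP (N := N)
    (g := fun n x => ∫ y, (φ n).normed volume y * g (x - y))
    (fun n => hg.average (hint n) (hint1 n)) (fun n => ?_) (fun x => ?_) (fun x => ?_)
  · refine generatorFormula_of_smooth hν hPl ?_ ?_
    · exact (φ n).hasCompactSupport_normed.contDiff_convolution_left
        (ContinuousLinearMap.lsmul ℝ ℝ) (φ n).contDiff_normed
        hg.diff.continuous.locallyIntegrable
    · exact (φ n).hasCompactSupport_normed.convolution (ContinuousLinearMap.lsmul ℝ ℝ) hc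
  · exact ContDiffBump.convolution_tendsto_right_of_continuous (μ := volume) hφ
      hg.diff.continuous x
  · have h1 : ∀ n, fderiv ℝ (fun x => ∫ y, (φ n).normed volume y * g (x - y)) x
        = ∫ y, (φ n).normed volume y • fderiv ℝ g (x - y) := fun n =>
      (hg.hasFDerivAt_average (hint n) x).fderiv
    simp only [h1]
    exact ContDiffBump.convolution_tendsto_right_of_continuous (μ := volume) hφ
      hg.continuous_fderiv x

lemma HasLipGrad.generatorFormula (hν : levyIntegral ν < ∞)
    {P : ℝ → Measure (RSpace d)} (hP : ∀ t, IsProbabilityMeasure (P t))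
    (hPl : ∀ t, 0 ≤ t → IsHeatLaw ν t (P t)) {N : ℝ} {g : RSpace d → ℝ} (hg : HasLipGrad N g) :
    GeneratorFormula ν P g := by
  let χ : ContDiffBump (0 : RSpace d) := ⟨1, 2, one_pos, one_lt_two⟩
  obtain ⟨A, hA⟩ := exists_hasLipGrad_of_hasCompactSupport (χ.contDiff (n := 2))
    χ.hasCompactSupport
  have hr : ∀ n : ℕ, ((n : ℝ) + 1)⁻¹ ∈ Icc (0 : ℝ) 1 := fun n =>
    ⟨by positivity, inv_le_one_of_one_le₀ (by linarith [n.cast_nonneg (α := ℝ)])⟩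
  have hone : ∀ x : RSpace d, ∀ᶠ n : ℕ in atTop,
      (fun x => χ (((n : ℝ) + 1)⁻¹ • x) * g x) =ᶠ[𝓝 x] g := by
    intro x
    filter_upwards [eventually_gt_atTop ⌈‖x‖⌉₊] with n hn
    have hn' : ‖x‖ < (n : ℝ) + 1 := by
      have := Nat.lt_of_ceil_lt hn
      linarith
    filter_upwards [continuous_norm.continuousAt.eventually_lt_const hn'] with y hy
    rw [χ.one_of_mem_closedBall, one_mul]
    rw [mem_closedBall_zero_iff, norm_smul, Real.norm_of_nonneg (hr n).1]
    have : (0 : ℝ) < (n : ℝ) + 1 := by positivity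
    exact (inv_mul_le_one₀ this).2 hy.le
  -- Compact support is removed by dilated cutoffs; the product bound does not depend on n, and near
  -- any fixed point the products eventually coincide with g.
  refine GeneratorFormula.of_tendsto hν hP (N := 4 * (A * N))
    (g := fun n x => χ (((n : ℝ) + 1)⁻¹ • x) * g x)
    (fun n => (hA.comp_smul (hr n)).mul hg) (fun n => ?_)
    (fun x => ?_) (fun x => ?_)
  · refine generatorFormula_of_hasCompactSupport hν hP hPl ((hA.comp_smul (hr n)).mul hg) ?_
    refine HasCompactSupport.mul_right ?_
    exact χ.hasCompactSupport.comp_smul (by positivity)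
  · exact tendsto_const_nhds.congr' ((hone x).mono fun n hn => hn.eq_of_nhds.symm)
  · exact tendsto_const_nhds.congr' ((hone x).mono fun n hn => hn.fderiv_eq.symm)

/-- The properties of the heat semigroup of the Lévy operator on `[0, ∞)` and of its density on
`(0, T)` which are used to solve the Fokker–Planck equation. -/
structure IsHeatSemigroup (ν : Measure (RSpace d)) (T σ C : ℝ) (P : ℝ → Measure (RSpace d))
    (K : ℝ → RSpace d → ℝ) : Prop where
  prob : ∀ t, IsProbabilityMeasure (P t)
  zero : P 0 = Measure.dirac 0
  conv : ∀ s t, 0 ≤ s → 0 ≤ t → (P s).conv (P t) = P (s + t)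
  density : ∀ t ∈ Ioo 0 T, P t = volume.withDensity fun x => ENNReal.ofReal (K t x)
  kernel_nonneg : ∀ t ∈ Ioo 0 T, ∀ x, 0 ≤ K t x
  kernel_contDiff : ∀ t ∈ Ioo 0 T, ContDiff ℝ 1 (K t)
  kernel_continuousOn : ContinuousOn (fun q : ℝ × RSpace d => K q.1 q.2) (Ioo (0 : ℝ) T ×ˢ univ)
  kernel_grad : ∀ t ∈ Ioo 0 T,
    ∫⁻ x, ‖fderiv ℝ (K t) x‖ₑ ≤ ENNReal.ofReal (C * t ^ (-(1 / σ)))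
  generator : ∀ (N : ℝ) (g : RSpace d → ℝ), HasLipGrad N g → GeneratorFormula ν P g

theorem exists_isHeatSemigroup (hν : levyIntegral ν < ∞) (hT : 0 < T)
    (hK : HeatKernelBounds ν T σ 𝒦) :
    ∃ P, IsHeatSemigroup ν T σ (𝒦 1 1) P (heatKernel ν) := by
  -- Freezing the family at the time-zero law for t < 0 gives probability measures for all real t,
  -- so later statements need no sign condition for this.
  have hex : ∀ t : ℝ, ∃ p, IsHeatLaw ν (max t 0) p := fun t =>
    exists_isHeatLaw hν hK hT (le_max_right _ _)
  choose P hP using hex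
  have hP' : ∀ t, 0 ≤ t → IsHeatLaw ν t (P t) := fun t ht => by
    have := hP t
    rwa [max_eq_left ht] at this
  refine ⟨P, fun t => (hP t).1, (hP' 0 le_rfl).unique isHeatLaw_zero, fun s t hs ht => ?_,
    fun t ht => (hP' t ht.1.le).unique (isHeatLaw_heatMeasure hν hK ht),
    fun t ht => (hK t ht).2.1, fun t ht => (hK t ht).1.of_le (by exact_mod_cast le_top),
    continuousOn_heatKernel hν hK, fun t ht => ?_,
    fun N g hg => hg.generatorFormula hν (fun t => (hP t).1) hP'⟩
  · exact ((hP' s hs).conv (hP' t ht)).unique (hP' _ (add_nonneg hs ht))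
  · have h := (hK t ht).2.2.2 1 1 le_rfl
    rw [ENNReal.ofReal_one, eLpNorm_one_eq_lintegral_enorm] at h
    simp only [Nat.cast_one, div_one, sub_self, zero_mul, add_zero] at h
    refine le_trans (le_of_eq (lintegral_congr fun x => ?_)) h
    rw [← ofReal_norm, ← ofReal_norm, ← norm_iteratedFDeriv_fderiv, norm_iteratedFDeriv_zero]

end

/-! ### Smoothness of parametric integrals and of products -/

section
variable {d : ℕ}

set_option maxSynthPendingDepth 5

section ParametricIntegral
variable {E α : Type*} [NormedAddCommGroup E] [NormedSpace ℝ E] [MeasurableSpace α] {p : Measure α} {k : α → ℝ} {G : α → E → ℝ}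
  {n : ℕ} {C : ℝ}

lemma integrable_smul_iteratedFDeriv (hk : Integrable k p)
    (hm : ∀ j ≤ n, ∀ x, AEStronglyMeasurable (fun a => iteratedFDeriv ℝ j (G a) x) p)
    (hC : ∀ j ≤ n, ∀ a x, ‖iteratedFDeriv ℝ j (G a) x‖ ≤ C) {j : ℕ} (hj : j ≤ n) (x : E) :
    Integrable (fun a => k a • iteratedFDeriv ℝ j (G a) x) p := by
  refine (hk.norm.mul_const C).mono' (hk.aestronglyMeasurable.smul (hm j hj x))
    (ae_of_all _ fun a => ?_)
  rw [norm_smul]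
  gcongr
  exact hC j hj a x

/-- Induction on the order: each differentiation under the integral is dominated by |k| C. The
weight k does not depend on the differentiation variable, so it needs no regularity. -/
lemma iteratedFDeriv_integral_eq (hk : Integrable k p) (hG : ∀ a, ContDiff ℝ n (G a))
    (hm : ∀ j ≤ n, ∀ x, AEStronglyMeasurable (fun a => iteratedFDeriv ℝ j (G a) x) p)
    (hC : ∀ j ≤ n, ∀ a x, ‖iteratedFDeriv ℝ j (G a) x‖ ≤ C) {j : ℕ} (hj : j ≤ n) :
    (iteratedFDeriv ℝ j fun x => ∫ a, k a * G a x ∂p)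
      = fun x => ∫ a, k a • iteratedFDeriv ℝ j (G a) x ∂p := by
  have hI := fun {j} => integrable_smul_iteratedFDeriv (j := j) hk hm hC
  induction j with
  | zero =>
    funext x
    simp only [iteratedFDeriv_zero_eq_comp, Function.comp]
    have := (continuousMultilinearCurryFin0 ℝ (E) ℝ).symm.toContinuousLinearEquiv.toContinuousLinearMap.integral_comp_comm
      (μ := p) (φ := fun a => k a * G a x) ?_
    · refine Eq.trans this.symm ?_
      refine integral_congr_ae (ae_of_all _ fun a => ?_)
      exact ((continuousMultilinearCurryFin0 ℝ (E) ℝ).symm.map_smul (k a) (G a x))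
    · have h1 := hI hj x
      refine h1.norm.mono' ?_ (ae_of_all _ fun a => ?_)
      · have h2 := (hm 0 hj x)
        refine hk.aestronglyMeasurable.mul ?_
        simp only [iteratedFDeriv_zero_eq_comp, Function.comp] at h2
        simpa using (continuousMultilinearCurryFin0 ℝ (E) ℝ).continuous.comp_aestronglyMeasurable h2
      · rw [norm_smul, norm_iteratedFDeriv_zero, norm_mul]
  | succ j ih =>
    have hjn : j ≤ n := by omega
    have hj' : (j : WithTop ℕ∞) < n := by exact_mod_cast hj
    have hm' : ∀ x, AEStronglyMeasurable
        (fun a => k a • fderiv ℝ (iteratedFDeriv ℝ j (G a)) x) p := by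
      refine fun x => hk.aestronglyMeasurable.smul ?_
      simp only [fderiv_iteratedFDeriv, Function.comp]
      exact (LinearIsometryEquiv.continuous _).comp_aestronglyMeasurable (hm (j + 1) hj x)
    have hb' : ∀ a x, ‖k a • fderiv ℝ (iteratedFDeriv ℝ j (G a)) x‖ ≤ ‖k a‖ * C := by
      intro a x
      rw [norm_smul, norm_fderiv_iteratedFDeriv]
      gcongr
      exact hC (j + 1) hj a x
    funext x
    have hF : HasFDerivAt (fun x => ∫ a, k a • iteratedFDeriv ℝ j (G a) x ∂p)
        (∫ a, k a • fderiv ℝ (iteratedFDeriv ℝ j (G a)) x ∂p) x :=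
      hasFDerivAt_integral_of_dominated_of_fderiv_le (s := univ)
        (F := fun x a => k a • iteratedFDeriv ℝ j (G a) x)
        (F' := fun x a => k a • fderiv ℝ (iteratedFDeriv ℝ j (G a)) x)
        (bound := fun a => ‖k a‖ * C) univ_mem
        (Eventually.of_forall fun y => (hI hjn y).aestronglyMeasurable)
        (hI hjn x) (hm' x) (ae_of_all _ fun a y _ => hb' a y) (hk.norm.mul_const C)
        (ae_of_all _ fun a y _ =>
          (((hG a).differentiable_iteratedFDeriv hj' y).hasFDerivAt).const_smul (k a))
    have h4 := (hk.norm.mul_const C).mono' (hm' x) (ae_of_all _ fun a => hb' a x)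
    ext w
    rw [iteratedFDeriv_succ_apply_left, ih hjn, hF.fderiv, ContinuousLinearMap.integral_apply h4,
      ContinuousMultilinearMap.integral_apply (h4.apply_continuousLinearMap (w 0)),
      ContinuousMultilinearMap.integral_apply (hI hj x)]
    rfl

lemma contDiff_integral (hk : Integrable k p) (hG : ∀ a, ContDiff ℝ n (G a))
    (hm : ∀ j ≤ n, ∀ x, AEStronglyMeasurable (fun a => iteratedFDeriv ℝ j (G a) x) p)
    (hC : ∀ j ≤ n, ∀ a x, ‖iteratedFDeriv ℝ j (G a) x‖ ≤ C) :
    ContDiff ℝ n fun x => ∫ a, k a * G a x ∂p := by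
  have hI := fun {j} => integrable_smul_iteratedFDeriv (j := j) hk hm hC
  have heq := fun {j} => iteratedFDeriv_integral_eq (j := j) hk hG hm hC
  rw [contDiff_nat_iff_continuous_differentiable]
  refine ⟨fun j hj => ?_, fun j hj => ?_⟩
  · rw [heq hj]
    refine continuous_of_dominated (bound := fun a => ‖k a‖ * C)
      (fun x => (hI hj x).aestronglyMeasurable) (fun x => ae_of_all _ fun a => ?_)
      (hk.norm.mul_const C) (ae_of_all _ fun a => ?_)
    · rw [norm_smul]
      gcongr
      exact hC j hj a x
    · exact ((hG a).continuous_iteratedFDeriv (by exact_mod_cast hj)).const_smul (k a)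
  · rw [heq hj.le]
    intro x
    have hj' : (j : WithTop ℕ∞) < n := by exact_mod_cast hj
    refine HasFDerivAt.differentiableAt (hasFDerivAt_integral_of_dominated_of_fderiv_le (s := univ)
      (F := fun x a => k a • iteratedFDeriv ℝ j (G a) x)
      (F' := fun x a => k a • fderiv ℝ (iteratedFDeriv ℝ j (G a)) x)
      (bound := fun a => ‖k a‖ * C) univ_mem
      (Eventually.of_forall fun y => (hI hj.le y).aestronglyMeasurable)
      (hI hj.le x) ?_ ?_ (hk.norm.mul_const C) ?_)
    · refine hk.aestronglyMeasurable.smul ?_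
      simp only [fderiv_iteratedFDeriv, Function.comp]
      exact (LinearIsometryEquiv.continuous _).comp_aestronglyMeasurable (hm (j + 1) hj x)
    · refine ae_of_all _ fun a y _ => ?_
      rw [norm_smul, norm_fderiv_iteratedFDeriv]
      gcongr
      exact hC (j + 1) hj a y
    · exact ae_of_all _ fun a y _ =>
        (((hG a).differentiable_iteratedFDeriv hj' y).hasFDerivAt).const_smul (k a)

end ParametricIntegral

/-- The space derivatives of order at most `n` are continuous in `(t, x)` for `t ∈ I`. -/
def SpaceContOn {W : Type*} [NormedAddCommGroup W] [NormedSpace ℝ W] (n : ℕ) (I : Set ℝ)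
    (f : ℝ → RSpace d → W) : Prop :=
  ∀ j ≤ n, ContinuousOn (fun q : ℝ × RSpace d => iteratedFDeriv ℝ j (f q.1) q.2) (I ×ˢ univ)

section Product
variable {I : Set ℝ}

lemma spaceContOn_zero_iff {W : Type*} [NormedAddCommGroup W] [NormedSpace ℝ W]
    {f : ℝ → RSpace d → W} :
    SpaceContOn 0 I f ↔ ContinuousOn (fun q : ℝ × RSpace d => f q.1 q.2) (I ×ˢ univ) := by
  have h : (fun q : ℝ × RSpace d => iteratedFDeriv ℝ 0 (f q.1) q.2)
      = (continuousMultilinearCurryFin0 ℝ (RSpace d) W).symm ∘ fun q => f q.1 q.2 := by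
    funext q; simp [iteratedFDeriv_zero_eq_comp]
  refine ⟨fun hf => ?_, fun hf j hj => ?_⟩
  · have := hf 0 le_rfl
    rwa [h, LinearIsometryEquiv.comp_continuousOn_iff] at this
  · obtain rfl : j = 0 := by omega
    rwa [h, LinearIsometryEquiv.comp_continuousOn_iff]

lemma spaceContOn_succ_iff {W : Type*} [NormedAddCommGroup W] [NormedSpace ℝ W] {n : ℕ}
    {f : ℝ → RSpace d → W} :
    SpaceContOn (n + 1) I f ↔ ContinuousOn (fun q : ℝ × RSpace d => f q.1 q.2) (I ×ˢ univ) ∧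
      SpaceContOn n I (fun t => fderiv ℝ (f t)) := by
  have h : ∀ j, (fun q : ℝ × RSpace d => iteratedFDeriv ℝ (j + 1) (f q.1) q.2)
      = (continuousMultilinearCurryRightEquiv' ℝ j (RSpace d) W).symm ∘
        fun q => iteratedFDeriv ℝ j (fderiv ℝ (f q.1)) q.2 := by
    intro j; funext q; simp only [iteratedFDeriv_succ_eq_comp_right]; rfl
  refine ⟨fun hf => ⟨?_, fun j hj => ?_⟩, fun ⟨h0, hf⟩ j hj => ?_⟩
  · exact spaceContOn_zero_iff.1 fun j hj => hf j (by omega)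
  · have := hf (j + 1) (by omega)
    rwa [h, LinearIsometryEquiv.comp_continuousOn_iff] at this
  · rcases j with _ | j
    · exact spaceContOn_zero_iff.2 h0 0 le_rfl
    · rw [h, LinearIsometryEquiv.comp_continuousOn_iff]
      exact hf j (by omega)

lemma SpaceContOn.mono {W : Type*} [NormedAddCommGroup W] [NormedSpace ℝ W] {n k : ℕ}
    {f : ℝ → RSpace d → W} (hf : SpaceContOn n I f) (h : k ≤ n) : SpaceContOn k I f :=
  fun j hj => hf j (hj.trans h)

lemma SpaceContOn.congr {W : Type*} [NormedAddCommGroup W] [NormedSpace ℝ W] {n : ℕ}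
    {f g : ℝ → RSpace d → W} (hf : SpaceContOn n I f) (h : ∀ t ∈ I, g t = f t) :
    SpaceContOn n I g :=
  fun j hj => (hf j hj).congr fun q hq => by rw [h q.1 hq.1]

lemma SpaceContOn.add {W : Type*} [NormedAddCommGroup W] [NormedSpace ℝ W] {n : ℕ}
    {f g : ℝ → RSpace d → W} (hf : SpaceContOn n I f) (hg : SpaceContOn n I g)
    (hfd : ∀ t ∈ I, ContDiff ℝ n (f t)) (hgd : ∀ t ∈ I, ContDiff ℝ n (g t)) :
    SpaceContOn n I (fun t x => f t x + g t x) := by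
  intro j hj
  refine ((hf j hj).add (hg j hj)).congr fun q hq => ?_
  have hj' : (j : WithTop ℕ∞) ≤ n := by exact_mod_cast hj
  exact iteratedFDeriv_add_apply ((hfd _ hq.1).of_le hj').contDiffAt
    ((hgd _ hq.1).of_le hj').contDiffAt

/-- Arbitrary bilinear maps are needed even for scalar products, because the derivative of L(f, g)
is a sum of two bilinear pairings with values in a space of linear maps; the induction therefore
ranges over all spaces. -/
lemma SpaceContOn.bilinear (n : ℕ) {W₁ W₂ W₃ : Type} [NormedAddCommGroup W₁] [NormedSpace ℝ W₁]
    [NormedAddCommGroup W₂] [NormedSpace ℝ W₂] [NormedAddCommGroup W₃] [NormedSpace ℝ W₃]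
    (L : W₁ →L[ℝ] W₂ →L[ℝ] W₃) {f : ℝ → RSpace d → W₁} {g : ℝ → RSpace d → W₂}
    (hf : SpaceContOn n I f) (hg : SpaceContOn n I g)
    (hfd : ∀ t ∈ I, ContDiff ℝ n (f t)) (hgd : ∀ t ∈ I, ContDiff ℝ n (g t)) :
    SpaceContOn n I (fun t x => L (f t x) (g t x)) := by
  induction n generalizing W₁ W₂ W₃ with
  | zero =>
    rw [spaceContOn_zero_iff] at *
    exact L.continuous₂.comp_continuousOn (hf.prodMk hg)
  | succ n ih =>
    have hf' := spaceContOn_succ_iff.1 hf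
    have hg' := spaceContOn_succ_iff.1 hg
    rw [spaceContOn_succ_iff]
    refine ⟨L.continuous₂.comp_continuousOn (hf'.1.prodMk hg'.1), ?_⟩
    have hfd0 : ∀ t ∈ I, ContDiff ℝ n (f t) := fun t ht => (hfd t ht).of_le (by norm_cast; omega)
    have hgd0 : ∀ t ∈ I, ContDiff ℝ n (g t) := fun t ht => (hgd t ht).of_le (by norm_cast; omega)
    have hfd1 : ∀ t ∈ I, ContDiff ℝ n (fderiv ℝ (f t)) := fun t ht =>
      (hfd t ht).fderiv_right (by norm_cast)
    have hgd1 : ∀ t ∈ I, ContDiff ℝ n (fderiv ℝ (g t)) := fun t ht =>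
      (hgd t ht).fderiv_right (by norm_cast)
    have h1 := ih (L.precompR (RSpace d)) (hf.mono (Nat.le_succ n)) hg'.2 hfd0 hgd1
    have h2 := ih (L.precompL (RSpace d)) hf'.2 (hg.mono (Nat.le_succ n)) hfd1 hgd0
    refine (h1.add h2 (fun t ht => ?_) (fun t ht => ?_)).congr fun t ht => ?_
    · exact (L.precompR (RSpace d)).isBoundedBilinearMap.contDiff.comp
        ((hfd0 t ht).prodMk (hgd1 t ht))
    · exact (L.precompL (RSpace d)).isBoundedBilinearMap.contDiff.comp
        ((hfd1 t ht).prodMk (hgd0 t ht))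
    · funext x
      have hn : ((n + 1 : ℕ) : WithTop ℕ∞) ≠ 0 := by norm_cast
      exact L.fderiv_of_bilinear ((hfd t ht).differentiable hn x) ((hgd t ht).differentiable hn x)

end Product

/-! ### Scheffé's lemma -/

/-- Write |f - g| = (f - g) + 2(g - f)⁺. The first term integrates to 0 since the masses agree, and
0 ≤ (g - f)⁺ ≤ g gives dominated convergence for the second. -/
lemma tendsto_integral_abs_sub_of_tendsto {α ι : Type*} [MeasurableSpace α] {p : Measure α}
    {l : Filter ι} [l.IsCountablyGenerated] {f : ι → α → ℝ} {g : α → ℝ} {c : ℝ}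
    (hf : ∀ᶠ i in l, Integrable (f i) p ∧ (∀ a, 0 ≤ f i a) ∧ ∫ a, f i a ∂p = c)
    (hg : Integrable g p) (hgc : ∫ a, g a ∂p = c)
    (h : ∀ a, Tendsto (fun i => f i a) l (𝓝 (g a))) (hg0 : ∀ a, 0 ≤ g a) :
    Tendsto (fun i => ∫ a, |f i a - g a| ∂p) l (𝓝 0) := by
  have h1 : Tendsto (fun i => 2 * ∫ a, max (g a - f i a) 0 ∂p) l (𝓝 (2 * ∫ _, (0 : ℝ) ∂p)) := by
    refine Tendsto.const_mul 2 (tendsto_integral_filter_of_dominated_convergence g ?_ ?_ hg ?_)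
    · exact hf.mono fun i hi =>
        (hg.aestronglyMeasurable.sub hi.1.aestronglyMeasurable).sup aestronglyMeasurable_const
    · refine hf.mono fun i hi => ae_of_all _ fun a => ?_
      rw [Real.norm_of_nonneg (le_max_right _ _)]
      exact max_le (by linarith [hi.2.1 a]) (hg0 a)
    · refine ae_of_all _ fun a => ?_
      simpa using ((tendsto_const_nhds (x := g a)).sub (h a)).max (tendsto_const_nhds (x := (0 : ℝ)))
  rw [integral_zero, mul_zero] at h1
  refine h1.congr' (hf.mono fun i hi => ?_)
  obtain ⟨hi1, hi2, hi3⟩ := hi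
  have h2 : ∀ a, |f i a - g a| = (f i a - g a) + 2 * max (g a - f i a) 0 := by
    intro a
    rcases le_total (f i a) (g a) with h | h
    · rw [abs_of_nonpos (by linarith), max_eq_left (by linarith)]; ring
    · rw [abs_of_nonneg (by linarith), max_eq_right (by linarith)]; ring
  have hmax : Integrable (fun a => 2 * max (g a - f i a) 0) p :=
    ((hg.sub hi1).pos_part).const_mul 2
  have hsub : Integrable (fun a => f i a - g a) p := hi1.sub hg
  simp only [h2]
  rw [integral_add hsub hmax, integral_sub hi1 hg, hi3, hgc, sub_self, zero_add,
    integral_const_mul]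

end

/-! ### Space-time convolution -/

section
variable {d : ℕ} {T l θ A B : ℝ} {κ : ℝ × RSpace d → ℝ} {F : ℝ → RSpace d → ℝ}

/-- Lebesgue measure on `ℝ × ℝ^d`. -/
abbrev spaceTime (d : ℕ) : Measure (ℝ × RSpace d) :=
  (volume : Measure ℝ).prod (volume : Measure (RSpace d))

/-- A kernel supported in `(0,T) × ℝ^d` with weighted mass at most `θ` whose space slices have
integral zero. -/
structure IsVolterraKernel (T l θ : ℝ) (κ : ℝ × RSpace d → ℝ) : Prop where
  aestronglyMeasurable : AEStronglyMeasurable κ (spaceTime d)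
  zero : ∀ q, q.1 ∉ Ioo 0 T → κ q = 0
  weight : ∫⁻ q, ‖κ q‖ₑ * ENNReal.ofReal (Real.exp (-(l * q.1))) ∂(spaceTime d)
    ≤ ENNReal.ofReal θ
  mean : ∀ τ, ∫ y, κ (τ, y) = 0

/-- A function on `(0,T) × ℝ^d` whose space derivatives up to order two are continuous and,
like its `L¹` norm in space, bounded by `A exp(l t)`. -/
structure IsSlab (T l A : ℝ) (F : ℝ → RSpace d → ℝ) : Prop where
  nonneg : 0 ≤ A
  contDiff : ∀ s ∈ Ioo 0 T, ContDiff ℝ 2 (F s)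
  cont : SpaceContOn 2 (Ioo 0 T) F
  bound : ∀ j ≤ 2, ∀ s ∈ Ioo 0 T, ∀ x, ‖iteratedFDeriv ℝ j (F s) x‖ ≤ A * Real.exp (l * s)
  lintegral_le : ∀ s ∈ Ioo 0 T, ∫⁻ x, ‖F s x‖ₑ ≤ ENNReal.ofReal (A * Real.exp (l * s))

open Classical in
/-- The extension of a function on `(0,T) × ℝ^d` by zero. -/
def zeroExtend (T : ℝ) (F : ℝ → RSpace d → ℝ) (s : ℝ) : RSpace d → ℝ :=
  if s ∈ Ioo 0 T then F s else fun _ => 0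

/-- The space-time convolution of `κ` with the extension of `F` by zero. -/
def stConv (T : ℝ) (κ : ℝ × RSpace d → ℝ) (F : ℝ → RSpace d → ℝ) (t : ℝ) (x : RSpace d) : ℝ :=
  ∫ q, κ q * zeroExtend T F (t - q.1) (x - q.2) ∂(spaceTime d)

lemma zeroExtend_of_mem {s : ℝ} (hs : s ∈ Ioo 0 T) : zeroExtend T F s = F s := if_pos hs

lemma zeroExtend_of_notMem {s : ℝ} (hs : s ∉ Ioo 0 T) : zeroExtend T F s = fun _ => 0 := if_neg hs

lemma IsSlab.contDiff_zeroExtend (hF : IsSlab T l A F) (s : ℝ) :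
    ContDiff ℝ 2 (zeroExtend T F s) := by
  by_cases hs : s ∈ Ioo 0 T
  · rw [zeroExtend_of_mem hs]; exact hF.contDiff s hs
  · rw [zeroExtend_of_notMem hs]; exact contDiff_const

lemma IsSlab.bound_zeroExtend (hF : IsSlab T l A F) {j : ℕ} (hj : j ≤ 2) (s : ℝ) (x : RSpace d) :
    ‖iteratedFDeriv ℝ j (zeroExtend T F s) x‖ ≤ A * Real.exp (l * s) := by
  have hA := hF.nonneg
  by_cases hs : s ∈ Ioo 0 T
  · rw [zeroExtend_of_mem hs]; exact hF.bound j hj s hs x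
  · rw [zeroExtend_of_notMem hs, iteratedFDeriv_fun_zero, Pi.zero_apply, norm_zero]
    positivity

lemma IsSlab.bound_zeroExtend' (hF : IsSlab T l A F) (hl : 0 ≤ l) {j : ℕ} (hj : j ≤ 2) (s : ℝ)
    (x : RSpace d) : ‖iteratedFDeriv ℝ j (zeroExtend T F s) x‖ ≤ A * Real.exp (l * T) := by
  have hA := hF.nonneg
  by_cases hs : s ∈ Ioo 0 T
  · refine (hF.bound_zeroExtend hj s x).trans ?_
    gcongr
    exact hs.2.le
  · rw [zeroExtend_of_notMem hs, iteratedFDeriv_fun_zero, Pi.zero_apply, norm_zero]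
    positivity

lemma IsSlab.lintegral_zeroExtend_le (hF : IsSlab T l A F) (s : ℝ) :
    ∫⁻ x, ‖zeroExtend T F s x‖ₑ ≤ ENNReal.ofReal (A * Real.exp (l * s)) := by
  by_cases hs : s ∈ Ioo 0 T
  · rw [zeroExtend_of_mem hs]; exact hF.lintegral_le s hs
  · simp [zeroExtend_of_notMem hs]

lemma IsSlab.continuousAt_zeroExtend (hF : IsSlab T l A F) {j : ℕ} (hj : j ≤ 2) {q : ℝ × RSpace d}
    (h0 : q.1 ≠ 0) (hT : q.1 ≠ T) :
    ContinuousAt (fun q : ℝ × RSpace d => iteratedFDeriv ℝ j (zeroExtend T F q.1) q.2) q := by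
  by_cases hs : q.1 ∈ Ioo 0 T
  · have hn : Ioo (0 : ℝ) T ×ˢ (univ : Set (RSpace d)) ∈ 𝓝 q :=
      (isOpen_Ioo.prod isOpen_univ).mem_nhds ⟨hs, mem_univ _⟩
    refine ((hF.cont j hj).continuousAt hn).congr ?_
    filter_upwards [hn] with p hp
    rw [zeroExtend_of_mem hp.1]
  · have hn : (Icc (0 : ℝ) T)ᶜ ×ˢ (univ : Set (RSpace d)) ∈ 𝓝 q := by
      refine (isClosed_Icc.isOpen_compl.prod isOpen_univ).mem_nhds ⟨fun h => hs ?_, mem_univ _⟩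
      exact ⟨lt_of_le_of_ne h.1 h0.symm, lt_of_le_of_ne h.2 hT⟩
    refine (continuousAt_const (y := 0)).congr ?_
    filter_upwards [hn] with p hp
    rw [zeroExtend_of_notMem fun h => hp.1 (Ioo_subset_Icc_self h), iteratedFDeriv_fun_zero]
    rfl

lemma IsSlab.aestronglyMeasurable_zeroExtend (hF : IsSlab T l A F) {j : ℕ} (hj : j ≤ 2)
    (p : Measure (ℝ × RSpace d)) : AEStronglyMeasurable
      (fun q : ℝ × RSpace d => iteratedFDeriv ℝ j (zeroExtend T F q.1) q.2) p := by
  have hm : MeasurableSet (Ioo (0 : ℝ) T ×ˢ (univ : Set (RSpace d))) :=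
    measurableSet_Ioo.prod MeasurableSet.univ
  have h := ((hF.cont j hj).aestronglyMeasurable (μ := p) hm)
  rw [← aestronglyMeasurable_indicator_iff hm] at h
  convert h using 1
  funext q
  by_cases hq : q.1 ∈ Ioo 0 T
  · rw [indicator_of_mem (show q ∈ Ioo (0 : ℝ) T ×ˢ univ from ⟨hq, mem_univ _⟩), zeroExtend_of_mem hq]
  · rw [indicator_of_notMem (show q ∉ Ioo (0 : ℝ) T ×ˢ univ from fun h => hq h.1), zeroExtend_of_notMem hq, iteratedFDeriv_fun_zero]
    rfl

lemma IsSlab.aestronglyMeasurable_shift (hF : IsSlab T l A F) {j : ℕ} (hj : j ≤ 2) (t : ℝ)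
    (x : RSpace d) : AEStronglyMeasurable
      (fun q : ℝ × RSpace d => iteratedFDeriv ℝ j (zeroExtend T F (t - q.1)) (x - q.2))
      (spaceTime d) :=
  (hF.aestronglyMeasurable_zeroExtend hj _).comp_quasiMeasurePreserving
    (quasiMeasurePreserving_sub_left (spaceTime d) (t, x))

lemma IsVolterraKernel.integrable (hκ : IsVolterraKernel T l θ κ) (hl : 0 ≤ l) :
    Integrable κ (spaceTime d) := by
  refine ⟨hκ.aestronglyMeasurable, ?_⟩
  refine lt_of_le_of_lt (b := ENNReal.ofReal (Real.exp (l * T)) * ENNReal.ofReal θ) ?_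
    (ENNReal.mul_lt_top ENNReal.ofReal_lt_top ENNReal.ofReal_lt_top)
  refine le_trans ?_ (mul_le_mul_right hκ.weight _)
  rw [← lintegral_const_mul' _ _ ENNReal.ofReal_ne_top]
  refine lintegral_mono fun q => ?_
  by_cases hq : q.1 ∈ Ioo 0 T
  · rw [mul_left_comm, ← ENNReal.ofReal_mul (Real.exp_nonneg _), ← Real.exp_add]
    refine le_mul_of_one_le_right zero_le ?_
    rw [ENNReal.one_le_ofReal]
    refine Real.one_le_exp ?_
    nlinarith [hq.2]
  · simp [hκ.zero q hq]

lemma IsVolterraKernel.integrable_weight (hκ : IsVolterraKernel T l θ κ) :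
    Integrable (fun q => ‖κ q‖ * Real.exp (-(l * q.1))) (spaceTime d) := by
  refine ⟨hκ.aestronglyMeasurable.norm.mul (Continuous.aestronglyMeasurable (by fun_prop)), ?_⟩
  refine lt_of_le_of_lt ?_ (hκ.weight.trans_lt ENNReal.ofReal_lt_top)
  refine le_of_eq (lintegral_congr fun q => ?_)
  rw [enorm_mul, enorm_norm, Real.enorm_of_nonneg (Real.exp_nonneg _)]

lemma IsVolterraKernel.integral_weight_le (hκ : IsVolterraKernel T l θ κ) (hθ : 0 ≤ θ) :
    ∫ q, ‖κ q‖ * Real.exp (-(l * q.1)) ∂(spaceTime d) ≤ θ := by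
  rw [integral_eq_lintegral_of_nonneg_ae (ae_of_all _ fun q => by positivity)
    hκ.integrable_weight.aestronglyMeasurable]
  refine ENNReal.toReal_le_of_le_ofReal hθ (le_trans (le_of_eq (lintegral_congr fun q => ?_))
    hκ.weight)
  rw [ENNReal.ofReal_mul (norm_nonneg _), ofReal_norm]

section Conv
variable (hκ : IsVolterraKernel T l θ κ) (hl : 0 ≤ l) (hF : IsSlab T l A F)
include hκ hl hF

lemma stConv_contDiff (t : ℝ) : ContDiff ℝ 2 (stConv T κ F t) := by
  refine contDiff_integral (n := 2) (C := A * Real.exp (l * T)) (k := κ)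
    (G := fun q x => zeroExtend T F (t - q.1) (x - q.2)) (hκ.integrable hl)
    (fun q => (hF.contDiff_zeroExtend _).comp (contDiff_id.sub contDiff_const))
    (fun j hj x => ?_) fun j hj q x => ?_
  · simpa only [iteratedFDeriv_comp_sub] using hF.aestronglyMeasurable_shift hj t x
  · rw [iteratedFDeriv_comp_sub]
    exact hF.bound_zeroExtend' hl hj _ _

lemma iteratedFDeriv_stConv {j : ℕ} (hj : j ≤ 2) (t : ℝ) (x : RSpace d) :
    iteratedFDeriv ℝ j (stConv T κ F t) x
      = ∫ q, κ q • iteratedFDeriv ℝ j (zeroExtend T F (t - q.1)) (x - q.2) ∂(spaceTime d) := by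
  have := iteratedFDeriv_integral_eq (n := 2) (C := A * Real.exp (l * T)) (k := κ)
    (G := fun q x => zeroExtend T F (t - q.1) (x - q.2)) (hκ.integrable hl)
    (fun q => (hF.contDiff_zeroExtend _).comp (contDiff_id.sub contDiff_const))
    (fun j hj x => ?_) (fun j hj q x => ?_) hj
  · refine (congrFun this x).trans ?_
    simp only [iteratedFDeriv_comp_sub]
  · simpa only [iteratedFDeriv_comp_sub] using hF.aestronglyMeasurable_shift hj t x
  · rw [iteratedFDeriv_comp_sub]
    exact hF.bound_zeroExtend' hl hj _ _

/-- All derivatives fall on F, whose growth splits as exp(l(t - τ)) = exp(l t) exp(-l τ). The second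
factor is the weight of the kernel, so the constant is multiplied by θ for every order alike. -/
lemma norm_iteratedFDeriv_stConv_le (hθ : 0 ≤ θ) {j : ℕ} (hj : j ≤ 2) (t : ℝ) (x : RSpace d) :
    ‖iteratedFDeriv ℝ j (stConv T κ F t) x‖ ≤ θ * A * Real.exp (l * t) := by
  rw [iteratedFDeriv_stConv hκ hl hF hj]
  have hA := hF.nonneg
  have h1 := hκ.integrable_weight.mul_const (A * Real.exp (l * t))
  refine (norm_integral_le_of_norm_le h1 (ae_of_all _ fun q => ?_)).trans ?_
  · rw [norm_smul, mul_assoc]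
    gcongr
    refine (hF.bound_zeroExtend hj _ _).trans (le_of_eq ?_)
    rw [mul_left_comm, ← Real.exp_add]
    congr 2
    ring
  · rw [integral_mul_const, mul_assoc]
    gcongr
    exact hκ.integral_weight_le hθ

lemma continuous_iteratedFDeriv_stConv {j : ℕ} (hj : j ≤ 2) :
    Continuous fun p : ℝ × RSpace d => iteratedFDeriv ℝ j (stConv T κ F p.1) p.2 := by
  simp only [iteratedFDeriv_stConv hκ hl hF hj]
  rw [continuous_iff_continuousAt]
  intro p
  refine continuousAt_of_dominated (bound := fun q => ‖κ q‖ * (A * Real.exp (l * T)))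
    (Eventually.of_forall fun p =>
      hκ.aestronglyMeasurable.smul (hF.aestronglyMeasurable_shift hj p.1 p.2))
    (Eventually.of_forall fun p => ae_of_all _ fun q => ?_)
    ((hκ.integrable hl).norm.mul_const _) ?_
  · rw [norm_smul]
    gcongr
    exact hF.bound_zeroExtend' hl hj _ _
  -- The extension by zero can jump only at times 0 and T, which a fixed p meets on a null set of q;
  -- continuity of the integrand almost everywhere is enough.
  · have hne : ∀ a : ℝ, ∀ᵐ q : ℝ × RSpace d ∂(spaceTime d), q.1 ≠ a := fun a =>
      Measure.quasiMeasurePreserving_fst.ae (p := fun s : ℝ => s ≠ a)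
        (Measure.ae_ne volume a)
    filter_upwards [hne p.1, hne (p.1 - T)] with q h1 h2
    have hc : ContinuousAt (fun p : ℝ × RSpace d => (p.1 - q.1, p.2 - q.2)) p :=
      Continuous.continuousAt (by fun_prop)
    suffices h : ContinuousAt (fun q : ℝ × RSpace d =>
        iteratedFDeriv ℝ j (zeroExtend T F q.1) q.2) (p.1 - q.1, p.2 - q.2) from
      (ContinuousAt.comp (f := fun p : ℝ × RSpace d => (p.1 - q.1, p.2 - q.2)) h hc).const_smul
        (κ q)
    refine hF.continuousAt_zeroExtend hj ?_ ?_
    · intro h; exact h1 (by simp only at h; linarith)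
    · intro h; exact h2 (by simp only at h; linarith)

omit hκ hl in
lemma measurable_zeroExtend : Measurable fun q : ℝ × RSpace d => zeroExtend T F q.1 q.2 := by
  classical
  have hm : MeasurableSet (Ioo (0 : ℝ) T ×ˢ (univ : Set (RSpace d))) :=
    measurableSet_Ioo.prod MeasurableSet.univ
  have h := spaceContOn_zero_iff.1 (hF.cont.mono (k := 0) (by norm_num))
  convert h.measurable_piecewise (continuousOn_const (c := (0 : ℝ))) hm using 1
  funext q
  by_cases hq : q.1 ∈ Ioo 0 T
  · rw [piecewise_eq_of_mem _ _ _ (show q ∈ Ioo (0 : ℝ) T ×ˢ univ from ⟨hq, mem_univ _⟩),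
      zeroExtend_of_mem hq]
  · rw [piecewise_eq_of_notMem _ _ _ (show q ∉ Ioo (0 : ℝ) T ×ˢ univ from fun h => hq h.1),
      zeroExtend_of_notMem hq]

omit hl in
lemma aestronglyMeasurable_stConv_integrand (t : ℝ) :
    AEStronglyMeasurable (fun z : (ℝ × RSpace d) × RSpace d =>
      κ z.1 * zeroExtend T F (t - z.1.1) (z.2 - z.1.2)) ((spaceTime d).prod volume) := by
  refine hκ.aestronglyMeasurable.comp_fst.mul (Measurable.aestronglyMeasurable ?_)
  exact (measurable_zeroExtend hF).comp (by fun_prop :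
    Measurable fun z : (ℝ × RSpace d) × RSpace d => (t - z.1.1, z.2 - z.1.2))

omit hl in
lemma lintegral_stConv_integrand_le (t : ℝ) :
    ∫⁻ q, (∫⁻ x, ‖κ q * zeroExtend T F (t - q.1) (x - q.2)‖ₑ) ∂(spaceTime d)
      ≤ ENNReal.ofReal (θ * A * Real.exp (l * t)) := by
  have hA := hF.nonneg
  calc ∫⁻ q, (∫⁻ x, ‖κ q * zeroExtend T F (t - q.1) (x - q.2)‖ₑ) ∂(spaceTime d)
      ≤ ∫⁻ q, (‖κ q‖ₑ * ENNReal.ofReal (Real.exp (-(l * q.1))))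
          * ENNReal.ofReal (A * Real.exp (l * t)) ∂(spaceTime d) := by
        refine lintegral_mono fun q => ?_
        simp only [enorm_mul]
        rw [lintegral_const_mul' _ _ enorm_ne_top, mul_assoc]
        refine mul_le_mul_right ?_ _
        rw [lintegral_sub_right_eq_self (fun x => ‖zeroExtend T F (t - q.1) x‖ₑ),
          ← ENNReal.ofReal_mul (Real.exp_nonneg _)]
        refine (hF.lintegral_zeroExtend_le _).trans (le_of_eq ?_)
        rw [mul_left_comm, ← Real.exp_add]
        congr 3
        ring
    _ ≤ ENNReal.ofReal θ * ENNReal.ofReal (A * Real.exp (l * t)) := by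
        rw [lintegral_mul_const' _ _ ENNReal.ofReal_ne_top]
        exact mul_le_mul_left hκ.weight _
    _ ≤ _ := by rw [← ENNReal.ofReal_mul' (by positivity), mul_assoc]

omit hl in
lemma integrable_stConv_integrand (t : ℝ) :
    Integrable (fun z : (ℝ × RSpace d) × RSpace d =>
      κ z.1 * zeroExtend T F (t - z.1.1) (z.2 - z.1.2)) ((spaceTime d).prod volume) := by
  have hm := aestronglyMeasurable_stConv_integrand hκ hF t
  refine ⟨hm, ?_⟩
  rw [HasFiniteIntegral, lintegral_prod _ hm.enorm]
  exact (lintegral_stConv_integrand_le hκ hF t).trans_lt ENNReal.ofReal_lt_top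

omit hl in
lemma lintegral_stConv_le (t : ℝ) :
    ∫⁻ x, ‖stConv T κ F t x‖ₑ ≤ ENNReal.ofReal (θ * A * Real.exp (l * t)) := by
  refine le_trans ?_ (lintegral_stConv_integrand_le hκ hF t)
  rw [lintegral_lintegral_swap (aestronglyMeasurable_stConv_integrand hκ hF t).enorm]
  exact lintegral_mono fun x => enorm_integral_le_lintegral_enorm _

omit hl in
lemma integral_stConv (t : ℝ) : ∫ x, stConv T κ F t x = 0 := by
  have hi := integrable_stConv_integrand hκ hF t
  have h1 : ∫ x, stConv T κ F t x
      = ∫ q, (∫ x, κ q * zeroExtend T F (t - q.1) (x - q.2)) ∂(spaceTime d) :=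
    (integral_integral_swap hi).symm
  have hi' := hi.integral_prod_left
  rw [h1]
  simp only [integral_const_mul] at hi' ⊢
  have h2 : ∀ q : ℝ × RSpace d, ∫ x, zeroExtend T F (t - q.1) (x - q.2)
      = ∫ x, zeroExtend T F (t - q.1) x := fun q =>
    integral_sub_right_eq_self (fun x => zeroExtend T F (t - q.1) x) q.2
  simp only [h2] at hi' ⊢
  -- After integration in x the convolved function depends on the time lag only, so the mean-zero
  -- condition on each slice of the kernel gives 0.
  rw [integral_prod _ hi']
  simp [integral_mul_const, hκ.mean]

lemma isSlab_stConv (hθ : 0 ≤ θ) : IsSlab T l (θ * A) (stConv T κ F) where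
  nonneg := mul_nonneg hθ hF.nonneg
  contDiff := fun s _ => stConv_contDiff hκ hl hF s
  cont := fun _ hj => (continuous_iteratedFDeriv_stConv hκ hl hF hj).continuousOn
  bound := fun _ hj s _ x => norm_iteratedFDeriv_stConv_le hκ hl hF hθ hj s x
  lintegral_le := fun s _ => lintegral_stConv_le hκ hF s

omit hl hF in
lemma stConv_of_nonpos {t : ℝ} (ht : t ≤ 0) (x : RSpace d) : stConv T κ F t x = 0 := by
  refine integral_eq_zero_of_ae (ae_of_all _ fun q => ?_)
  by_cases hq : q.1 ∈ Ioo 0 T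
  · simp [zeroExtend_of_notMem (F := F) (T := T) (s := t - q.1) fun h => by
      have := h.1; have := hq.1; linarith]
  · simp [hκ.zero q hq]

end Conv

lemma IsSlab.sum {ι : Type*} (s : Finset ι) {F : ι → ℝ → RSpace d → ℝ} (hA : 0 ≤ A)
    (hF : ∀ i ∈ s, IsSlab T l A (F i)) :
    IsSlab T l (s.card * A) (fun t x => ∑ i ∈ s, F i t x) := by
  have hd : ∀ t ∈ Ioo 0 T, ∀ j ≤ 2, ∀ x, iteratedFDeriv ℝ j (fun x => ∑ i ∈ s, F i t x) x
      = ∑ i ∈ s, iteratedFDeriv ℝ j (F i t) x := by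
    intro t ht j hj x
    exact iteratedFDeriv_fun_sum_apply fun i hi =>
      (((hF i hi).contDiff t ht).of_le (by exact_mod_cast hj)).contDiffAt
  refine ⟨by positivity, fun t ht => ContDiff.sum fun i hi => (hF i hi).contDiff t ht,
    fun j hj => ?_, fun j hj t ht x => ?_, fun t ht => ?_⟩
  · refine (continuousOn_finsetSum s fun i hi => (hF i hi).cont j hj).congr fun q hq => ?_
    exact hd q.1 hq.1 j hj q.2
  · rw [hd t ht j hj, mul_assoc, ← nsmul_eq_mul]
    exact (norm_sum_le_of_le s fun i hi => (hF i hi).bound j hj t ht x).trans_eq (by simp)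
  · calc ∫⁻ x, ‖∑ i ∈ s, F i t x‖ₑ ≤ ∫⁻ x, ∑ i ∈ s, ‖F i t x‖ₑ :=
          lintegral_mono fun x => enorm_sum_le _ _
      _ = ∑ i ∈ s, ∫⁻ x, ‖F i t x‖ₑ := lintegral_finsetSum' _ fun i hi =>
          ((hF i hi).contDiff t ht).continuous.aestronglyMeasurable.enorm
      _ ≤ ∑ _i ∈ s, ENNReal.ofReal (A * Real.exp (l * t)) :=
          Finset.sum_le_sum fun i hi => (hF i hi).lintegral_le t ht
      _ = _ := by
          rw [Finset.sum_const, nsmul_eq_mul, mul_assoc,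
            ENNReal.ofReal_mul (p := (s.card : ℝ)) (by positivity), ENNReal.ofReal_natCast]

lemma IsSlab.component_mul (hF : IsSlab T l A F) {b : ℝ → RSpace d → RSpace d}
    (hb : SpaceDerivsBoundedBy 2 T B b) (hB : 0 ≤ B) (i : Fin d) :
    IsSlab T l (4 * B * A) (fun t x => b t x i * F t x) := by
  have hA := hF.nonneg
  let e : RSpace d →L[ℝ] ℝ := EuclideanSpace.proj i
  have hbc : ∀ t ∈ Ioo 0 T, ContDiff ℝ 2 fun x => b t x i := fun t ht =>
    e.contDiff.comp (hb.contDiff t ht)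
  have he : ‖e‖ ≤ 1 := e.opNorm_le_bound zero_le_one fun v => by
    rw [one_mul]; exact PiLp.norm_apply_le v i
  have hbb : ∀ j ≤ 2, ∀ t ∈ Ioo 0 T, ∀ x, ‖iteratedFDeriv ℝ j (fun x => b t x i) x‖ ≤ B := by
    intro j hj t ht x
    refine (e.norm_iteratedFDeriv_comp_left (hb.contDiff t ht).contDiffAt
      (by exact_mod_cast hj)).trans ?_
    exact (mul_le_of_le_one_left (norm_nonneg _) he).trans (hb.bound j hj t ht x)
  have hbs : SpaceContOn 2 (Ioo 0 T) (fun t x => b t x i) := by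
    intro j hj
    refine ((ContinuousLinearMap.compContinuousMultilinearMapL ℝ (fun _ : Fin j => RSpace d)
      (RSpace d) ℝ e).continuous.comp_continuousOn (hb.continuousOn j hj)).congr fun q hq => ?_
    exact e.iteratedFDeriv_comp_left (hb.contDiff q.1 hq.1).contDiffAt (by exact_mod_cast hj)
  refine ⟨by positivity, fun t ht => (hbc t ht).mul (hF.contDiff t ht),
    SpaceContOn.bilinear 2 (ContinuousLinearMap.mul ℝ ℝ) hbs hF.cont hbc hF.contDiff,
    fun j hj t ht x => ?_, fun t ht => ?_⟩
  · refine (norm_iteratedFDeriv_mul_le (hbc t ht) (hF.contDiff t ht) x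
      (by exact_mod_cast hj)).trans ?_
    calc _ ≤ ∑ k ∈ Finset.range (j + 1), (j.choose k : ℝ) * B * (A * Real.exp (l * t)) := by
          refine Finset.sum_le_sum fun k hk => ?_
          have : k ≤ j := by simpa [Nat.lt_succ_iff] using hk
          gcongr
          · exact hbb k (by omega) t ht x
          · exact hF.bound _ (by omega) t ht x
      -- The Leibniz coefficients of order j sum to 2^j, which is at most 4 for j ≤ 2.
      _ ≤ 4 * (B * (A * Real.exp (l * t))) := by
          simp only [mul_assoc]
          rw [← Finset.sum_mul, ← Nat.cast_sum, Nat.sum_range_choose]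
          refine mul_le_mul_of_nonneg_right ?_ (by positivity)
          calc (((2 ^ j : ℕ)) : ℝ) ≤ ((2 ^ 2 : ℕ) : ℝ) := by
                exact_mod_cast Nat.pow_le_pow_right (by norm_num) hj
            _ = 4 := by norm_num
      _ = _ := by ring
  · calc ∫⁻ x, ‖b t x i * F t x‖ₑ ≤ ∫⁻ x, ENNReal.ofReal B * ‖F t x‖ₑ := by
          refine lintegral_mono fun x => ?_
          rw [enorm_mul]
          refine mul_le_mul_left ?_ _
          rw [← ofReal_norm]
          exact ENNReal.ofReal_le_ofReal ((PiLp.norm_apply_le _ i).trans (hb.norm_le ht x))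
      _ ≤ ENNReal.ofReal B * ENNReal.ofReal (A * Real.exp (l * t)) := by
          rw [lintegral_const_mul' _ _ ENNReal.ofReal_ne_top]
          exact mul_le_mul_right (hF.lintegral_le t ht) _
      _ ≤ _ := by
          rw [← ENNReal.ofReal_mul hB]
          refine ENNReal.ofReal_le_ofReal ?_
          have : 0 ≤ B * (A * Real.exp (l * t)) := by positivity
          linarith

end

/-! ### The mild solution of a Volterra equation with drift -/

section
variable {d : ℕ} {T l θ A B : ℝ} {κ : Fin d → ℝ × RSpace d → ℝ}
  {b : ℝ → RSpace d → RSpace d} {w₀ : ℝ → RSpace d → ℝ}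

lemma IsSlab.mono {A' : ℝ} {F : ℝ → RSpace d → ℝ} (hF : IsSlab T l A F) (h : A ≤ A') :
    IsSlab T l A' F where
  nonneg := hF.nonneg.trans h
  contDiff := hF.contDiff
  cont := hF.cont
  bound := fun j hj s hs x => (hF.bound j hj s hs x).trans (by gcongr)
  lintegral_le := fun s hs => (hF.lintegral_le s hs).trans (ENNReal.ofReal_le_ofReal (by gcongr))

lemma IsSlab.tsum {w : ℕ → ℝ → RSpace d → ℝ} (hl : 0 ≤ l) (hA : 0 ≤ A)
    (hw : ∀ k, IsSlab T l (A * (1 / 2) ^ k) (w k)) :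
    IsSlab T l (2 * A) (fun t x => ∑' k, w k t x) := by
  have hsum : ∀ c : ℝ, HasSum (fun k : ℕ => A * (1 / 2) ^ k * c) (2 * A * c) := fun c => by
    have := (hasSum_geometric_two.mul_left A).mul_right c
    rwa [mul_comm A 2] at this
  have hcd : ∀ s ∈ Ioo 0 T, ∀ k, ContDiff ℝ ((2 : ℕ∞) : WithTop ℕ∞) (w k s) := fun s hs k =>
    (hw k).contDiff s hs
  have hle : ∀ {j : ℕ}, ((j : ℕ∞) ≤ 2) → j ≤ 2 := fun h => by exact_mod_cast h
  have hder : ∀ j ≤ 2, ∀ s ∈ Ioo 0 T, ∀ x, iteratedFDeriv ℝ j (fun x => ∑' k, w k s x) x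
      = ∑' k, iteratedFDeriv ℝ j (w k s) x := by
    intro j hj s hs x
    exact congrFun (iteratedFDeriv_tsum (N := 2) (hcd s hs) (fun _ _ => (hsum (Real.exp (l * s))).summable)
      (fun j k x hj => (hw k).bound j (hle hj) s hs x) (by exact_mod_cast hj)) x
  refine ⟨by positivity, fun s hs => ?_, fun j hj => ?_, fun j hj s hs x => ?_, fun s hs => ?_⟩
  · exact contDiff_tsum (N := 2) (hcd s hs) (fun _ _ => (hsum (Real.exp (l * s))).summable)
      (fun j k x hj => (hw k).bound j (hle hj) s hs x)
  · refine (continuousOn_tsum (fun k => (hw k).cont j hj) (hsum (Real.exp (l * T))).summable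
      fun k q hq => ?_).congr fun q hq => hder j hj q.1 hq.1 q.2
    refine ((hw k).bound j hj q.1 hq.1 q.2).trans ?_
    gcongr
    exact hq.1.2.le
  · rw [hder j hj s hs]
    exact tsum_of_norm_bounded (hsum _) fun k => (hw k).bound j hj s hs x
  · calc ∫⁻ x, ‖∑' k, w k s x‖ₑ ≤ ∫⁻ x, ∑' k, ‖w k s x‖ₑ :=
          lintegral_mono fun x => enorm_tsum_le_tsum_enorm
      _ = ∑' k, ∫⁻ x, ‖w k s x‖ₑ := lintegral_tsum fun k =>
          ((hw k).contDiff s hs).continuous.aestronglyMeasurable.enorm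
      _ ≤ ∑' k, ENNReal.ofReal (A * (1 / 2) ^ k * Real.exp (l * s)) :=
          ENNReal.tsum_le_tsum fun k => (hw k).lintegral_le s hs
      _ = _ := by
          rw [← ENNReal.ofReal_tsum_of_nonneg (fun k => by positivity) (hsum _).summable,
            (hsum _).tsum_eq]

/-- The operator `w ↦ ∑ᵢ κᵢ ⋆ (bᵢ w)`. -/
def driftConv (T : ℝ) (κ : Fin d → ℝ × RSpace d → ℝ) (b : ℝ → RSpace d → RSpace d)
    (w : ℝ → RSpace d → ℝ) (t : ℝ) (x : RSpace d) : ℝ :=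
  ∑ i, stConv T (κ i) (fun t x => b t x i * w t x) t x

/-- The terms of the Neumann series of the Volterra equation. -/
def neumannTerm (T : ℝ) (κ : Fin d → ℝ × RSpace d → ℝ) (b : ℝ → RSpace d → RSpace d)
    (w₀ : ℝ → RSpace d → ℝ) : ℕ → ℝ → RSpace d → ℝ
  | 0 => w₀
  | k + 1 => driftConv T κ b (neumannTerm T κ b w₀ k)

section Drift
variable (hκ : ∀ i, IsVolterraKernel T l θ (κ i)) (hl : 0 ≤ l) (hθ : 0 ≤ θ)
  (hb : SpaceDerivsBoundedBy 2 T B b) (hB : 0 ≤ B) (hsmall : d * (θ * (4 * B)) ≤ 1 / 2)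
include hκ hl hb hB

lemma continuous_driftConv {w : ℝ → RSpace d → ℝ} (hw : IsSlab T l A w) :
    Continuous fun p : ℝ × RSpace d => driftConv T κ b w p.1 p.2 := by
  refine continuous_finsetSum _ fun i _ => ?_
  have h := continuous_iteratedFDeriv_stConv (hκ i) hl (hw.component_mul hb hB i) (Nat.zero_le 2)
  have h0 : SpaceContOn 0 univ (stConv T (κ i) (fun t x => b t x i * w t x)) := fun j hj => by
    obtain rfl : j = 0 := by omega
    exact h.continuousOn
  have h1 := spaceContOn_zero_iff.1 h0
  rwa [univ_prod_univ, continuousOn_univ] at h1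

include hθ hsmall

lemma abs_driftConv_le {w : ℝ → RSpace d → ℝ} (hw : IsSlab T l A w) (t : ℝ) (x : RSpace d) :
    |driftConv T κ b w t x| ≤ 1 / 2 * A * Real.exp (l * t) := by
  have hA := hw.nonneg
  refine (Finset.abs_sum_le_sum_abs _ _).trans ?_
  refine (Finset.sum_le_sum fun i _ => ?_ : _ ≤ ∑ _i : Fin d, θ * (4 * B * A) * Real.exp (l * t)).trans ?_
  · have := norm_iteratedFDeriv_stConv_le (hκ i) hl (hw.component_mul hb hB i) hθ (Nat.zero_le 2) t x
    rwa [norm_iteratedFDeriv_zero] at this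
  · rw [Finset.sum_const, Finset.card_univ, Fintype.card_fin, nsmul_eq_mul]
    calc _ = d * (θ * (4 * B)) * (A * Real.exp (l * t)) := by ring
      _ ≤ 1 / 2 * (A * Real.exp (l * t)) := by gcongr
      _ = _ := by ring

lemma isSlab_driftConv {w : ℝ → RSpace d → ℝ} (hw : IsSlab T l A w) :
    IsSlab T l (1 / 2 * A) (driftConv T κ b w) := by
  have hA := hw.nonneg
  refine (IsSlab.sum Finset.univ (A := θ * (4 * B * A)) (by positivity) fun i _ =>
    isSlab_stConv (hκ i) hl (hw.component_mul hb hB i) hθ).mono ?_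
  rw [Finset.card_univ, Fintype.card_fin]
  calc _ = d * (θ * (4 * B)) * A := by ring
    _ ≤ 1 / 2 * A := by gcongr

lemma integrable_driftConv {w : ℝ → RSpace d → ℝ} (hw : IsSlab T l A w) (t : ℝ) :
    Integrable (driftConv T κ b w t) ∧ ∫ x, driftConv T κ b w t x = 0 ∧
      ∫ x, ‖driftConv T κ b w t x‖ ≤ 1 / 2 * A * Real.exp (l * t) := by
  have hA := hw.nonneg
  have hle : ∀ i, ∫⁻ x, ‖stConv T (κ i) (fun t x => b t x i * w t x) t x‖ₑ
      ≤ ENNReal.ofReal (θ * (4 * B * A) * Real.exp (l * t)) := fun i =>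
    lintegral_stConv_le (hκ i) (hw.component_mul hb hB i) t
  have hm : ∀ i, AEStronglyMeasurable
      (fun x => stConv T (κ i) (fun t x => b t x i * w t x) t x) volume := fun i =>
    (stConv_contDiff (hκ i) hl (hw.component_mul hb hB i) t).continuous.aestronglyMeasurable
  have hi : ∀ i, Integrable (fun x => stConv T (κ i) (fun t x => b t x i * w t x) t x) := fun i =>
    ⟨hm i, (hle i).trans_lt ENNReal.ofReal_lt_top⟩
  have hI : Integrable (driftConv T κ b w t) := integrable_finsetSum _ fun i _ => hi i
  refine ⟨hI, ?_, ?_⟩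
  · simp only [driftConv]
    rw [integral_finsetSum _ fun i _ => hi i]
    exact Finset.sum_eq_zero fun i _ => integral_stConv (hκ i) (hw.component_mul hb hB i) t
  · calc ∫ x, ‖driftConv T κ b w t x‖
        ≤ ∫ x, ∑ i, ‖stConv T (κ i) (fun t x => b t x i * w t x) t x‖ :=
          integral_mono hI.norm (integrable_finsetSum _ fun i _ => (hi i).norm)
            fun x => norm_sum_le _ _
      _ = ∑ i, ∫ x, ‖stConv T (κ i) (fun t x => b t x i * w t x) t x‖ :=
          integral_finsetSum _ fun i _ => (hi i).norm
      _ ≤ ∑ _i : Fin d, θ * (4 * B * A) * Real.exp (l * t) := by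
          refine Finset.sum_le_sum fun i _ => ?_
          rw [integral_norm_eq_lintegral_enorm (hm i)]
          exact ENNReal.toReal_le_of_le_ofReal (by positivity) (hle i)
      _ = d * (θ * (4 * B)) * (A * Real.exp (l * t)) := by
          rw [Finset.sum_const, Finset.card_univ, Fintype.card_fin, nsmul_eq_mul]; ring
      _ ≤ 1 / 2 * (A * Real.exp (l * t)) := by gcongr
      _ = _ := by ring

lemma isSlab_neumannTerm (hw : IsSlab T l A w₀) (k : ℕ) :
    IsSlab T l (A * (1 / 2) ^ k) (neumannTerm T κ b w₀ k) := by
  induction k with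
  | zero => rw [pow_zero, mul_one]; exact hw
  | succ k ih =>
    have := isSlab_driftConv hκ hl hθ hb hB hsmall ih
    rwa [show 1 / 2 * (A * (1 / 2) ^ k) = A * (1 / 2) ^ (k + 1) by ring] at this

omit hθ hsmall in
lemma hasSum_stConv {w : ℕ → ℝ → RSpace d → ℝ}
    (hw : ∀ k, IsSlab T l (A * (1 / 2) ^ k) (w k)) (i : Fin d) (t : ℝ) (x : RSpace d) :
    HasSum (fun k => stConv T (κ i) (fun t x => b t x i * w k t x) t x)
      (stConv T (κ i) (fun t x => b t x i * ∑' k, w k t x) t x) := by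
  have hs : ∀ k, IsSlab T l (4 * B * (A * (1 / 2) ^ k)) (fun t x => b t x i * w k t x) := fun k =>
    (hw k).component_mul hb hB i
  have hbd : ∀ k, ∀ q : ℝ × RSpace d,
      ‖κ i q * zeroExtend T (fun t x => b t x i * w k t x) (t - q.1) (x - q.2)‖
        ≤ ‖κ i q‖ * (4 * B * (A * (1 / 2) ^ k) * Real.exp (l * T)) := by
    intro k q
    rw [norm_mul]
    gcongr
    have := (hs k).bound_zeroExtend' hl (Nat.zero_le 2) (t - q.1) (x - q.2)
    rwa [norm_iteratedFDeriv_zero] at this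
  have hκi := (hκ i).integrable hl
  have hint : ∀ k, Integrable (fun q : ℝ × RSpace d =>
      κ i q * zeroExtend T (fun t x => b t x i * w k t x) (t - q.1) (x - q.2)) (spaceTime d) := by
    intro k
    refine (hκi.norm.mul_const _).mono' ((hκ i).aestronglyMeasurable.mul ?_)
      (ae_of_all _ (hbd k))
    exact ((measurable_zeroExtend (hs k)).comp (by fun_prop :
      Measurable fun q : ℝ × RSpace d => (t - q.1, x - q.2))).aestronglyMeasurable
  have heq : stConv T (κ i) (fun t x => b t x i * ∑' k, w k t x) t x = ∫ q, (∑' k, κ i q *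
      zeroExtend T (fun t x => b t x i * w k t x) (t - q.1) (x - q.2)) ∂(spaceTime d) := by
    refine integral_congr_ae (ae_of_all _ fun q => ?_)
    by_cases hq : t - q.1 ∈ Ioo 0 T
    · simp only [zeroExtend_of_mem hq, tsum_mul_left]
    · simp only [zeroExtend_of_notMem hq, mul_zero, tsum_zero]
  rw [heq]
  refine hasSum_integral_of_summable_integral_norm hint ?_
  · refine Summable.of_nonneg_of_le (fun k => integral_nonneg fun q => norm_nonneg _)
      (fun k => integral_mono (hint k).norm (hκi.norm.mul_const _) (hbd k)) ?_
    simp only [integral_mul_const]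
    refine Summable.mul_left _ (Summable.mul_right _ (Summable.mul_left _ ?_))
    exact summable_geometric_two.mul_left A

/-- Existence of a mild solution with its mass. -/
theorem exists_mild_solution (hw : IsSlab T l A w₀)
    (hwc : ContinuousOn (fun q : ℝ × RSpace d => w₀ q.1 q.2) (Icc 0 T ×ˢ univ))
    (hwb : ∀ t ∈ Icc 0 T, ∀ x, |w₀ t x| ≤ A * Real.exp (l * t))
    (hwi : ∀ t ∈ Icc 0 T, Integrable (w₀ t)) :
    ∃ m : ℝ → RSpace d → ℝ, IsSlab T l (2 * A) m ∧
      ContinuousOn (fun q : ℝ × RSpace d => m q.1 q.2) (Icc 0 T ×ˢ univ) ∧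
      (∀ t ∈ Icc 0 T, ∀ x, m t x = w₀ t x + driftConv T κ b m t x) ∧
      ∀ t ∈ Icc 0 T, Integrable (m t) ∧ ∫ x, m t x = ∫ x, w₀ t x := by
  have hA := hw.nonneg
  -- The solution is the sum of this series. The constants halve at each step, which gives
  -- convergence up to two space derivatives and in L¹, and doubles the final constant.
  set w := neumannTerm T κ b w₀
  have hwk : ∀ k, IsSlab T l (A * (1 / 2) ^ k) (w k) :=
    isSlab_neumannTerm hκ hl hθ hb hB hsmall hw
  have hm := IsSlab.tsum hl hA hwk
  have hsum : ∀ c : ℝ, Summable (fun k : ℕ => A * (1 / 2) ^ k * c) := fun c =>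
    (summable_geometric_two.mul_left A).mul_right c
  have hbd : ∀ k, ∀ t ∈ Icc 0 T, ∀ x, |w k t x| ≤ A * (1 / 2) ^ k * Real.exp (l * t) := by
    intro k t ht x
    rcases k with _ | k
    · rw [pow_zero, mul_one]; exact hwb t ht x
    · refine (abs_driftConv_le hκ hl hθ hb hB hsmall (hwk k) t x).trans (le_of_eq ?_)
      ring
  have hcont : ∀ k, ContinuousOn (fun q : ℝ × RSpace d => w k q.1 q.2) (Icc 0 T ×ˢ univ) := by
    intro k
    rcases k with _ | k
    · exact hwc
    · exact (continuous_driftConv hκ hl hb hB (hwk k)).continuousOn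
  have hmc : ContinuousOn (fun q : ℝ × RSpace d => ∑' k, w k q.1 q.2) (Icc 0 T ×ˢ univ) := by
    refine continuousOn_tsum hcont (hsum (Real.exp (l * T))) fun k q hq => ?_
    refine (hbd k q.1 hq.1 q.2).trans ?_
    gcongr
    exact hq.1.2
  refine ⟨fun t x => ∑' k, w k t x, hm, hmc, fun t ht x => ?_, fun t ht => ?_⟩
  · have hs : Summable fun k => w k t x :=
      .of_norm_bounded (hsum (Real.exp (l * t))) fun k => hbd k t ht x
    have h := hasSum_sum (s := Finset.univ) fun i _ => hasSum_stConv hκ hl hb hB hwk i t x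
    change ∑' k, w k t x = _
    rw [hs.tsum_eq_zero_add]
    exact congrArg (w₀ t x + ·) h.tsum_eq
  · have hint : ∀ k, Integrable (w k t) := by
      intro k
      rcases k with _ | k
      · exact hwi t ht
      · exact (integrable_driftConv hκ hl hθ hb hB hsmall (hwk k) t).1
    have hs : Summable fun k => ∫ x, ‖w k t x‖ := by
      rw [← summable_nat_add_iff 1]
      refine Summable.of_nonneg_of_le (fun k => integral_nonneg fun q => norm_nonneg _)
        (fun k => (integrable_driftConv hκ hl hθ hb hB hsmall (hwk k) t).2.2) ?_
      simpa only [mul_assoc] using (hsum (Real.exp (l * t))).mul_left (1 / 2)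
    have h1 := hasSum_integral_of_summable_integral_norm hint hs
    refine ⟨?_, ?_⟩
    · have hc : Continuous fun x => ∑' k, w k t x := by
        rw [← continuousOn_univ]
        exact hmc.comp (f := fun x : RSpace d => (t, x)) (by fun_prop) fun x _ => ⟨ht, mem_univ x⟩
      refine ⟨hc.aestronglyMeasurable, lt_of_le_of_lt
        (lintegral_mono fun x => enorm_tsum_le_tsum_enorm) ?_⟩
      rw [lintegral_tsum fun k => (hint k).aestronglyMeasurable.enorm]
      simp only [← ofReal_integral_norm_eq_lintegral_enorm (hint _)]
      rw [← ENNReal.ofReal_tsum_of_nonneg (fun k => integral_nonneg fun x => norm_nonneg _) hs]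
      exact ENNReal.ofReal_lt_top
    · rw [← h1.tsum_eq, h1.summable.tsum_eq_zero_add]
      -- Every correction term is a convolution with mean-zero kernels, so the whole mass sits in
      -- the term of index 0.
      have h0 : ∀ k, ∫ x, w (k + 1) t x = 0 := fun k =>
        (integrable_driftConv hκ hl hθ hb hB hsmall (hwk k) t).2.1
      simp only [h0, tsum_zero, add_zero]
      rfl

end Drift
end

/-! ### The heat semigroup in the Volterra equation -/

section
variable {d : ℕ} {ν : Measure (RSpace d)} {T σ C Λ N M l : ℝ} {P : ℝ → Measure (RSpace d)}
  {K : ℝ → RSpace d → ℝ} {g : RSpace d → ℝ}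

/-- The kernel `-∂ᵢK` on `(0,T) × ℝ^d`, extended by zero. -/
def gradKernel (T : ℝ) (K : ℝ → RSpace d → ℝ) (i : Fin d) : ℝ × RSpace d → ℝ :=
  (Ioo (0 : ℝ) T ×ˢ (univ : Set (RSpace d))).indicator
    fun q => -fderiv ℝ (K q.1) q.2 (EuclideanSpace.single i 1)

lemma gradKernel_of_mem {i : Fin d} {q : ℝ × RSpace d} (hq : q.1 ∈ Ioo 0 T) :
    gradKernel T K i q = -fderiv ℝ (K q.1) q.2 (EuclideanSpace.single i 1) :=
  indicator_of_mem (show q ∈ Ioo (0 : ℝ) T ×ˢ univ from ⟨hq, mem_univ _⟩) _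

lemma gradKernel_of_notMem {i : Fin d} {q : ℝ × RSpace d} (hq : q.1 ∉ Ioo 0 T) :
    gradKernel T K i q = 0 :=
  indicator_of_notMem (show q ∉ Ioo (0 : ℝ) T ×ˢ univ from fun h => hq h.1) _

section Kernel
variable (hS : IsHeatSemigroup ν T σ C P K)
include hS

/-- Joint continuity in (t, x) is known for K but not for DK. Joint measurability of the derivative
comes from difference quotients of K. -/
lemma IsHeatSemigroup.aestronglyMeasurable_gradKernel (i : Fin d) :
    AEStronglyMeasurable (gradKernel T K i) (spaceTime d) := by
  have hm : MeasurableSet (Ioo (0 : ℝ) T ×ˢ (univ : Set (RSpace d))) :=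
    measurableSet_Ioo.prod MeasurableSet.univ
  rw [gradKernel, aestronglyMeasurable_indicator_iff hm]
  refine AEStronglyMeasurable.neg ?_
  refine aestronglyMeasurable_of_tendsto_ae atTop (f := fun n : ℕ => fun q : ℝ × RSpace d =>
    (n : ℝ) • (K q.1 (q.2 + (n : ℝ)⁻¹ • EuclideanSpace.single i 1) - K q.1 q.2))
    (fun n => ContinuousOn.aestronglyMeasurable ?_ hm) ?_
  · refine ContinuousOn.const_smul (M := ℝ) (ContinuousOn.sub ?_ hS.kernel_continuousOn) _
    exact hS.kernel_continuousOn.comp (f := fun q : ℝ × RSpace d =>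
      (q.1, q.2 + (n : ℝ)⁻¹ • EuclideanSpace.single i (1 : ℝ))) (by fun_prop)
      fun q hq => ⟨hq.1, mem_univ _⟩
  · refine (ae_restrict_iff' hm).2 (ae_of_all _ fun q hq => ?_)
    exact (((hS.kernel_contDiff q.1 hq.1).differentiable one_ne_zero q.2).hasFDerivAt).lim _
      (by simpa using tendsto_natCast_atTop_atTop)

lemma IsHeatSemigroup.integrable_kernel {t : ℝ} (ht : t ∈ Ioo 0 T) :
    Integrable (K t) ∧ ∫ x, K t x = 1 := by
  have := hS.prob t
  have hc := (hS.kernel_contDiff t ht).continuous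
  have h1 : ∫⁻ x, ENNReal.ofReal (K t x) = 1 := by
    have := measure_univ (μ := P t)
    rwa [hS.density t ht, withDensity_apply _ MeasurableSet.univ, Measure.restrict_univ] at this
  have hI : Integrable (K t) := by
    refine ⟨hc.aestronglyMeasurable, ?_⟩
    rw [hasFiniteIntegral_iff_ofReal (ae_of_all _ (hS.kernel_nonneg t ht)), h1]
    exact ENNReal.one_lt_top
  refine ⟨hI, ?_⟩
  rw [integral_eq_lintegral_of_nonneg_ae (ae_of_all _ (hS.kernel_nonneg t ht))
    hc.aestronglyMeasurable, h1, ENNReal.toReal_one]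

lemma IsHeatSemigroup.integral_eq {F : Type*} [NormedAddCommGroup F] [NormedSpace ℝ F] {t : ℝ}
    (ht : t ∈ Ioo 0 T) (f : RSpace d → F) : ∫ y, f y ∂(P t) = ∫ y, K t y • f y := by
  rw [hS.density t ht, integral_withDensity_eq_integral_toReal_smul
    (hS.kernel_contDiff t ht).continuous.measurable.ennreal_ofReal
    (ae_of_all _ fun _ => ENNReal.ofReal_lt_top)]
  simp only [ENNReal.toReal_ofReal (hS.kernel_nonneg t ht _)]

lemma IsHeatSemigroup.integrable_fderiv_kernel {t : ℝ} (ht : t ∈ Ioo 0 T) :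
    Integrable (fderiv ℝ (K t)) :=
  ⟨((hS.kernel_contDiff t ht).continuous_fderiv one_ne_zero).aestronglyMeasurable,
    (hS.kernel_grad t ht).trans_lt ENNReal.ofReal_lt_top⟩

/-- Integration by parts. It turns the kernel form of the mild equation into Duhamel's formula and,
with g = 1, gives the vanishing mean of the kernel. -/
lemma IsHeatSemigroup.integral_fderiv_kernel_mul {t : ℝ} (ht : t ∈ Ioo 0 T) (v : RSpace d)
    {g : RSpace d → ℝ} (hg : ContDiff ℝ 1 g) {A : ℝ} (hgA : ∀ x, |g x| ≤ A)
    (hgA' : ∀ x, ‖fderiv ℝ g x‖ ≤ A) (x : RSpace d) :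
    ∫ y, -fderiv ℝ (K t) y v * g (x - y) = -∫ y, fderiv ℝ g (x - y) v ∂(P t) := by
  have hgd : Differentiable ℝ g := hg.differentiable one_ne_zero
  have hd : ∀ y, HasFDerivAt (fun y => g (x - y)) (-fderiv ℝ g (x - y)) y := fun y => by
    have h2 := (hgd (x - y)).hasFDerivAt.comp y ((hasFDerivAt_id y).const_sub x)
    rw [ContinuousLinearMap.comp_neg, ContinuousLinearMap.comp_id] at h2
    exact h2
  have hKi := (hS.integrable_kernel ht).1
  have hgc : Continuous fun y => g (x - y) := hg.continuous.comp (by fun_prop)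
  have hg'c : Continuous fun y => fderiv ℝ g (x - y) :=
    (hg.continuous_fderiv one_ne_zero).comp (by fun_prop)
  have h := integral_mul_fderiv_eq_neg_fderiv_mul_of_integrable (μ := (volume : Measure (RSpace d)))
    (f := K t) (g := fun y => g (x - y)) (v := v) ?_ ?_ ?_
    (fun y _ => (hS.kernel_contDiff t ht).differentiable one_ne_zero y)
    (fun y _ => (hd y).differentiableAt)
  · rw [hS.integral_eq ht]
    simp only [(hd _).fderiv, neg_apply, mul_neg, integral_neg, neg_mul,
      smul_eq_mul] at h ⊢
    linarith
  · refine (((hS.integrable_fderiv_kernel ht).apply_continuousLinearMap v).mul_bdd (c := A)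
      hgc.aestronglyMeasurable (ae_of_all _ fun y => hgA _))
  · refine hKi.mul_bdd (c := A * ‖v‖) ?_ (ae_of_all _ fun y => ?_)
    · simp only [(hd _).fderiv]
      exact Continuous.aestronglyMeasurable (by fun_prop)
    · rw [(hd y).fderiv]
      refine (ContinuousLinearMap.le_opNorm _ _).trans ?_
      rw [norm_neg]
      gcongr
      exact hgA' _
  · exact hKi.mul_bdd (c := A) hgc.aestronglyMeasurable (ae_of_all _ fun y => hgA _)

/-- The weighted mass is at most C ∫_0^∞ t^(-1/σ) exp(-l t) dt, a Gamma integral that converges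
because σ > 1 and decays as l grows. -/
lemma IsHeatSemigroup.isVolterraKernel (hσ : 1 < σ) (hl : 0 < l) (i : Fin d) :
    IsVolterraKernel T l (max C 0 * ((1 / l) ^ (1 - 1 / σ) * Real.Gamma (1 - 1 / σ)))
      (gradKernel T K i) := by
  have hσ' : 0 < 1 - 1 / σ := by
    have : 1 / σ < 1 := by rw [div_lt_one (by linarith)]; exact hσ
    linarith
  refine ⟨hS.aestronglyMeasurable_gradKernel i, fun q hq => gradKernel_of_notMem hq, ?_,
    fun τ => ?_⟩
  · have hm := (hS.aestronglyMeasurable_gradKernel i).enorm.mul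
      (ENNReal.continuous_ofReal.comp (by fun_prop : Continuous fun q : ℝ × RSpace d =>
        Real.exp (-(l * q.1)))).aemeasurable
    have hg := Real.integral_rpow_mul_exp_neg_mul_Ioi hσ' hl
    have hgi : IntegrableOn (fun t : ℝ => t ^ ((1 - 1 / σ) - 1) * Real.exp (-(l * t))) (Ioi 0) :=
      .of_integral_ne_zero (by
        rw [hg]
        have := Real.Gamma_pos_of_pos hσ'
        positivity)
    calc _ = ∫⁻ τ, (∫⁻ y, ‖gradKernel T K i (τ, y)‖ₑ * ENNReal.ofReal (Real.exp (-(l * τ)))) :=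
          lintegral_prod _ hm
      _ ≤ ∫⁻ τ, (Ioi (0 : ℝ)).indicator (fun τ => ENNReal.ofReal
            (max C 0 * (τ ^ ((1 - 1 / σ) - 1) * Real.exp (-(l * τ))))) τ := by
          refine lintegral_mono fun τ => ?_
          by_cases hτ : τ ∈ Ioo 0 T
          · rw [indicator_of_mem (show τ ∈ Ioi (0 : ℝ) from hτ.1),
              lintegral_mul_const' _ _ ENNReal.ofReal_ne_top, ← mul_assoc,
              ENNReal.ofReal_mul' (Real.exp_nonneg _)]
            refine mul_le_mul_left ?_ _
            refine le_trans (lintegral_mono fun y => ?_) ((hS.kernel_grad τ hτ).trans ?_)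
            · rw [gradKernel_of_mem hτ, enorm_neg, ← ofReal_norm, ← ofReal_norm]
              refine ENNReal.ofReal_le_ofReal ((ContinuousLinearMap.le_opNorm _ _).trans ?_)
              simp
            · refine ENNReal.ofReal_le_ofReal ?_
              rw [show (1 - 1 / σ) - 1 = -(1 / σ) by ring]
              have := Real.rpow_nonneg hτ.1.le (-(1 / σ))
              gcongr
              exact le_max_left _ _
          · simp [gradKernel_of_notMem (K := K) (i := i) (q := (τ, _)) hτ]
      _ = ENNReal.ofReal (∫ t in Ioi 0, max C 0 *
            (t ^ ((1 - 1 / σ) - 1) * Real.exp (-(l * t)))) := by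
          rw [lintegral_indicator measurableSet_Ioi, ofReal_integral_eq_lintegral_ofReal
            (hgi.const_mul _)]
          refine (ae_restrict_iff' measurableSet_Ioi).2 (ae_of_all _ fun t ht => ?_)
          have := Real.rpow_nonneg (le_of_lt ht) ((1 - 1 / σ) - 1)
          have := le_max_right C 0
          simp only [Pi.zero_apply]
          positivity
      _ ≤ _ := by rw [integral_const_mul, hg]
  · by_cases hτ : τ ∈ Ioo 0 T
    · have := hS.integral_fderiv_kernel_mul hτ (EuclideanSpace.single i 1) (g := fun _ => 1)
        contDiff_const (A := 1) (by simp) (by simp) 0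
      simpa [gradKernel_of_mem (K := K) (i := i) (q := (τ, _)) hτ] using this
    · simp [gradKernel_of_notMem (K := K) (i := i) (q := (τ, _)) hτ]

end Kernel

/-- The heat flow `P_t g(x) = ∫ g(x - y) P_t(dy)`. -/
def heatFlow (P : ℝ → Measure (RSpace d)) (g : RSpace d → ℝ) (t : ℝ) (x : RSpace d) : ℝ :=
  ∫ y, g (x - y) ∂(P t)

section Flow
variable (hS : IsHeatSemigroup ν T σ C P K)
include hS

lemma IsHeatSemigroup.abs_heatFlow_le {A : ℝ} (hA : ∀ x, |g x| ≤ A) (t : ℝ)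
    (x : RSpace d) : |heatFlow P g t x| ≤ A := by
  have := hS.prob t
  refine (norm_integral_le_of_norm_le_const (f := fun y => g (x - y))
    (ae_of_all _ fun y => hA (x - y))).trans ?_
  simp

lemma IsHeatSemigroup.hasLipGrad_heatFlow (hg : HasLipGrad N g) (t : ℝ) :
    HasLipGrad N (heatFlow P g t) := by
  have := hS.prob t
  have h := hg.average (p := P t) (k := fun _ => 1) (integrable_const _) (by simp)
  simp only [one_mul] at h
  exact h

lemma IsHeatSemigroup.heatFlow_zero (g : RSpace d → ℝ) (x : RSpace d) :
    heatFlow P g 0 x = g x := by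
  simp [heatFlow, hS.zero]

/-- The generator identity writes the increment as the time integral of the flow of 𝓛g, and 𝓛g is
bounded. -/
lemma IsHeatSemigroup.abs_heatFlow_sub_le (hν : levyIntegral ν ≤ ENNReal.ofReal Λ)
    (hg : HasLipGrad N g) {s t : ℝ} (hs : 0 ≤ s) (ht : 0 ≤ t) (x : RSpace d) :
    |heatFlow P g t x - heatFlow P g s x| ≤ 2 * N * max Λ 0 * |t - s| := by
  obtain ⟨hi, hti⟩ := hS.generator N g hg t ht x
  obtain ⟨hi', hsi⟩ := hS.generator N g hg s hs x
  have h1 : heatFlow P g t x - heatFlow P g s x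
      = ∫ r in s..t, heatFlow P (levyOp ν g) r x := by
    have := intervalIntegral.integral_interval_sub_left hi hi'
    simp only [heatFlow] at this ⊢
    linarith
  rw [h1]
  exact intervalIntegral.norm_integral_le_of_norm_le_const
    (f := fun r => heatFlow P (levyOp ν g) r x) fun r _ =>
    hS.abs_heatFlow_le (fun y => hg.abs_levyOp_le hν y) r x

lemma IsHeatSemigroup.continuousOn_heatFlow (hν : levyIntegral ν ≤ ENNReal.ofReal Λ)
    (hg : HasLipGrad N g) :
    ContinuousOn (fun q : ℝ × RSpace d => heatFlow P g q.1 q.2) (Ici 0 ×ˢ univ) := by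
  intro p hp
  have h : ∀ q ∈ Ici (0 : ℝ) ×ˢ (univ : Set (RSpace d)), dist (heatFlow P g q.1 q.2)
      (heatFlow P g p.1 p.2) ≤ 2 * N * max Λ 0 * |q.1 - p.1| + N * ‖q.2 - p.2‖ := by
    intro q hq
    have h1 := hS.abs_heatFlow_sub_le hν hg hp.1 hq.1 q.2
    have h2 := (hS.hasLipGrad_heatFlow hg p.1).abs_sub_le q.2 p.2
    rw [Real.dist_eq]
    refine (abs_sub_le _ (heatFlow P g p.1 q.2) _).trans (add_le_add h1 h2)
  rw [ContinuousWithinAt, tendsto_iff_dist_tendsto_zero]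
  refine squeeze_zero' (Eventually.of_forall fun _ => dist_nonneg)
    (eventually_nhdsWithin_of_forall h) ?_
  have hc : Continuous fun q : ℝ × RSpace d =>
      2 * N * max Λ 0 * |q.1 - p.1| + N * ‖q.2 - p.2‖ := by fun_prop
  simpa using hc.continuousWithinAt (s := Ici 0 ×ˢ univ) (x := p) |>.tendsto

lemma IsHeatSemigroup.lintegral_heatFlow_le (hg : Integrable g) (hgc : Continuous g) (t : ℝ) :
    Integrable (heatFlow P g t) ∧ ∫ x, heatFlow P g t x = ∫ x, g x ∧
      ∫⁻ x, ‖heatFlow P g t x‖ₑ ≤ ∫⁻ x, ‖g x‖ₑ := by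
  have := hS.prob t
  have hm : AEStronglyMeasurable (fun z : RSpace d × RSpace d => g (z.1 - z.2))
      ((volume : Measure (RSpace d)).prod (P t)) :=
    Continuous.aestronglyMeasurable (by fun_prop)
  have hle : ∫⁻ x, (∫⁻ y, ‖g (x - y)‖ₑ ∂(P t)) = ∫⁻ x, ‖g x‖ₑ := by
    rw [lintegral_lintegral_swap hm.enorm]
    have : ∀ y, ∫⁻ x, ‖g (x - y)‖ₑ = ∫⁻ x, ‖g x‖ₑ := fun y =>
      lintegral_sub_right_eq_self (fun x => ‖g x‖ₑ) y
    simp [this]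
  have hI : Integrable (fun z : RSpace d × RSpace d => g (z.1 - z.2))
      ((volume : Measure (RSpace d)).prod (P t)) := by
    refine ⟨hm, ?_⟩
    rw [HasFiniteIntegral, lintegral_prod _ hm.enorm, hle]
    exact hg.2
  refine ⟨hI.integral_prod_left, ?_, ?_⟩
  · have h1 := integral_integral_swap (f := fun x y => g (x - y)) hI
    refine h1.trans ?_
    have : ∀ y, ∫ x, g (x - y) = ∫ x, g x := fun y => integral_sub_right_eq_self g y
    simp [this]
  · rw [← hle]
    exact lintegral_mono fun x => enorm_integral_le_lintegral_enorm _

lemma IsHeatSemigroup.iteratedFDeriv_heatFlow (hg : ContDiff ℝ 2 g)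
    (hgM : ∀ j ≤ 2, ∀ x, ‖iteratedFDeriv ℝ j g x‖ ≤ M) (t : ℝ) :
    ContDiff ℝ 2 (heatFlow P g t) ∧ ∀ j ≤ 2, ∀ x, iteratedFDeriv ℝ j (heatFlow P g t) x
      = ∫ y, iteratedFDeriv ℝ j g (x - y) ∂(P t) := by
  have := hS.prob t
  have hk : Integrable (fun _ : RSpace d => (1 : ℝ)) (P t) := integrable_const _
  have hG : ∀ y : RSpace d, ContDiff ℝ (2 : ℕ) fun x => g (x - y) := fun y =>
    hg.comp (contDiff_id.sub contDiff_const)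
  have hm : ∀ j ≤ 2, ∀ x, AEStronglyMeasurable
      (fun y => iteratedFDeriv ℝ j (fun x => g (x - y)) x) (P t) := by
    intro j hj x
    simp only [iteratedFDeriv_comp_sub]
    exact ((hg.continuous_iteratedFDeriv (by exact_mod_cast hj)).comp
      (by fun_prop : Continuous fun y => x - y)).aestronglyMeasurable
  have hb : ∀ j ≤ 2, ∀ y x, ‖iteratedFDeriv ℝ j (fun x => g (x - y)) x‖ ≤ M := by
    intro j hj y x
    rw [iteratedFDeriv_comp_sub]
    exact hgM j hj _
  refine ⟨?_, fun j hj x => ?_⟩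
  · have h := contDiff_integral hk hG hm hb
    simp only [one_mul] at h
    exact h
  · have h := congrFun (iteratedFDeriv_integral_eq hk hG hm hb hj) x
    simp only [one_mul, one_smul, iteratedFDeriv_comp_sub] at h
    exact h

lemma IsHeatSemigroup.tendsto_integral_abs_kernel_sub {t₀ : ℝ} (ht₀ : t₀ ∈ Ioo 0 T) :
    Tendsto (fun t => ∫ y, |K t y - K t₀ y|) (𝓝 t₀) (𝓝 0) := by
  have hn : Ioo 0 T ∈ 𝓝 t₀ := isOpen_Ioo.mem_nhds ht₀
  refine tendsto_integral_abs_sub_of_tendsto (c := 1) ?_ (hS.integrable_kernel ht₀).1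
    (hS.integrable_kernel ht₀).2 (fun y => ?_) (hS.kernel_nonneg t₀ ht₀)
  · filter_upwards [hn] with t ht
    exact ⟨(hS.integrable_kernel ht).1, hS.kernel_nonneg t ht, (hS.integrable_kernel ht).2⟩
  · have h : ContinuousAt (fun q : ℝ × RSpace d => K q.1 q.2) (t₀, y) :=
      hS.kernel_continuousOn.continuousAt ((isOpen_Ioo.prod isOpen_univ).mem_nhds ⟨ht₀, mem_univ _⟩)
    exact h.tendsto.comp (by
      simpa using (continuous_id.prodMk (continuous_const (y := y))).tendsto t₀)

/-- Change the kernel and the integrand separately: t ↦ K(t) is continuous into L¹ by Scheffé, which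
handles the kernel against bounded G, and with the kernel frozen dominated convergence applies. -/
lemma IsHeatSemigroup.continuousOn_integral {F : Type*} [NormedAddCommGroup F] [NormedSpace ℝ F]
    {I : Set ℝ} (hI : IsOpen I) (hIT : I ⊆ Ioo 0 T) {G : ℝ → RSpace d → F}
    (hG : ContinuousOn (fun q : ℝ × RSpace d => G q.1 q.2) (I ×ˢ univ))
    (hM : ∀ t ∈ I, ∀ x, ‖G t x‖ ≤ M) :
    ContinuousOn (fun q : ℝ × RSpace d => ∫ y, G q.1 (q.2 - y) ∂(P q.1)) (I ×ˢ univ) := by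
  intro p hp
  have hn : I ×ˢ (univ : Set (RSpace d)) ∈ 𝓝 p := (hI.prod isOpen_univ).mem_nhds hp
  refine ContinuousAt.continuousWithinAt ?_
  have hGm : ∀ q ∈ I ×ˢ (univ : Set (RSpace d)), Continuous fun y => G q.1 (q.2 - y) := by
    intro q hq
    rw [← continuousOn_univ]
    exact hG.comp (f := fun y : RSpace d => (q.1, q.2 - y)) (by fun_prop) fun y _ =>
      ⟨hq.1, mem_univ _⟩
  have hb : ∀ {k : RSpace d → ℝ}, ∀ q ∈ I ×ˢ (univ : Set (RSpace d)), ∀ y,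
      ‖k y • G q.1 (q.2 - y)‖ ≤ ‖k y‖ * M := by
    intro k q hq y
    rw [norm_smul]
    gcongr
    exact hM _ hq.1 _
  have hint : ∀ {k : RSpace d → ℝ}, Integrable k → ∀ q ∈ I ×ˢ (univ : Set (RSpace d)),
      Integrable fun y => k y • G q.1 (q.2 - y) := by
    intro k hk q hq
    exact (hk.norm.mul_const M).mono' (hk.aestronglyMeasurable.smul
      (hGm q hq).aestronglyMeasurable) (ae_of_all _ (hb q hq))
  have hk := (hS.integrable_kernel (hIT hp.1)).1
  have h2 : Tendsto (fun q : ℝ × RSpace d => ∫ y, K p.1 y • G q.1 (q.2 - y)) (𝓝 p)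
      (𝓝 (∫ y, K p.1 y • G p.1 (p.2 - y))) := by
    refine continuousAt_of_dominated (F := fun (q : ℝ × RSpace d) y => K p.1 y • G q.1 (q.2 - y))
      (bound := fun y => ‖K p.1 y‖ * M)
      ?_ ?_ (hk.norm.mul_const M) (ae_of_all _ fun y => ?_)
    · filter_upwards [hn] with q hq using (hint hk q hq).aestronglyMeasurable
    · filter_upwards [hn] with q hq using ae_of_all _ (hb q hq)
    · have h3 : ContinuousAt (fun q : ℝ × RSpace d => G q.1 q.2) (p.1, p.2 - y) :=
        hG.continuousAt ((hI.prod isOpen_univ).mem_nhds ⟨hp.1, mem_univ _⟩)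
      have h4 : ContinuousAt (fun q : ℝ × RSpace d => (q.1, q.2 - y)) p :=
        Continuous.continuousAt (by fun_prop)
      exact (ContinuousAt.comp (f := fun q : ℝ × RSpace d => (q.1, q.2 - y)) h3 h4).const_smul
        (K p.1 y)
  have h1 : Tendsto (fun q : ℝ × RSpace d => ∫ y, (K q.1 y - K p.1 y) • G q.1 (q.2 - y)) (𝓝 p)
      (𝓝 0) := by
    refine squeeze_zero_norm' (a := fun q : ℝ × RSpace d => (∫ y, |K q.1 y - K p.1 y|) * M) ?_ ?_
    · filter_upwards [hn] with q hq
      have hk' := (hS.integrable_kernel (hIT hq.1)).1.sub hk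
      rw [← integral_mul_const]
      exact norm_integral_le_of_norm_le (hk'.norm.mul_const M)
        (ae_of_all _ (hb (k := fun y => K q.1 y - K p.1 y) q hq))
    · have := ((hS.tendsto_integral_abs_kernel_sub (hIT hp.1)).comp
        (continuous_fst.tendsto p)).mul_const M
      simpa using this
  have h3 := h1.add h2
  rw [zero_add] at h3
  rw [ContinuousAt, hS.integral_eq (hIT hp.1)]
  refine h3.congr' ?_
  filter_upwards [hn] with q hq
  rw [hS.integral_eq (hIT hq.1), ← integral_add]
  · simp only [sub_smul, sub_add_cancel]
  · exact hint ((hS.integrable_kernel (hIT hq.1)).1.sub hk) q hq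
  · exact hint hk q hq

/-- The constant `max M 1` has to cover both the C² bound `M` and the L¹ norm, which is 1 for a
probability density. -/
lemma IsHeatSemigroup.isSlab_heatFlow (hg : IsInitialDensity M g) (hl : 0 ≤ l) :
    IsSlab T l (max M 1) (heatFlow P g) := by
  have hf := fun t => hS.iteratedFDeriv_heatFlow hg.contDiff hg.bound t
  have h1 : ∀ s ∈ Ioo 0 T, max M 1 ≤ max M 1 * Real.exp (l * s) := fun s hs =>
    le_mul_of_one_le_right (le_max_of_le_right zero_le_one)
      (Real.one_le_exp (mul_nonneg hl hs.1.le))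
  refine ⟨le_max_of_le_right zero_le_one, fun s _ => (hf s).1, fun j hj => ?_,
    fun j hj s hs x => ?_, fun s hs => ?_⟩
  · simp only [(hf _).2 j hj]
    refine hS.continuousOn_integral (M := M) (G := fun _ => iteratedFDeriv ℝ j g) isOpen_Ioo
      subset_rfl (Continuous.continuousOn ?_) fun _ _ => hg.bound j hj
    exact (hg.contDiff.continuous_iteratedFDeriv (by exact_mod_cast hj)).comp continuous_snd
  · refine le_trans ?_ (h1 s hs)
    rw [(hf s).2 j hj]
    have := hS.prob s
    refine (norm_integral_le_of_norm_le_const (ae_of_all _ fun y => hg.bound j hj (x - y))).trans ?_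
    simp
  · refine ((hS.lintegral_heatFlow_le hg.integrable hg.contDiff.continuous s).2.2).trans ?_
    have h2 : ∫⁻ x, ‖g x‖ₑ = 1 := by
      rw [← ofReal_integral_norm_eq_lintegral_enorm hg.integrable]
      simp only [Real.norm_of_nonneg (hg.nonneg _), hg.integral_eq_one, ENNReal.ofReal_one]
    rw [h2, ← ENNReal.ofReal_one]
    exact ENNReal.ofReal_le_ofReal ((le_max_right _ _).trans (h1 s hs))

end Flow
end

/-! ### Regularity in time of solutions of Duhamel's formula -/

lemma intervalIntegrable_of_continuousOn_Ioo {φ : ℝ → ℝ} {a b A : ℝ} (hab : a ≤ b)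
    (hc : ContinuousOn φ (Ioo a b)) (hA : ∀ t ∈ Ioo a b, |φ t| ≤ A) :
    IntervalIntegrable φ volume a b := by
  rw [intervalIntegrable_iff_integrableOn_Ioo_of_le hab]
  exact Integrable.of_bound (C := A) (hc.aestronglyMeasurable measurableSet_Ioo)
    ((ae_restrict_iff' measurableSet_Ioo).2 (ae_of_all _ hA))

/-- A continuous function with continuous right derivative c is the integral of c, hence
differentiable from both sides. -/
lemma hasDerivAt_of_hasDerivWithinAt_Ioi {φ c : ℝ → ℝ} {a b : ℝ}
    (hd : ∀ t ∈ Ioo a b, HasDerivWithinAt φ (c t) (Ioi t) t) (hφ : ContinuousOn φ (Ioo a b))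
    (hc : ContinuousOn c (Ioo a b)) {t : ℝ} (ht : t ∈ Ioo a b) : HasDerivAt φ (c t) t := by
  obtain ⟨u, hau, hut⟩ := exists_between ht.1
  obtain ⟨v, htv, hvb⟩ := exists_between ht.2
  have hsub : ∀ {s}, s ∈ Icc u v → s ∈ Ioo a b := fun h => ⟨hau.trans_le h.1, h.2.trans_lt hvb⟩
  have hi : ∀ s ∈ Icc u v, IntervalIntegrable c volume u s := fun s hs =>
    (hc.mono fun r hr => by
      rw [uIcc_of_le hs.1] at hr
      exact hsub ⟨hr.1, hr.2.trans hs.2⟩).intervalIntegrable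
  have h1 : ∀ s ∈ Icc u v, φ s = φ u + ∫ r in u..s, c r := by
    intro s hs
    rw [intervalIntegral.integral_eq_sub_of_hasDeriv_right_of_le hs.1
      (hφ.mono fun r hr => hsub ⟨hr.1, hr.2.trans hs.2⟩)
      (fun r hr => hd r (hsub ⟨hr.1.le, hr.2.le.trans hs.2⟩)) (hi s hs)]
    ring
  have htI : t ∈ Icc u v := ⟨hut.le, htv.le⟩
  have hn : Ioo a b ∈ 𝓝 t := isOpen_Ioo.mem_nhds ht
  have h2 : HasDerivAt (fun s => φ u + ∫ r in u..s, c r) (c t) t :=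
    (intervalIntegral.integral_hasDerivAt_right (hi t htI)
      (hc.stronglyMeasurableAtFilter isOpen_Ioo t ht) (hc.continuousAt hn)).const_add _
  refine h2.congr_of_eventuallyEq ?_
  filter_upwards [Icc_mem_nhds hut htv] with s hs using h1 s hs

section
variable {d : ℕ} {ν : Measure (RSpace d)} {T σ C Λ N A : ℝ} {P : ℝ → Measure (RSpace d)}
  {K : ℝ → RSpace d → ℝ} {g : RSpace d → ℝ} {f m : ℝ → RSpace d → ℝ}

lemma continuousOn_levyOp (hν : levyIntegral ν < ∞) (hm : SpaceContOn 1 (Ioo 0 T) m)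
    (hN : ∀ t ∈ Ioo 0 T, HasLipGrad N (m t)) :
    ContinuousOn (fun q : ℝ × RSpace d => levyOp ν (m q.1) q.2) (Ioo 0 T ×ˢ univ) := by
  obtain ⟨h0, h1⟩ := spaceContOn_succ_iff.1 hm
  rw [spaceContOn_zero_iff] at h1
  intro p hp
  have hn : Ioo (0 : ℝ) T ×ˢ (univ : Set (RSpace d)) ∈ 𝓝 p :=
    (isOpen_Ioo.prod isOpen_univ).mem_nhds hp
  refine ContinuousAt.continuousWithinAt ?_
  refine tendsto_levyOp (g := fun q : ℝ × RSpace d => m q.1) (x := fun q => q.2) (N := N) hν ?_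
    (h0.continuousAt hn) (fun z => ?_) (fun z => ?_)
  · filter_upwards [hn] with q hq using hN q.1 hq.1
  · have h3 : ContinuousAt (fun q : ℝ × RSpace d => m q.1 q.2) (p.1, p.2 + z) :=
      h0.continuousAt ((isOpen_Ioo.prod isOpen_univ).mem_nhds ⟨hp.1, mem_univ _⟩)
    exact (ContinuousAt.comp (f := fun q : ℝ × RSpace d => (q.1, q.2 + z)) h3
      (Continuous.continuousAt (by fun_prop))).tendsto
  · exact ((h1.continuousAt hn).clm_apply continuousAt_const).tendsto

section Semigroup
variable (hS : IsHeatSemigroup ν T σ C P K)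
include hS

lemma IsHeatSemigroup.integral_heatFlow_sub (hg : Continuous g) (hA : ∀ x, |g x| ≤ A) {h τ : ℝ}
    (hh : 0 ≤ h) (hτ : 0 ≤ τ) (x : RSpace d) :
    ∫ y, heatFlow P g τ (x - y) ∂(P h) = heatFlow P g (h + τ) x := by
  have := hS.prob h
  have := hS.prob τ
  have := hS.prob (h + τ)
  have hi : Integrable (fun y => g (x - y)) (P (h + τ)) :=
    Integrable.of_bound (C := A) (Continuous.aestronglyMeasurable (by fun_prop))
      (ae_of_all _ fun y => hA _)
  simp only [heatFlow]
  rw [← hS.conv h τ hh hτ] at hi ⊢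
  rw [integral_conv hi]
  simp only [sub_sub]

/-- For small r the law P_r concentrates at 0: the flow of a bump equal to 1 at 0 drops by at most L
r. The threshold `ρ` is uniform in φ, since the function to be averaged varies with r in Duhamel's
formula. -/
lemma IsHeatSemigroup.exists_forall_abs_heatFlow_sub_le (hν : levyIntegral ν < ∞) (x : RSpace d)
    (A : ℝ) {ε δ : ℝ} (hε : 0 < ε) (hδ : 0 < δ) :
    ∃ ρ > 0, ∀ r ∈ Ico 0 ρ, ∀ (φ : RSpace d → ℝ) (c : ℝ), Continuous φ → (∀ y, |φ y| ≤ A) →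
      |c| ≤ A → (∀ y, ‖y‖ < δ → |φ (x - y) - c| ≤ ε) → |heatFlow P φ r x - c| ≤ 2 * ε := by
  rcases lt_or_ge A 0 with hA | hA
  · exact ⟨1, one_pos, fun r _ φ c _ _ hc _ => absurd ((abs_nonneg c).trans hc) (not_le.2 hA)⟩
  let χ : ContDiffBump (0 : RSpace d) := ⟨δ / 2, δ, by positivity, by linarith⟩
  obtain ⟨N, hN⟩ := exists_hasLipGrad_of_hasCompactSupport (g := χ) χ.contDiff χ.hasCompactSupport
  have hN0 := hN.nonneg
  have hν' : levyIntegral ν ≤ ENNReal.ofReal (levyIntegral ν).toReal :=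
    (ENNReal.ofReal_toReal hν.ne).ge
  set L := 2 * N * max (levyIntegral ν).toReal 0
  have hL : 0 ≤ L := by positivity
  -- This makes the tail 2A L r at most ε; the added 1 avoids division by zero when A L = 0.
  refine ⟨ε / (2 * A * L + 1), by positivity, fun r hr φ c hφ hφA hc hyc => ?_⟩
  have := hS.prob r
  have h1 := hS.abs_heatFlow_sub_le hν' hN le_rfl hr.1 0
  rw [hS.heatFlow_zero, χ.one_of_mem_closedBall (Metric.mem_closedBall_self χ.rIn_pos.le), sub_zero, abs_of_nonneg hr.1] at h1
  have hbd : ∀ y, |φ (x - y) - c| ≤ ε + 2 * A * (1 - χ (0 - y)) := by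
    intro y
    rcases lt_or_ge ‖y‖ δ with h | h
    · have := hyc y h
      have := χ.le_one (x := 0 - y)
      nlinarith [mul_nonneg hA (sub_nonneg.2 this)]
    · rw [χ.zero_of_le_dist (by simpa using h)]
      have := abs_sub (φ (x - y)) c
      linarith [hφA (x - y)]
  have hχi : Integrable (fun y => χ (0 - y)) (P r) :=
    Integrable.of_bound (C := 1) (χ.continuous.comp (by fun_prop)).aestronglyMeasurable
      (ae_of_all _ fun y => by rw [Real.norm_of_nonneg χ.nonneg]; exact χ.le_one)
  have hφi : Integrable (fun y => φ (x - y)) (P r) :=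
    Integrable.of_bound (C := A) (Continuous.aestronglyMeasurable (by fun_prop))
      (ae_of_all _ fun y => hφA _)
  have h2 : heatFlow P φ r x - c = ∫ y, (φ (x - y) - c) ∂(P r) := by
    rw [integral_sub hφi (integrable_const _)]
    simp [heatFlow]
  have hχi' : Integrable (fun y => 2 * A * (1 - χ (0 - y))) (P r) :=
    ((integrable_const _).sub hχi).const_mul _
  have h3 : ∫ y, (ε + 2 * A * (1 - χ (0 - y))) ∂(P r) = ε + 2 * A * (1 - heatFlow P χ r 0) := by
    rw [integral_add (integrable_const _) hχi', integral_const_mul,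
      integral_sub (integrable_const _) hχi]
    simp [heatFlow]
  have hi3 : Integrable (fun y => ε + 2 * A * (1 - χ (0 - y))) (P r) :=
    (integrable_const _).add hχi'
  rw [h2]
  refine (norm_integral_le_of_norm_le (f := fun y => φ (x - y) - c) hi3 (ae_of_all _ hbd)).trans ?_
  rw [h3]
  have h4 := (abs_le.1 h1).1
  have h5 : (2 * A * L + 1) * r ≤ ε := by
    have := hr.2.le
    rw [le_div_iff₀ (by positivity)] at this
    linarith
  have h6 : 2 * A * (1 - heatFlow P χ r 0) ≤ 2 * A * (L * r) :=
    mul_le_mul_of_nonneg_left (by linarith) (by positivity)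
  have h7 := hr.1
  nlinarith

section Duhamel
variable (hfc : ContinuousOn (fun q : ℝ × RSpace d => f q.1 q.2) (Ioo 0 T ×ˢ univ))
  (hfA : ∀ s ∈ Ioo 0 T, ∀ x, |f s x| ≤ A)
include hfc hfA

omit hS hfA in
lemma continuous_of_mem_Ioo {s : ℝ} (hs : s ∈ Ioo 0 T) : Continuous (f s) := by
  rw [← continuousOn_univ]
  exact hfc.comp (f := fun x : RSpace d => (s, x)) (by fun_prop) fun x _ => ⟨hs, mem_univ x⟩

lemma IsHeatSemigroup.continuousOn_duhamel {t : ℝ} (ht : t ≤ T) :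
    ContinuousOn (fun q : ℝ × RSpace d => heatFlow P (f (t - q.1)) q.1 q.2) (Ioo 0 t ×ˢ univ) := by
  have hmem : ∀ {τ}, τ ∈ Ioo 0 t → t - τ ∈ Ioo 0 T := fun h =>
    ⟨by linarith [h.2], by linarith [h.1]⟩
  refine hS.continuousOn_integral (M := A) (G := fun τ => f (t - τ)) isOpen_Ioo
    (Ioo_subset_Ioo_right ht) ?_ fun τ hτ => hfA _ (hmem hτ)
  exact hfc.comp (f := fun q : ℝ × RSpace d => (t - q.1, q.2)) (by fun_prop)
    fun q hq => ⟨hmem hq.1, mem_univ _⟩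

lemma IsHeatSemigroup.intervalIntegrable_duhamel {h t : ℝ} (hh : 0 ≤ h) (hht : h ≤ t) (ht : t ≤ T)
    (x : RSpace d) :
    IntervalIntegrable (fun τ => heatFlow P (f (t - τ)) τ x) volume 0 h := by
  refine intervalIntegrable_of_continuousOn_Ioo (A := A) hh ?_ fun τ hτ => ?_
  · exact (hS.continuousOn_duhamel hfc hfA ht).comp (f := fun τ : ℝ => (τ, x)) (by fun_prop)
      fun τ hτ => ⟨⟨hτ.1, hτ.2.trans_le hht⟩, mem_univ _⟩
  · exact hS.abs_heatFlow_le (hfA _ ⟨by linarith [hτ.2], by linarith [hτ.1]⟩) _ _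

variable (hg : Continuous g) {M : ℝ} (hgM : ∀ x, |g x| ≤ M)
  (hm : ∀ t ∈ Ioo 0 T, ∀ x, m t x
    = heatFlow P g t x + ∫ τ in 0..t, heatFlow P (f (t - τ)) τ x)
include hg hgM hm

/-- Apply P_h to the formula at time t. The semigroup law and Fubini shift the lag by h, and the
missing lags in (0, h) form the remaining integral. -/
lemma IsHeatSemigroup.duhamel_restart {t h : ℝ} (ht : t ∈ Ioo 0 T) (hh : 0 ≤ h) (hth : t + h < T)
    (hmi : Continuous (heatFlow P g t)) (x : RSpace d) :
    m (t + h) x = heatFlow P (m t) h x + ∫ r in 0..h, heatFlow P (f (t + h - r)) r x := by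
  have := hS.prob h
  have hth0 : t + h ∈ Ioo 0 T := ⟨by linarith [ht.1], hth⟩
  have hI : Integrable (fun q : RSpace d × ℝ => heatFlow P (f (t - q.2)) q.2 (x - q.1))
      ((P h).prod (volume.restrict (Ioo 0 t))) := by
    refine Integrable.of_bound (C := A) ?_ ?_
    · have hms : MeasurableSet ((univ : Set (RSpace d)) ×ˢ Ioo (0 : ℝ) t) :=
        MeasurableSet.univ.prod measurableSet_Ioo
      have h1 : ContinuousOn (fun q : RSpace d × ℝ => heatFlow P (f (t - q.2)) q.2 (x - q.1))
          (univ ×ˢ Ioo 0 t) :=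
        (hS.continuousOn_duhamel hfc hfA ht.2.le).comp
          (f := fun q : RSpace d × ℝ => (q.2, x - q.1)) (by fun_prop) fun q hq => ⟨hq.2, mem_univ _⟩
      have h2 := h1.aestronglyMeasurable (μ := (P h).prod volume) hms
      rwa [← Measure.prod_restrict, Measure.restrict_univ] at h2
    · have : ∀ᵐ q : RSpace d × ℝ ∂((P h).prod (volume.restrict (Ioo 0 t))), q.2 ∈ Ioo 0 t :=
        Measure.quasiMeasurePreserving_snd.ae (p := fun s : ℝ => s ∈ Ioo 0 t)
          (ae_restrict_mem measurableSet_Ioo)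
      filter_upwards [this] with q hq
      exact hS.abs_heatFlow_le (hfA _ ⟨by linarith [hq.2], by linarith [hq.1, ht.2]⟩) _ _
  have hII := fun {a b : ℝ} (hab : a ≤ b) (φ : ℝ → ℝ) =>
    (intervalIntegral.integral_of_le (μ := volume) (f := φ) hab).trans
      integral_Ioc_eq_integral_Ioo
  have h1 : heatFlow P (m t) h x = heatFlow P g (h + t) x
      + ∫ τ in 0..t, heatFlow P (f (t - τ)) (h + τ) x := by
    have e1 : heatFlow P (m t) h x = ∫ y, (heatFlow P g t (x - y)
        + ∫ τ in Ioo 0 t, heatFlow P (f (t - τ)) τ (x - y)) ∂(P h) := by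
      refine integral_congr_ae (ae_of_all _ fun y => ?_)
      simp only [hm t ht (x - y), hII ht.1.le]
    rw [e1, integral_add _ hI.integral_prod_left,
      hS.integral_heatFlow_sub hg hgM hh ht.1.le, hII ht.1.le]
    · congr 1
      rw [integral_integral_swap hI]
      refine setIntegral_congr_fun measurableSet_Ioo fun τ hτ => ?_
      have hs : t - τ ∈ Ioo 0 T := ⟨by linarith [hτ.2], by linarith [hτ.1, ht.2]⟩
      exact hS.integral_heatFlow_sub (continuous_of_mem_Ioo hfc hs) (hfA _ hs) hh hτ.1.le x
    · exact Integrable.of_bound (C := M) (Continuous.aestronglyMeasurable (by fun_prop))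
        (ae_of_all _ fun y => hS.abs_heatFlow_le hgM _ _)
  have h2 : ∫ τ in 0..t, heatFlow P (f (t - τ)) (h + τ) x
      = ∫ r in h..(t + h), heatFlow P (f (t + h - r)) r x := by
    have := intervalIntegral.integral_comp_add_left (a := 0) (b := t)
      (fun r => heatFlow P (f (t + h - r)) r x) h
    rw [add_zero, add_comm h t] at this
    rw [← this]
    refine intervalIntegral.integral_congr fun τ _ => ?_
    simp only [show t + h - (h + τ) = t - τ by ring]
  have hi1 := hS.intervalIntegrable_duhamel hfc hfA hh (by linarith [ht.1]) hth.le x (t := t + h)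
  have hi2 := hS.intervalIntegrable_duhamel hfc hfA hth0.1.le le_rfl hth.le x
  have h3 := intervalIntegral.integral_add_adjacent_intervals hi1 (hi1.symm.trans hi2)
  rw [hm _ hth0, h1, h2, ← h3, add_comm h t]
  ring

/-- The restarted formula and the generator identity give the increment over h > 0 as an integral
over [0, h] of P_r 𝓛m(t) + P_r f(t + h - r), and each term tends to its value at (t, x). Only
forward increments are accessible this way. -/
lemma IsHeatSemigroup.hasDerivWithinAt_duhamel (hν : levyIntegral ν < ∞) {t : ℝ}
    (ht : t ∈ Ioo 0 T) (hmi : Continuous (heatFlow P g t)) (hN : HasLipGrad N (m t))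
    (x : RSpace d) :
    HasDerivWithinAt (fun τ => m τ x) (levyOp ν (m t) x + f t x) (Ioi t) t := by
  have hν' : levyIntegral ν ≤ ENNReal.ofReal (levyIntegral ν).toReal :=
    (ENNReal.ofReal_toReal hν.ne).ge
  rw [hasDerivWithinAt_iff_isLittleO, Asymptotics.isLittleO_iff]
  intro ε hε
  have hε' : 0 < ε / 4 := by positivity
  have hcL : ContinuousAt (levyOp ν (m t)) x := (hN.continuous_levyOp hν).continuousAt
  have hcf : ContinuousAt (fun q : ℝ × RSpace d => f q.1 q.2) (t, x) :=
    hfc.continuousAt ((isOpen_Ioo.prod isOpen_univ).mem_nhds ⟨ht, mem_univ _⟩)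
  obtain ⟨δ₁, hδ₁, hL⟩ := Metric.continuousAt_iff.1 hcL (ε / 4) hε'
  obtain ⟨δ₂, hδ₂, hf⟩ := Metric.continuousAt_iff.1 hcf (ε / 4) hε'
  set A₁ := 2 * N * max (levyIntegral ν).toReal 0
  obtain ⟨ρ₁, hρ₁, h1⟩ := hS.exists_forall_abs_heatFlow_sub_le hν x A₁ hε' hδ₁
  obtain ⟨ρ₂, hρ₂, h2⟩ := hS.exists_forall_abs_heatFlow_sub_le hν x A hε' hδ₂
  have hρ : 0 < min (min ρ₁ ρ₂) (min δ₂ (T - t)) :=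
    lt_min (lt_min hρ₁ hρ₂) (lt_min hδ₂ (by linarith [ht.2]))
  filter_upwards [Ioo_mem_nhdsGT (show t < t + min (min ρ₁ ρ₂) (min δ₂ (T - t)) by linarith)]
    with s hs
  obtain ⟨h, rfl⟩ : ∃ h, s = t + h := ⟨s - t, by ring⟩
  have hh : 0 < h := by linarith [hs.1]
  have hh' : h < min (min ρ₁ ρ₂) (min δ₂ (T - t)) := by linarith [hs.2]
  simp only [lt_min_iff] at hh'
  obtain ⟨⟨hh1, hh2⟩, hh3, hh4⟩ := hh'
  have e1 := hS.duhamel_restart hfc hfA hg hgM hm ht hh.le (by linarith) hmi x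
  obtain ⟨hi1, e2⟩ := hS.generator N (m t) hN h hh.le x
  change IntervalIntegrable (fun r => heatFlow P (levyOp ν (m t)) r x) volume 0 h at hi1
  change heatFlow P (m t) h x - m t x = ∫ r in 0..h, heatFlow P (levyOp ν (m t)) r x at e2
  have hi2 := hS.intervalIntegrable_duhamel hfc hfA (t := t + h) hh.le (by linarith [ht.1])
    (by linarith) x
  have e3 : m (t + h) x - m t x - (t + h - t) • (levyOp ν (m t) x + f t x)
      = ∫ r in 0..h, ((heatFlow P (levyOp ν (m t)) r x - levyOp ν (m t) x)
          + (heatFlow P (f (t + h - r)) r x - f t x)) := by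
    rw [intervalIntegral.integral_add (hi1.sub intervalIntegrable_const)
      (hi2.sub intervalIntegrable_const), intervalIntegral.integral_sub hi1
      intervalIntegrable_const, intervalIntegral.integral_sub hi2 intervalIntegrable_const,
      intervalIntegral.integral_const, intervalIntegral.integral_const, e1, ← e2]
    simp only [smul_eq_mul]
    ring
  rw [e3]
  refine (intervalIntegral.norm_integral_le_of_norm_le_const (C := ε) fun r hr => ?_).trans_eq (by
    rw [sub_zero, add_sub_cancel_left, Real.norm_eq_abs])
  rw [uIoc_of_le hh.le] at hr
  have hs' : t + h - r ∈ Ioo 0 T := ⟨by linarith [hr.2, ht.1], by linarith [hr.1]⟩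
  have b1 := h1 r ⟨hr.1.le, hr.2.trans_lt hh1⟩ (levyOp ν (m t)) (levyOp ν (m t) x)
    (hN.continuous_levyOp hν) (fun y => hN.abs_levyOp_le hν' y) (hN.abs_levyOp_le hν' x)
    fun y hy => (hL (by simpa [dist_eq_norm] using hy)).le
  have b2 := h2 r ⟨hr.1.le, hr.2.trans_lt hh2⟩ (f (t + h - r)) (f t x)
    (continuous_of_mem_Ioo hfc hs') (hfA _ hs') (hfA _ ht x) fun y hy => by
      refine (hf (x := (t + h - r, x - y)) ?_).le
      rw [Prod.dist_eq, max_lt_iff, Real.dist_eq, abs_lt]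
      refine ⟨⟨by linarith [hr.2], by linarith [hr.1]⟩, by simpa [dist_eq_norm] using hy⟩
  refine (norm_add_le _ _).trans ?_
  rw [Real.norm_eq_abs, Real.norm_eq_abs]
  linarith

end Duhamel
end Semigroup
end

/-! ### Existence of classical solutions -/

section
variable {d : ℕ} {ν μ : Measure (RSpace d)} {T σ C Λ c₀ A B M N l θ : ℝ} {𝒦 : ℕ → ℝ → ℝ}
  {P : ℝ → Measure (RSpace d)} {K : ℝ → RSpace d → ℝ} {F m m₁ m₂ : ℝ → RSpace d → ℝ}
  {b : ℝ → RSpace d → RSpace d} {m₀ n₁ n₂ : RSpace d → ℝ}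

lemma divergence_eq_sum {V : RSpace d → RSpace d} {x : RSpace d} (hV : DifferentiableAt ℝ V x) :
    divergence V x = ∑ i, fderiv ℝ (fun y => V y i) x (EuclideanSpace.single i 1) := by
  refine Finset.sum_congr rfl fun i _ => ?_
  let e : RSpace d →L[ℝ] ℝ := EuclideanSpace.proj i
  have h := e.hasFDerivAt.comp x hV.hasFDerivAt
  exact (congrArg (fun L => L (EuclideanSpace.single i (1 : ℝ))) h.fderiv).symm

lemma IsSlab.norm_fderiv_le (hF : IsSlab T l A F) (hl : 0 ≤ l) {s : ℝ} (hs : s ∈ Ioo 0 T)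
    (x : RSpace d) : ‖fderiv ℝ (F s) x‖ ≤ A * Real.exp (l * T) := by
  have h := hF.bound_zeroExtend' hl one_le_two s x
  rwa [zeroExtend_of_mem hs, ← zero_add 1, ← norm_iteratedFDeriv_fderiv,
    norm_iteratedFDeriv_zero] at h

lemma IsSlab.continuousOn_fderiv (hF : IsSlab T l A F) :
    ContinuousOn (fun q : ℝ × RSpace d => fderiv ℝ (F q.1) q.2) (Ioo 0 T ×ˢ univ) :=
  spaceContOn_zero_iff.1 (spaceContOn_succ_iff.1 (hF.cont.mono one_le_two)).2

section Semigroup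
variable (hS : IsHeatSemigroup ν T σ C P K)
include hS

lemma IsHeatSemigroup.stConv_gradKernel (hσ : 1 < σ) (hl : 0 < l) (hF : IsSlab T l A F) (i : Fin d)
    {t : ℝ} (ht : t ∈ Ioo 0 T) (x : RSpace d) :
    IntegrableOn (fun τ => -∫ y, fderiv ℝ (F (t - τ)) (x - y) (EuclideanSpace.single i 1) ∂(P τ))
      (Ioo 0 t) ∧ stConv T (gradKernel T K i) F t x
      = ∫ τ in Ioo 0 t,
        -∫ y, fderiv ℝ (F (t - τ)) (x - y) (EuclideanSpace.single i 1) ∂(P τ) := by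
  have hκ := hS.isVolterraKernel hσ hl i
  have hI : Integrable (fun q : ℝ × RSpace d =>
      gradKernel T K i q * zeroExtend T F (t - q.1) (x - q.2)) (spaceTime d) := by
    refine (hκ.integrable hl.le).mul_bdd (c := A * Real.exp (l * T)) ?_ (ae_of_all _ fun q => ?_)
    · exact ((measurable_zeroExtend hF).comp (by fun_prop :
        Measurable fun q : ℝ × RSpace d => (t - q.1, x - q.2))).aestronglyMeasurable
    · have := hF.bound_zeroExtend' hl.le (Nat.zero_le 2) (t - q.1) (x - q.2)
      rwa [norm_iteratedFDeriv_zero] at this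
  have heq : (fun τ => ∫ y, gradKernel T K i (τ, y) * zeroExtend T F (t - τ) (x - y))
      = (Ioo 0 t).indicator fun τ =>
        -∫ y, fderiv ℝ (F (t - τ)) (x - y) (EuclideanSpace.single i 1) ∂(P τ) := by
    funext τ
    by_cases hτ : τ ∈ Ioo 0 t
    · have hτT : τ ∈ Ioo 0 T := ⟨hτ.1, hτ.2.trans ht.2⟩
      have hs : t - τ ∈ Ioo 0 T := ⟨by linarith [hτ.2], by linarith [hτ.1, ht.2]⟩
      rw [indicator_of_mem hτ]
      simp only [gradKernel_of_mem (K := K) (i := i) (q := (τ, _)) hτT, zeroExtend_of_mem hs]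
      refine hS.integral_fderiv_kernel_mul hτT _ ((hF.contDiff _ hs).of_le (by norm_num))
        (A := A * Real.exp (l * T)) (fun y => ?_) (hF.norm_fderiv_le hl.le hs) x
      have := hF.bound_zeroExtend' hl.le (Nat.zero_le 2) (t - τ) y
      rwa [norm_iteratedFDeriv_zero, zeroExtend_of_mem hs] at this
    · rw [indicator_of_notMem hτ]
      by_cases hτT : τ ∈ Ioo 0 T
      · have hs : t - τ ∉ Ioo 0 T := fun h => hτ ⟨hτT.1, by linarith [h.1]⟩
        simp [zeroExtend_of_notMem hs]
      · simp [gradKernel_of_notMem (K := K) (i := i) (q := (τ, _)) hτT]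
  have h1 := hI.integral_prod_left
  rw [heq, integrable_indicator_iff measurableSet_Ioo] at h1
  refine ⟨h1, ?_⟩
  rw [stConv, integral_prod _ hI, heq, integral_indicator measurableSet_Ioo]

/-- The source term `-div(b m)`. -/
def driftSource (b : ℝ → RSpace d → RSpace d) (m : ℝ → RSpace d → ℝ) (s : ℝ) (x : RSpace d) : ℝ :=
  ∑ i, -fderiv ℝ (fun y => b s y i * m s y) x (EuclideanSpace.single i 1)

omit hS in
lemma continuousOn_driftSource (hm : IsSlab T l A m) (hb : SpaceDerivsBoundedBy 2 T B b)
    (hB : 0 ≤ B) :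
    ContinuousOn (fun q : ℝ × RSpace d => driftSource b m q.1 q.2) (Ioo 0 T ×ˢ univ) :=
  continuousOn_finsetSum _ fun i _ =>
    ((hm.component_mul hb hB i).continuousOn_fderiv.clm_apply continuousOn_const).neg

omit hS in
lemma abs_driftSource_le (hl : 0 ≤ l) (hm : IsSlab T l A m) (hb : SpaceDerivsBoundedBy 2 T B b)
    (hB : 0 ≤ B) {s : ℝ} (hs : s ∈ Ioo 0 T) (x : RSpace d) :
    |driftSource b m s x| ≤ d * (4 * B * A * Real.exp (l * T)) := by
  refine (Finset.abs_sum_le_sum_abs _ _).trans ((Finset.sum_le_sum fun i _ => ?_ :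
    _ ≤ ∑ _i : Fin d, 4 * B * A * Real.exp (l * T)).trans_eq (by simp))
  rw [abs_neg, ← Real.norm_eq_abs]
  refine (ContinuousLinearMap.le_opNorm _ _).trans ?_
  simpa using (hm.component_mul hb hB i).norm_fderiv_le hl hs x

omit hS in
lemma driftSource_eq_neg_divergence {s : ℝ} {x : RSpace d} (hm : DifferentiableAt ℝ (m s) x)
    (hb : DifferentiableAt ℝ (b s) x) :
    driftSource b m s x = -divergence (fun y => m s y • b s y) x := by
  have hV : DifferentiableAt ℝ (fun y => m s y • b s y) x := hm.smul hb
  rw [divergence_eq_sum hV, driftSource, Finset.sum_neg_distrib]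
  simp only [PiLp.smul_apply, smul_eq_mul, mul_comm]

lemma IsHeatSemigroup.driftConv_gradKernel (hσ : 1 < σ) (hl : 0 < l) (hm : IsSlab T l A m)
    (hb : SpaceDerivsBoundedBy 2 T B b) (hB : 0 ≤ B) {t : ℝ} (ht : t ∈ Ioo 0 T) (x : RSpace d) :
    driftConv T (gradKernel T K) b m t x
      = ∫ τ in 0..t, heatFlow P (driftSource b m (t - τ)) τ x := by
  have h := fun i => hS.stConv_gradKernel hσ hl (hm.component_mul hb hB i) i ht x
  rw [driftConv, intervalIntegral.integral_of_le ht.1.le, integral_Ioc_eq_integral_Ioo]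
  simp only [(h _).2]
  rw [← integral_finsetSum _ fun i _ => (h i).1]
  refine setIntegral_congr_fun measurableSet_Ioo fun τ hτ => ?_
  have hs : t - τ ∈ Ioo 0 T := ⟨by linarith [hτ.2], by linarith [hτ.1, ht.2]⟩
  have := hS.prob τ
  simp only [heatFlow, driftSource]
  rw [integral_finsetSum]
  · simp only [integral_neg]
  · intro i _
    have hF := hm.component_mul hb hB i
    refine Integrable.neg (Integrable.of_bound (C := 4 * B * A * Real.exp (l * T)) ?_
      (ae_of_all _ fun y => ?_))
    · refine Continuous.aestronglyMeasurable ?_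
      have hc := (hF.contDiff _ hs).continuous_fderiv (by norm_num)
      exact (hc.comp (by fun_prop : Continuous fun y => x - y)).clm_apply continuous_const
    · refine (ContinuousLinearMap.le_opNorm _ _).trans ?_
      simpa using hF.norm_fderiv_le hl.le hs (x - y)

end Semigroup

lemma IsSlab.spaceDerivsBoundedBy (hm : IsSlab T l A m) (hl : 0 ≤ l) :
    SpaceDerivsBoundedBy 2 T (A * Real.exp (l * T)) m where
  contDiff := hm.contDiff
  continuousOn := hm.cont
  bound := fun j hj t ht x => by
    have := hm.bound_zeroExtend' hl hj t x
    rwa [zeroExtend_of_mem ht] at this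

/-- Here σ > 1 makes the exponent 1 - 1/σ positive, so a large rate replaces a short time interval
and no iteration over subintervals is needed. -/
lemma exists_volterra_rate (hσ : 1 < σ) (c k : ℝ) :
    ∃ l > 0, k * (c * ((1 / l) ^ (1 - 1 / σ) * Real.Gamma (1 - 1 / σ))) ≤ 1 / 2 := by
  have hσ' : 0 < 1 - 1 / σ := by
    have : 1 / σ < 1 := by rw [div_lt_one (by linarith)]; exact hσ
    linarith
  have h1 : Tendsto (fun l : ℝ => (1 / l) ^ (1 - 1 / σ)) atTop (𝓝 0) := by
    have h2 : Tendsto (fun l : ℝ => 1 / l) atTop (𝓝 0) := by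
      simpa using tendsto_inv_atTop_zero (𝕜 := ℝ)
    have h4 := h2.rpow_const (p := 1 - 1 / σ) (Or.inr hσ'.le)
    rwa [Real.zero_rpow hσ'.ne'] at h4
  have h3 := ((h1.mul_const (Real.Gamma (1 - 1 / σ))).const_mul c).const_mul k
  simp only [zero_mul, mul_zero] at h3
  obtain ⟨l, hl, hl0⟩ := ((h3.eventually_lt_const (by norm_num : (0 : ℝ) < 1 / 2)).and
    (eventually_gt_atTop 0)).exists
  exact ⟨l, hl0, hl.le⟩

lemma IsHeatSemigroup.hasDerivAt_of_mild (hS : IsHeatSemigroup ν T σ C P K) (hσ : 1 < σ)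
    (hν : levyIntegral ν < ∞) (hl : 0 < l) (hm : IsSlab T l A m)
    (hmc : ContinuousOn (fun q : ℝ × RSpace d => m q.1 q.2) (Ioo 0 T ×ˢ univ))
    (hb : SpaceDerivsBoundedBy 2 T B b) (hB : 0 ≤ B) (hg : HasLipGrad M m₀)
    (hmeq : ∀ t ∈ Ioo 0 T, ∀ x,
      m t x = heatFlow P m₀ t x + driftConv T (gradKernel T K) b m t x)
    {t : ℝ} (ht : t ∈ Ioo 0 T) (x : RSpace d) :
    HasDerivAt (fun τ => m τ x) (levyOp ν (m t) x + driftSource b m t x) t := by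
  have hmb := hm.spaceDerivsBoundedBy hl.le
  have hfc := continuousOn_driftSource hm hb hB
  obtain ⟨Q, hfA⟩ : ∃ Q, ∀ s ∈ Ioo 0 T, ∀ x, |driftSource b m s x| ≤ Q :=
    ⟨_, fun s hs x => abs_driftSource_le hl.le hm hb hB hs x⟩
  have hduh : ∀ t ∈ Ioo 0 T, ∀ x, m t x = heatFlow P m₀ t x
      + ∫ τ in 0..t, heatFlow P (driftSource b m (t - τ)) τ x := fun t ht x => by
    rw [hmeq t ht x, hS.driftConv_gradKernel hσ hl hm hb hB ht x]
  have hLc := continuousOn_levyOp hν (hm.cont.mono one_le_two) fun t ht => hmb.hasLipGrad ht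
  have hx : ContinuousOn (fun τ : ℝ => (τ, x)) (Ioo 0 T) := by fun_prop
  have hmaps : MapsTo (fun τ : ℝ => (τ, x)) (Ioo 0 T) (Ioo 0 T ×ˢ univ) := fun τ hτ =>
    ⟨hτ, mem_univ _⟩
  have hmx : ContinuousOn (fun τ => m τ x) (Ioo 0 T) := hmc.comp hx hmaps
  have hLx : ContinuousOn (fun t => levyOp ν (m t) x) (Ioo 0 T) := hLc.comp hx hmaps
  have hfx := hfc.comp hx hmaps
  simp only [Function.comp_def] at hfx
  have hcx := hLx.add hfx
  have hright : ∀ s ∈ Ioo 0 T, HasDerivWithinAt (fun τ => m τ x)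
      (levyOp ν (m s) x + driftSource b m s x) (Ioi s) s := fun s hs =>
    hS.hasDerivWithinAt_duhamel hfc hfA hg.diff.continuous hg.bound hduh hν hs
      (hS.hasLipGrad_heatFlow hg s).diff.continuous (hmb.hasLipGrad hs) x
  exact hasDerivAt_of_hasDerivWithinAt_Ioi hright hmx hcx ht

theorem exists_isClassicalSolution (d : ℕ) (hT : 0 < T) (hσ : 1 < σ) (𝒦 : ℕ → ℝ → ℝ) (B M : ℝ) :
    ∃ c : ℝ, ∀ (Λ c₀ : ℝ) (μ : Measure (RSpace d)) (b : ℝ → RSpace d → RSpace d)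
      (m₀ : RSpace d → ℝ), LevyAssumptions T σ Λ c₀ 𝒦 μ → SpaceDerivsBoundedBy 2 T B b →
      IsInitialDensity M m₀ → ∃ m : ℝ → RSpace d → ℝ, IsClassicalSolution T μ b m₀ m ∧
        SpaceDerivsBoundedBy 2 T c m ∧ (∀ t ∈ Icc 0 T, ∀ x, |m t x| ≤ c) ∧
        ∀ t ∈ Icc 0 T, Integrable (m t) ∧ ∫ x, m t x = 1 := by
  obtain ⟨l, hl, hsmall⟩ := exists_volterra_rate hσ (max (𝒦 1 1) 0) (d * (4 * B))
  -- The rate `l`, and with it the final bound, is fixed by d, σ, `𝒦 1 1` and `B`, before μ, b and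
  -- m₀ are introduced.
  set θ := max (𝒦 1 1) 0 * ((1 / l) ^ (1 - 1 / σ) * Real.Gamma (1 - 1 / σ)) with hθdef
  set A := max M 1
  refine ⟨2 * A * Real.exp (l * T), fun Λ c₀ μ b m₀ hμ hb hm₀ => ?_⟩
  have hν := hμ.levy_antipodal_lt
  obtain ⟨P, hS⟩ := exists_isHeatSemigroup hν hT hμ.kernel_adjoint
  have hB : 0 ≤ B := hb.const_nonneg hT
  have hσ' : 0 < 1 - 1 / σ := by
    have : 1 / σ < 1 := by rw [div_lt_one (by linarith)]; exact hσ
    linarith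
  have hθ : 0 ≤ θ := by
    have := Real.Gamma_pos_of_pos hσ'
    positivity
  have hκ := fun i => hS.isVolterraKernel hσ hl i
  have hsm : d * (θ * (4 * B)) ≤ 1 / 2 := by linarith
  have hg : HasLipGrad M m₀ := .of_iteratedFDeriv hm₀.contDiff hm₀.bound
  have hgA : ∀ x, |m₀ x| ≤ A := fun x => (hg.bound x).trans (le_max_left _ _)
  have hA : 0 ≤ A := le_max_of_le_right zero_le_one
  have hw := hS.isSlab_heatFlow hm₀ hl.le
  obtain ⟨m, hm, hmc, hmeq, hmi⟩ := exists_mild_solution hκ hl.le hθ hb hB hsm hw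
    ((hS.continuousOn_heatFlow hμ.levy_antipodal hg).mono (prod_mono_left Icc_subset_Ici_self))
    (fun t ht x => (hS.abs_heatFlow_le hgA t x).trans
      (le_mul_of_one_le_right hA (Real.one_le_exp (mul_nonneg hl.le ht.1))))
    (fun t _ => (hS.lintegral_heatFlow_le hm₀.integrable hm₀.contDiff.continuous t).1)
  have hmb := hm.spaceDerivsBoundedBy hl.le
  have hfc := continuousOn_driftSource hm hb hB
  have hLc := continuousOn_levyOp hν (hm.cont.mono one_le_two) fun t ht => hmb.hasLipGrad ht
  have hder := fun t (ht : t ∈ Ioo 0 T) x => hS.hasDerivAt_of_mild hσ hν hl hm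
    (hmc.mono (prod_mono_left Ioo_subset_Icc_self)) hb hB hg
    (fun t ht x => hmeq t (Ioo_subset_Icc_self ht) x) ht x
  refine ⟨m, ⟨hmc, hm.contDiff, hm.cont, fun t ht x =>
    (hmb.hasLipGrad ht).integrable_levyIntegrand hν x, hLc,
    fun t ht x => (hder t ht x).differentiableAt, ?_, fun t ht x => ?_, fun x => ?_⟩, hmb,
    fun t ht x => ?_, fun t ht => ⟨(hmi t ht).1, ?_⟩⟩
  · exact (hLc.add hfc).congr fun q hq => (hder q.1 hq.1 q.2).deriv
  · rw [(hder t ht x).deriv, driftSource_eq_neg_divergence (hmb.differentiable ht x)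
      (hb.differentiable ht x)]
    ring
  · rw [hmeq 0 (left_mem_Icc.2 hT.le) x, hS.heatFlow_zero, driftConv]
    simp [stConv_of_nonpos (hκ _) le_rfl]
  · rw [hmeq t ht x]
    have h1 := abs_driftConv_le hκ hl.le hθ hb hB hsm hm t x
    have h2 := (hS.abs_heatFlow_le hgA t x).trans
      (le_mul_of_one_le_right hA (Real.one_le_exp (mul_nonneg hl.le ht.1)))
    have h3 : A * Real.exp (l * t) ≤ A * Real.exp (l * T) := by
      gcongr
      exact ht.2
    refine (abs_add_le _ _).trans ?_
    linarith
  · rw [(hmi t ht).2, (hS.lintegral_heatFlow_le hm₀.integrable hm₀.contDiff.continuous t).2.1,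
      hm₀.integral_eq_one]

/-! ### Comparison of classical solutions -/

lemma isClassicalSolution_zero : IsClassicalSolution T μ b (fun _ => 0) (fun _ _ => 0) where
  continuousOn := continuousOn_const
  contDiff := fun _ _ => contDiff_const
  continuousOn_space := fun j _ => by simpa using continuousOn_const
  integrable := fun t _ x => by
    have : levyIntegrand (fun _ : RSpace d => (0 : ℝ)) x = fun _ => 0 := by
      funext z; simp [levyIntegrand]
    rw [this]
    exact integrable_zero _ _ _
  continuousOn_levy := by simpa [levyOp, levyIntegrand] using continuousOn_const
  differentiable_time := fun _ _ _ => differentiableAt_const _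
  continuousOn_time := by simpa using continuousOn_const
  equation := fun t _ x => by simp [levyOp, levyIntegrand, divergence]
  initial := fun _ => rfl

/-- By linearity the difference solves the same equation, and expanding div(b w) leaves a gradient
term and a zero-order term with bounded coefficients, as the maximum principle requires. -/
theorem IsClassicalSolution.le_of_initial_le (hν : levyIntegral (antipodal μ) < ∞) (hT : 0 < T)
    (hb : SpaceDerivsBoundedBy 2 T B b) (h₁ : IsClassicalSolution T μ b n₁ m₁)
    (h₂ : IsClassicalSolution T μ b n₂ m₂) {C₁ C₂ : ℝ} (hC₁ : ∀ t ∈ Icc 0 T, ∀ x, |m₁ t x| ≤ C₁)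
    (hC₂ : ∀ t ∈ Icc 0 T, ∀ x, |m₂ t x| ≤ C₂) (h0 : ∀ x, n₁ x ≤ n₂ x) :
    ∀ t ∈ Icc 0 T, ∀ x, m₁ t x ≤ m₂ t x := by
  have hB : 0 ≤ B := hb.const_nonneg hT
  have hd₁ : ∀ t ∈ Ioo 0 T, Differentiable ℝ (m₁ t) := fun t ht =>
    (h₁.contDiff t ht).differentiable (by norm_num)
  have hd₂ : ∀ t ∈ Ioo 0 T, Differentiable ℝ (m₂ t) := fun t ht =>
    (h₂.contDiff t ht).differentiable (by norm_num)
  have hfd : ∀ t ∈ Ioo 0 T, ∀ x, fderiv ℝ (fun x => m₁ t x - m₂ t x) x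
      = fderiv ℝ (m₁ t) x - fderiv ℝ (m₂ t) x := fun t ht x =>
    fderiv_fun_sub (hd₁ t ht x) (hd₂ t ht x)
  have hlevy : ∀ t ∈ Ioo 0 T, ∀ x, levyIntegrand (fun x => m₁ t x - m₂ t x) x
      = fun z => levyIntegrand (m₁ t) x z - levyIntegrand (m₂ t) x z := by
    intro t ht x
    funext z
    rcases lt_or_ge ‖z‖ 1 with h | h
    · simp only [levyIntegrand_of_lt _ _ h, hfd t ht, sub_apply]
      ring
    · simp only [levyIntegrand_of_le _ _ h]
      ring
  -- The coefficient d B bounds div b and B bounds b; their sum serves for both terms.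
  have hmax := maximum_principle hν hT (B := d * B + B) (C := C₁ + C₂) (by positivity)
    (w := fun t x => m₁ t x - m₂ t x) (h₁.continuousOn.sub h₂.continuousOn)
    (fun t ht => (hd₁ t ht).sub (hd₂ t ht))
    (fun t ht x => (h₁.differentiable_time t ht x).sub (h₂.differentiable_time t ht x))
    (fun t ht x => by
      rw [hlevy t ht x]
      exact (h₁.integrable t ht x).sub (h₂.integrable t ht x))
    (fun t ht x => (abs_sub _ _).trans (add_le_add (hC₁ t ht x) (hC₂ t ht x)))
    (fun x => by rw [h₁.initial, h₂.initial]; linarith [h0 x]) ?_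
  · intro t ht x
    linarith [hmax t ht x]
  · intro t ht x
    have hop : levyOp (antipodal μ) (fun x => m₁ t x - m₂ t x) x
        = levyOp (antipodal μ) (m₁ t) x - levyOp (antipodal μ) (m₂ t) x := by
      simp only [levyOp, hlevy t ht x]
      exact integral_sub (h₁.integrable t ht x) (h₂.integrable t ht x)
    rw [deriv_fun_sub (h₁.differentiable_time t ht x) (h₂.differentiable_time t ht x),
      h₁.deriv_eq hb ht, h₂.deriv_eq hb ht, hop, hfd t ht x]
    have e1 : |(m₁ t x - m₂ t x) * divergence (b t) x| ≤ |m₁ t x - m₂ t x| * (d * B) := by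
      rw [abs_mul]
      gcongr
      refine (abs_divergence_le _ _).trans ?_
      gcongr
      exact hb.norm_fderiv_le (by norm_num) ht x
    have e2 : |(fderiv ℝ (m₁ t) x - fderiv ℝ (m₂ t) x) (b t x)|
        ≤ ‖fderiv ℝ (m₁ t) x - fderiv ℝ (m₂ t) x‖ * B := by
      refine ((fderiv ℝ (m₁ t) x - fderiv ℝ (m₂ t) x).le_opNorm (b t x)).trans ?_
      gcongr
      exact hb.norm_le ht x
    rw [sub_apply] at e2
    have e3 := (abs_le.1 e1).1
    have e4 := (abs_le.1 e2).1
    have e5 : 0 ≤ d * B * ‖fderiv ℝ (m₁ t) x - fderiv ℝ (m₂ t) x‖ := by positivity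
    have e6 : 0 ≤ B * |m₁ t x - m₂ t x| := by positivity
    nlinarith

/-- Pointwise continuity in time and constant mass give continuity into L¹ by Scheffé, which is
stronger than weak continuity. -/
lemma continuousOn_integral_mul {u : ℝ → RSpace d → ℝ} {I : Set ℝ}
    (hu : ContinuousOn (fun q : ℝ × RSpace d => u q.1 q.2) (I ×ˢ univ))
    (h0 : ∀ t ∈ I, ∀ x, 0 ≤ u t x) (h1 : ∀ t ∈ I, Integrable (u t) ∧ ∫ x, u t x = 1)
    (f : BoundedContinuousFunction (RSpace d) ℝ) :
    ContinuousOn (fun t => ∫ x, f x * u t x) I := by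
  intro t₀ ht₀
  have hs : Tendsto (fun t => ∫ x, |u t x - u t₀ x|) (𝓝[I] t₀) (𝓝 0) := by
    refine tendsto_integral_abs_sub_of_tendsto (c := 1)
      (eventually_nhdsWithin_of_forall fun t ht => ⟨(h1 t ht).1, h0 t ht, (h1 t ht).2⟩)
      (h1 t₀ ht₀).1 (h1 t₀ ht₀).2 (fun x => ?_) (h0 t₀ ht₀)
    exact (hu.comp (f := fun t : ℝ => (t, x)) (by fun_prop) fun t ht => ⟨ht, mem_univ _⟩) t₀ ht₀
  have hi : ∀ t ∈ I, Integrable fun x => f x * u t x := fun t ht =>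
    (h1 t ht).1.bdd_mul (c := ‖f‖) f.continuous.aestronglyMeasurable (ae_of_all _ f.norm_coe_le_norm)
  rw [ContinuousWithinAt, tendsto_iff_norm_sub_tendsto_zero]
  refine squeeze_zero' (Eventually.of_forall fun _ => norm_nonneg _)
    (eventually_nhdsWithin_of_forall fun t ht => ?_) (by simpa using hs.const_mul ‖f‖)
  rw [← integral_sub (hi t ht) (hi t₀ ht₀), ← integral_const_mul]
  refine norm_integral_le_of_norm_le (((h1 t ht).1.sub (h1 t₀ ht₀).1).abs.const_mul _)
    (ae_of_all _ fun x => ?_)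
  rw [← mul_sub, norm_mul, Real.norm_eq_abs (u t x - u t₀ x)]
  exact mul_le_mul_of_nonneg_right (f.norm_coe_le_norm x) (abs_nonneg _)

lemma SpaceDerivsBoundedBy.mono {c c' : ℝ} (h : SpaceDerivsBoundedBy 2 T c m) (hc : c ≤ c') :
    SpaceDerivsBoundedBy 2 T c' m :=
  ⟨h.contDiff, h.continuousOn, fun j hj t ht x => (h.bound j hj t ht x).trans hc⟩

theorem exists_fokkerPlanck_solution (d : ℕ) (T σ Λ c₀ : ℝ) (𝒦 : ℕ → ℝ → ℝ) (B M : ℝ)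
    (hT : 0 < T) :
    ∃ c : ℝ, ∀ (μ : Measure (RSpace d)) (b : ℝ → RSpace d → RSpace d) (m₀ : RSpace d → ℝ),
      LevyAssumptions T σ Λ c₀ 𝒦 μ → SpaceDerivsBoundedBy 2 T B b → IsInitialDensity M m₀ →
      ∃ m : ℝ → RSpace d → ℝ,
        IsClassicalSolution T μ b m₀ m ∧
        (∀ t ∈ Icc (0 : ℝ) T, ∀ x, 0 ≤ m t x) ∧
        (∀ t ∈ Icc (0 : ℝ) T, Integrable (m t) ∧ ∫ x, m t x = 1) ∧
        (∀ f : BoundedContinuousFunction (RSpace d) ℝ,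
          ContinuousOn (fun t => ∫ x, f x * m t x) (Icc (0 : ℝ) T)) ∧
        SpaceDerivsBoundedBy 2 T c m ∧
        (∀ t ∈ Ioo (0 : ℝ) T, ∀ x, |deriv (fun τ => m τ x) t| ≤ c) ∧
        (∀ m' : ℝ → RSpace d → ℝ, IsClassicalSolution T μ b m₀ m' →
          (∃ C : ℝ, ∀ t ∈ Icc (0 : ℝ) T, ∀ x, |m' t x| ≤ C) →
          ∀ t ∈ Icc (0 : ℝ) T, ∀ x, m' t x = m t x) := by
  -- The constant must be produced before the assumption that contains σ > 1; if that fails, no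
  -- admissible measure exists and any constant will do.
  by_cases hσ : 1 < σ
  swap
  · exact ⟨0, fun μ b m₀ hμ => absurd hμ.one_lt hσ⟩
  obtain ⟨c, hc⟩ := exists_isClassicalSolution d hT hσ 𝒦 B M
  refine ⟨max c (timeDerivBound d Λ B c), fun μ b m₀ hμ hb hm₀ => ?_⟩
  obtain ⟨m, hm, hmb, hmC, hmi⟩ := hc Λ c₀ μ b m₀ hμ hb hm₀
  have hν := hμ.levy_antipodal_lt
  have hpos : ∀ t ∈ Icc (0 : ℝ) T, ∀ x, 0 ≤ m t x :=
    -- Nonnegativity is comparison with the zero solution, so no positivity of the Neumann series is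
    -- needed.
    isClassicalSolution_zero.le_of_initial_le hν hT hb hm (C₁ := 0) (by simp) hmC hm₀.nonneg
  refine ⟨m, hm, hpos, hmi, continuousOn_integral_mul hm.continuousOn hpos hmi,
    hmb.mono (le_max_left _ _), fun t ht x =>
    (abs_deriv_le hμ.levy_antipodal hb hm hmb ht x).trans (le_max_right _ _), ?_⟩
  rintro m' hm' ⟨C, hC⟩ t ht x
  exact le_antisymm (hm'.le_of_initial_le hν hT hb hm hC hmC (fun _ => le_rfl) t ht x)
    (hm.le_of_initial_le hν hT hb hm' hmC hC (fun _ => le_rfl) t ht x)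

end

end

/-! ### The three statements assembled. -/

theorem proposition6p7 (d : ℕ) :
    -- (a) existence, uniqueness and bounds
    (∀ (T σ Λ c₀ : ℝ) (𝒦 : ℕ → ℝ → ℝ) (B M : ℝ), 0 < T →
      ∃ c : ℝ, ∀ (μ : Measure (RSpace d)) (b : ℝ → RSpace d → RSpace d) (m₀ : RSpace d → ℝ),
        LevyAssumptions T σ Λ c₀ 𝒦 μ → SpaceDerivsBoundedBy 2 T B b → IsInitialDensity M m₀ →
        ∃ m : ℝ → RSpace d → ℝ,
          IsClassicalSolution T μ b m₀ m ∧
          (∀ t ∈ Icc (0 : ℝ) T, ∀ x, 0 ≤ m t x) ∧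
          (∀ t ∈ Icc (0 : ℝ) T, Integrable (m t) ∧ ∫ x, m t x = 1) ∧
          (∀ f : BoundedContinuousFunction (RSpace d) ℝ,
            ContinuousOn (fun t => ∫ x, f x * m t x) (Icc (0 : ℝ) T)) ∧
          SpaceDerivsBoundedBy 2 T c m ∧
          (∀ t ∈ Ioo (0 : ℝ) T, ∀ x, |deriv (fun τ => m τ x) t| ≤ c) ∧
          (∀ m' : ℝ → RSpace d → ℝ, IsClassicalSolution T μ b m₀ m' →
            (∃ C : ℝ, ∀ t ∈ Icc (0 : ℝ) T, ∀ x, |m' t x| ≤ C) →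
            ∀ t ∈ Icc (0 : ℝ) T, ∀ x, m' t x = m t x)) ∧
    -- (b) uniform continuity of the solution and of its gradient
    (∀ Λ B N : ℝ, ∃ ω' : ℝ → ℝ, IsModulus ω' ∧
      ∀ (T σ c₀ : ℝ) (𝒦 : ℕ → ℝ → ℝ) (M : ℝ), 0 < T →
      ∀ (μ : Measure (RSpace d)) (b : ℝ → RSpace d → RSpace d) (m₀ : RSpace d → ℝ),
        LevyAssumptions T σ Λ c₀ 𝒦 μ → SpaceDerivsBoundedBy 2 T B b → IsInitialDensity M m₀ →
        ∀ m : ℝ → RSpace d → ℝ,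
          IsClassicalSolution T μ b m₀ m → SpaceDerivsBoundedBy 2 T N m →
          (∀ t ∈ Icc (0 : ℝ) T, Differentiable ℝ (m t)) ∧
          ∀ s ∈ Icc (0 : ℝ) T, ∀ t ∈ Icc (0 : ℝ) T, ∀ x y : RSpace d,
            |m t x - m s y| + ‖fderiv ℝ (m t) x - fderiv ℝ (m s) y‖
              ≤ ω' (|t - s| + ‖x - y‖)) ∧
    -- (c) uniform continuity of the terms of the equation
    (∀ (T σ Λ c₀ B N : ℝ) (ωb ωDb : ℝ → ℝ), 0 < T → IsModulus ωb → IsModulus ωDb →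
      ∃ ω : ℝ → ℝ, IsModulus ω ∧
      ∀ (𝒦 : ℕ → ℝ → ℝ) (M : ℝ)
        (μ : Measure (RSpace d)) (b : ℝ → RSpace d → RSpace d) (m₀ : RSpace d → ℝ),
        LevyAssumptions T σ Λ c₀ 𝒦 μ → SpaceDerivsBoundedBy 2 T B b → IsInitialDensity M m₀ →
        (∀ s ∈ Ioo (0 : ℝ) T, ∀ t ∈ Ioo (0 : ℝ) T, ∀ x y : RSpace d,
          ‖b t x - b s y‖ ≤ ωb (|t - s| + ‖x - y‖) ∧
          ‖fderiv ℝ (b t) x - fderiv ℝ (b s) y‖ ≤ ωDb (|t - s| + ‖x - y‖)) →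
        ∀ m : ℝ → RSpace d → ℝ,
          IsClassicalSolution T μ b m₀ m → SpaceDerivsBoundedBy 2 T N m →
          (∀ t ∈ Icc (0 : ℝ) T, ∀ x,
            Integrable (levyIntegrand (m t) x) (antipodal μ) ∧
            DifferentiableWithinAt ℝ (fun τ => m τ x) (Icc (0 : ℝ) T) t) ∧
          ∀ s ∈ Icc (0 : ℝ) T, ∀ t ∈ Icc (0 : ℝ) T, ∀ x y : RSpace d,
            |levyOp (antipodal μ) (m t) x - levyOp (antipodal μ) (m s) y|
              + |derivWithin (fun τ => m τ x) (Icc (0 : ℝ) T) t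
                  - derivWithin (fun τ => m τ y) (Icc (0 : ℝ) T) s|
              ≤ ω (|t - s| + ‖x - y‖)) := by
  refine ⟨fun T σ Λ c₀ 𝒦 B M hT => exists_fokkerPlanck_solution d T σ Λ c₀ 𝒦 B M hT,
    exists_modulus_solution_gradient d, fun T σ Λ c₀ B N ωb ωDb hT hωb hωDb =>
      exists_modulus_equation_terms d T σ Λ c₀ B N ωb ωDb hT hωb hωDb⟩
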